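/- Let $d\in\{2,3\}$, $\Omega=(0,1)^d$, $T>0$, and let $\langle\cdot,\cdot\rangle$ be the $L^2(\Omega)$ scalar product. Let $(\mathsf u,\mathsf p)$ solve the Stokes problem $\mathsf u_t-\Delta\mathsf u+\nabla\mathsf p=f$, $\nabla\cdot\mathsf u=0$ in $\Omega$, $\mathsf u|_{\partial\Omega}=0$, on $[0,T]$, with a source $f$ that is smooth in time ($f\in W^{3,\infty}((0,T);\mathbf L^2(\Omega))$ suffices). *Notation.* For $\tau>0$ let $Bv=\partial_{xxyy}v$ if $d=2$ and $Bv=(\partial_{xxyy}+\partial_{yyzz}+\partial_{zzxx}-\frac\tau2\partial_{xxyyzz})v$ if $d=3$, with $D(B)=\{v\in\mathbf H^1_0(\Omega): Bv\in\mathbf L^2(\Omega)\}$ normed by the graph norm. Let $\mathbf Z$ be the space of $v\in\mathbf H^1_0(\Omega)$ all of whose derivatives of order at most one in each variable are in $\mathbf L^2(\Omega)$, with $\|v\|_{\mathbf Z}^2=\|\partial_{xy}v\|^2_{\mathbf L^2}$ if $d=2$ and $\|v\|_{\mathbf Z}^2=\|\partial_{xy}v\|^2_{\mathbf L^2}+\|\partial_{yz}v\|^2_{\mathbf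 L^2}+\|\partial_{xz}v\|^2_{\mathbf L^2}+\frac\tau2\|\partial_{xyz}v\|^2_{\mathbf L^2}$ if $d=3$. Let $Y$ be the space of $q\in L^2(\Omega)$ of zero mean all of whose derivatives of order at most one in each variable are in $L^2(\Omega)$. Let $A=(1-\partial_{xx})(1-\partial_{yy})$ if $d=2$ and $A=(1-\partial_{xx})(1-\partial_{yy})(1-\partial_{zz})$ if $d=3$, acting on functions of zero mean, each factor being taken with homogeneous Neumann conditions on the two faces orthogonal to its direction. For $q\in H^1(\Omega)$ put $\|q\|_\triangle=\sup_{0\ne v\in\mathbf Z}\langle\nabla q,v\rangle/\|v\|_{\mathbf Z}$. *Scheme* (standard form, time step $\tau>0$, $t_s=s\tau$, $f^{k+1/2}=f(t_{k+1/2})$). Set $u^0=\mathsf u(0)$, $p^{-1/2}=\mathsf p(0)$, and let $\phi^{-1/2}$ be given. For $k\ge0$ put $p^{\star,k+1/2}=p^{k-1/2}+\phi^{k-1/2}$ and compute $u^{k+1}$ as follows. If $d=2$: $$\tfrac{u^{k+1/2}-u^k}{\tau/2}-\partial_{xx}u^{k+1/2}-\partial_{yy}u^k+\nabla p^{\star,k+1/2}=f^{k+1/2},\quad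 u^{k+1/2}|_{x=0,1}=0,$$ $$\tfrac{u^{k+1}-u^{k+1/2}}{\tau/2}-\partial_{xx}u^{k+1/2}-\partial_{yy}u^{k+1}+\nabla p^{\star,k+1/2}=f^{k+1/2},\quad u^{k+1}|_{y=0,1}=0.$$ If $d=3$: $$\tfrac{\xi^{k+1}-u^k}{\tau}-\Delta u^k+\nabla p^{\star,k+1/2}=f^{k+1/2},$$ $$\tfrac{\eta^{k+1}-\xi^{k+1}}{\tau}-\tfrac12\partial_{xx}(\eta^{k+1}-u^k)=0,\quad \eta^{k+1}|_{x=0,1}=0,$$ $$\tfrac{\zeta^{k+1}-\eta^{k+1}}{\tau}-\tfrac12\partial_{yy}(\zeta^{k+1}-u^k)=0,\quad \zeta^{k+1}|_{y=0,1}=0,$$ $$\tfrac{u^{k+1}-\zeta^{k+1}}{\tau}-\tfrac12\partial_{zz}(u^{k+1}-u^k)=0,\quad u^{k+1}|_{z=0,1}=0.$$ Then solve $A\phi^{k+1/2}=-\frac1\tau\nabla\cdot u^{k+1}$ and set $p^{k+1/2}=p^{k-1/2}+\phi^{k+1/2}$. The pressure error is $\epsilon^{k+1/2}=\mathsf p(t_{k+1/2})-p^{k+1/2}$.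 **Theorem.** Assume that $\mathsf u\in W^{3,\infty}((0,T);\mathbf H^2(\Omega))$, that $\mathsf u\in W^{2,\infty}((0,T);D(B))$ (for every $\tau>0$, if $d=3$), and that $\mathsf p\in W^{3,\infty}((0,T);Y)$. Let $c_0$ be a constant. Then there is a constant $c$, depending on $T$, $f$, $(\mathsf u,\mathsf p)$ and $c_0$ but not on $\tau$ or on the discrete solution, such that for every $\tau>0$, every $\phi^{-1/2}$ with $$\|\mathsf p(\tfrac\tau2)-p^{\star,1/2}\|_{L^2}\le c_0\tau,$$ every corresponding solution of the scheme and every $N$ such that $t_{k+1/2}\in[0,T]$ for all $k<N$, the errors $\epsilon^{k+1/2}$, $k<N$, are in $H^1(\Omega)$ and $$\|\epsilon_\tau\|_{\ell^2(\triangle)}=\Big(\tau\sum_{k=0}^{N-1}\|\epsilon^{k+1/2}\|_\triangle^2\Big)^{1/2}\le c\,\tau .$$ -/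

import Mathlib

open MeasureTheory Set
open scoped ENNReal ContDiff

namespace DirSplit

/-! ### The domain, `L²`, and weak derivatives -/

/-- The open unit cube `Ω = (0,1)^d`. -/
def cube (d : ℕ) : Set (Fin d → ℝ) := Set.univ.pi fun _ => Ioo (0 : ℝ) 1

/-- Lebesgue measure on `Ω`. -/
noncomputable abbrev vol (d : ℕ) : Measure (Fin d → ℝ) := volume.restrict (cube d)

/-- The Hilbert space `L²(Ω)` of real functions. -/
noncomputable abbrev L2 (d : ℕ) : Type := Lp ℝ 2 (vol d)

/-- Vector fields with components in `L²(Ω)`. -/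
abbrev Vec (d : ℕ) : Type := Fin d → L2 d

/-- The first-order multi-index in direction `i`. -/
def unitIdx {d : ℕ} (i : Fin d) : Fin d → ℕ := Pi.single i 1

/-- The classical partial derivative `∂_i ψ`. -/
noncomputable def pderiv {d : ℕ} (i : Fin d) (ψ : (Fin d → ℝ) → ℝ) : (Fin d → ℝ) → ℝ :=
  fun x => fderiv ℝ ψ x (Pi.single i 1)

/-- The classical partial derivative `∂^α ψ` for a multi-index `α`. -/
noncomputable def mderiv {d : ℕ} (α : Fin d → ℕ) (ψ : (Fin d → ℝ) → ℝ) : (Fin d → ℝ) → ℝ :=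
  (List.finRange d).foldr (fun i χ => (pderiv i)^[α i] χ) ψ

/-- Smooth functions with compact support in `Ω`. -/
def IsTest {d : ℕ} (ψ : (Fin d → ℝ) → ℝ) : Prop :=
  ContDiff ℝ ∞ ψ ∧ HasCompactSupport ψ ∧ tsupport ψ ⊆ cube d

/-- `g = ∂^α u` in the sense of distributions on `Ω`. -/
def HasWD {d : ℕ} (α : Fin d → ℕ) (u g : L2 d) : Prop :=
  ∀ ψ : (Fin d → ℝ) → ℝ, IsTest ψ →
    ∫ x in cube d, u x * mderiv α ψ x = (-1) ^ (∑ i, α i) * ∫ x in cube d, g x * ψ x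

/-- `g = ∂_i u` in `Ω` and `u` vanishes on the two faces `x_i = 0` and `x_i = 1`.
The vanishing of the trace is expressed by Green's formula: there is no boundary term, although
the smooth function `ψ` is not required to vanish on the boundary of `Ω`. -/
def HasWDZeroTrace {d : ℕ} (i : Fin d) (u g : L2 d) : Prop :=
  ∀ ψ : (Fin d → ℝ) → ℝ, ContDiff ℝ ∞ ψ → HasCompactSupport ψ →
    ∫ x in cube d, u x * pderiv i ψ x = - ∫ x in cube d, g x * ψ x

/-- The weak derivative `∂^α u` exists in `L²(Ω)`. -/
def WDiff {d : ℕ} (α : Fin d → ℕ) (u : L2 d) : Prop := ∃ g, HasWD α u g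

open Classical in
/-- The weak derivative `∂^α u` (zero if it does not exist in `L²(Ω)`). -/
noncomputable def wd {d : ℕ} (α : Fin d → ℕ) (u : L2 d) : L2 d :=
  if h : WDiff α u then h.choose else 0

/-- `g = ∇·u` in the sense of distributions. -/
def HasWeakDiv {d : ℕ} (u : Vec d) (g : L2 d) : Prop :=
  ∀ ψ : (Fin d → ℝ) → ℝ, IsTest ψ →
    ∑ i, ∫ x in cube d, u i x * pderiv i ψ x = - ∫ x in cube d, g x * ψ x

/-- `g = Δ u` in the sense of distributions. -/
def HasWeakLaplacian {d : ℕ} (u g : L2 d) : Prop :=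
  ∀ ψ : (Fin d → ℝ) → ℝ, IsTest ψ →
    ∫ x in cube d, u x * (∑ i, pderiv i (pderiv i ψ) x) = ∫ x in cube d, g x * ψ x

/-- Zero mean over `Ω`. -/
def MeanZero {d : ℕ} (q : L2 d) : Prop := ∫ x in cube d, q x = 0

/-- Membership in `H¹(Ω)`. -/
def InH1 {d : ℕ} (q : L2 d) : Prop := ∀ i, WDiff (unitIdx i) q

/-- Membership in `H¹₀(Ω)`, the closure of the test functions in the norm of `H¹(Ω)`. -/
def InH10 {d : ℕ} (v : L2 d) : Prop :=
  ∃ g : Fin d → L2 d, (∀ i, HasWD (unitIdx i) v (g i)) ∧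
    ∀ ε : ℝ≥0∞, 0 < ε → ∃ ψ : (Fin d → ℝ) → ℝ, IsTest ψ ∧
      eLpNorm (fun x => v x - ψ x) 2 (vol d) < ε ∧
      ∀ i, eLpNorm (fun x => g i x - pderiv i ψ x) 2 (vol d) < ε

/-! ### The velocity operator `B`, the space `Z` and the norm `‖·‖_△` -/

/-- The differential operator `B` on smooth functions:
`∂_xxyy` for `d = 2`, `∂_xxyy + ∂_yyzz + ∂_zzxx - (τ/2) ∂_xxyyzz` for `d = 3`. -/
noncomputable def opB : (d : ℕ) → ℝ → ((Fin d → ℝ) → ℝ) → (Fin d → ℝ) → ℝ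
  | 2, _, ψ => mderiv ![2, 2] ψ
  | 3, τ, ψ => fun x => mderiv ![2, 2, 0] ψ x + mderiv ![0, 2, 2] ψ x + mderiv ![2, 0, 2] ψ x
      - τ / 2 * mderiv ![2, 2, 2] ψ x
  | _, _, _ => 0

/-- `g = B v` in the sense of distributions (`B` is formally self-adjoint). -/
def HasB {d : ℕ} (τ : ℝ) (v g : Vec d) : Prop :=
  ∀ i, ∀ ψ : (Fin d → ℝ) → ℝ, IsTest ψ →
    ∫ x in cube d, v i x * opB d τ ψ x = ∫ x in cube d, g i x * ψ x

/-- The Hilbert space `Z`: fields in `H¹₀(Ω)` whose mixed derivatives, of order at most one in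
each variable, lie in `L²(Ω)`. -/
def InZ {d : ℕ} (v : Vec d) : Prop :=
  ∀ i, InH10 (v i) ∧ ∀ α : Fin d → ℕ, (∀ j, α j ≤ 1) → WDiff α (v i)

/-- The square of the norm `‖v‖_Z = ‖v‖_B`. -/
noncomputable def normBSq : (d : ℕ) → ℝ → Vec d → ℝ
  | 2, _, v => ∑ i, ‖wd ![1, 1] (v i)‖ ^ 2
  | 3, τ, v => ∑ i, (‖wd ![1, 1, 0] (v i)‖ ^ 2 + ‖wd ![0, 1, 1] (v i)‖ ^ 2
      + ‖wd ![1, 0, 1] (v i)‖ ^ 2 + τ / 2 * ‖wd ![1, 1, 1] (v i)‖ ^ 2)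
  | _, _, _ => 0

/-- The norm `‖q‖_△ = sup_{0 ≠ v ∈ Z} ⟨∇q, v⟩ / ‖v‖_Z` of `q ∈ H¹(Ω)`. -/
noncomputable def triNorm {d : ℕ} (τ : ℝ) (q : L2 d) : ℝ≥0∞ :=
  ⨆ v : {v : Vec d // InZ v ∧ v ≠ 0},
    ENNReal.ofReal ((∑ i, inner ℝ (wd (unitIdx i) q) (v.1 i)) / √(normBSq d τ v.1))

/-- The norm `(τ ∑_{k<N} ‖q^k‖_△²)^{1/2}` of a finite sequence. -/
noncomputable def ellTwoTri {d : ℕ} (τ : ℝ) (N : ℕ) (q : ℕ → L2 d) : ℝ≥0∞ :=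
  (ENNReal.ofReal τ * ∑ k ∈ Finset.range N, triNorm τ (q k) ^ 2) ^ (1 / 2 : ℝ)

/-! ### Regularity in time -/

/-- `ψ ∈ W^{m,∞}((0,T);E)`, for the representative defined at every point of `[0,T]`: each
derivative of order less than `m` is the integral of the next one, all are in `L^∞((0,T);E)`. -/
def MemWInfty {E : Type*} [NormedAddCommGroup E] [NormedSpace ℝ E] [CompleteSpace E]
    (m : ℕ) (T : ℝ) (ψ : ℝ → E) : Prop :=
  ∃ D : ℕ → ℝ → E, (∀ t ∈ Icc 0 T, D 0 t = ψ t) ∧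
    (∀ j ≤ m, MemLp (D j) ∞ (volume.restrict (Ioo 0 T))) ∧
    ∀ j < m, ∀ t ∈ Icc 0 T, D j t = D j 0 + ∫ r in (0 : ℝ)..t, D (j + 1) r

/-- The weak space derivative `∂^α w(t)` exists for all `t` and is in `W^{m,∞}((0,T);L²(Ω))`. -/
def DerivMemWInfty {d : ℕ} (m : ℕ) (T : ℝ) (α : Fin d → ℕ) (w : ℝ → L2 d) : Prop :=
  ∃ W : ℝ → L2 d, (∀ t ∈ Icc 0 T, HasWD α (w t) (W t)) ∧ MemWInfty m T W

/-- `u ∈ W^{m,∞}((0,T);H²(Ω))`. -/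
def MemWInftyH2 {d : ℕ} (m : ℕ) (T : ℝ) (u : ℝ → Vec d) : Prop :=
  ∀ i, ∀ α : Fin d → ℕ, ∑ j, α j ≤ 2 → DerivMemWInfty m T α fun t => u t i

/-- `u ∈ W^{m,∞}((0,T);D(B))` with `D(B) = {v ∈ H¹₀(Ω) : B v ∈ L²(Ω)}` under the graph norm. -/
def MemWInftyDB {d : ℕ} (τ : ℝ) (m : ℕ) (T : ℝ) (u : ℝ → Vec d) : Prop :=
  (∀ t ∈ Icc 0 T, ∀ i, InH10 (u t i)) ∧ (∀ i, MemWInfty m T fun t => u t i) ∧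
    ∃ Bu : ℝ → Vec d, (∀ t ∈ Icc 0 T, HasB τ (u t) (Bu t)) ∧ ∀ i, MemWInfty m T fun t => Bu t i

/-- `p ∈ W^{m,∞}((0,T);Y)`, where `Y` consists of the functions of zero mean whose derivatives of
order at most one in each variable lie in `L²(Ω)`. -/
def MemWInftyY {d : ℕ} (m : ℕ) (T : ℝ) (p : ℝ → L2 d) : Prop :=
  (∀ t ∈ Icc 0 T, MeanZero (p t)) ∧
    ∀ α : Fin d → ℕ, (∀ j, α j ≤ 1) → DerivMemWInfty m T α p

/-! ### The Stokes problem -/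

/-- `∂_t u - Δu + ∇p = f`, `∇·u = 0`, `u = 0` on the boundary. -/
structure IsStokesSolution {d : ℕ} (T : ℝ) (f u : ℝ → Vec d) (p : ℝ → L2 d) : Prop where
  momentum : ∀ t ∈ Ioc 0 T, ∀ i, ∃ lap grad : L2 d,
    HasWeakLaplacian (u t i) lap ∧ HasWD (unitIdx i) (p t) grad ∧
      HasDerivWithinAt (fun s => u s i) (f t i + lap - grad) (Icc 0 T) t
  incompressible : ∀ t ∈ Icc 0 T, HasWeakDiv (u t) 0
  boundary : ∀ t ∈ Ioc 0 T, ∀ i, InH10 (u t i)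

/-! ### The direction splitting scheme -/

/-- `h = ∂_ii u ∈ L²(Ω)` and `u = 0` on the faces `x_i = 0, 1`. -/
def Dirichlet1D {d : ℕ} (i : Fin d) (u h : L2 d) : Prop :=
  ∃ g : L2 d, HasWDZeroTrace i u g ∧ HasWD (unitIdx i) g h

/-- `h = ∂_ii q ∈ L²(Ω)` and `∂_i q = 0` on the faces `x_i = 0, 1`. -/
def Neumann1D {d : ℕ} (i : Fin d) (q h : L2 d) : Prop :=
  ∃ g : L2 d, HasWD (unitIdx i) q g ∧ HasWDZeroTrace i g h

/-- `φ ∈ D(A)` and `A φ = g`, with `A = (1 - ∂_xx)(1 - ∂_yy)` for `d = 2` and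
`A = (1 - ∂_xx)(1 - ∂_yy)(1 - ∂_zz)` for `d = 3`, each factor with homogeneous Neumann
conditions in its own direction. -/
def HasA : (d : ℕ) → L2 d → L2 d → Prop
  | 2, φ, g => MeanZero φ ∧ ∃ a b : L2 2, Neumann1D 1 φ a ∧ Neumann1D 0 (φ - a) b ∧
      φ - a - b = g
  | 3, φ, g => MeanZero φ ∧ ∃ a b c : L2 3, Neumann1D 2 φ a ∧ Neumann1D 1 (φ - a) b ∧
      Neumann1D 0 (φ - a - b) c ∧ φ - a - b - c = g
  | _, _, _ => False

/-- One velocity step `u ↦ u'` with pressure gradient `G` and source `F`: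
the scheme of Peaceman and Rachford for `d = 2`, that of Douglas for `d = 3`. The first
intermediate field `ξ` of the latter is given explicitly, so no boundary condition is put on it. -/
def VelocityStep : (d : ℕ) → ℝ → Vec d → Vec d → Vec d → Vec d → Prop
  | 2, τ, G, F, u, u' => ∃ uh : Vec 2, ∀ i, ∃ uhxx uyy uyy' : L2 2,
      Dirichlet1D 0 (uh i) uhxx ∧ HasWD ![0, 2] (u i) uyy ∧ Dirichlet1D 1 (u' i) uyy' ∧
      (τ / 2)⁻¹ • (uh i - u i) - uhxx - uyy + G i = F i ∧
      (τ / 2)⁻¹ • (u' i - uh i) - uhxx - uyy' + G i = F i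
  | 3, τ, G, F, u, u' => ∃ ξ η ζ : Vec 3, ∀ i, ∃ uxx uyy uzz ηxx ζyy uzz' : L2 3,
      HasWD ![2, 0, 0] (u i) uxx ∧ HasWD ![0, 2, 0] (u i) uyy ∧ HasWD ![0, 0, 2] (u i) uzz ∧
      Dirichlet1D 0 (η i) ηxx ∧ Dirichlet1D 1 (ζ i) ζyy ∧ Dirichlet1D 2 (u' i) uzz' ∧
      τ⁻¹ • (ξ i - u i) - (uxx + uyy + uzz) + G i = F i ∧
      τ⁻¹ • (η i - ξ i) - (1 / 2 : ℝ) • (ηxx - uxx) = 0 ∧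
      τ⁻¹ • (ζ i - η i) - (1 / 2 : ℝ) • (ζyy - uyy) = 0 ∧
      τ⁻¹ • (u' i - ζ i) - (1 / 2 : ℝ) • (uzz' - uzz) = 0
  | _, _, _, _, _, _ => False

/-- The first `N` steps of the standard scheme (`χ = 0`) with time step `τ`, source `f`, initial
velocity `u₀` and initial pressure `p₀`. Here `u k = u^k`, while `p k = p^{k-1/2}` and
`φ k = φ^{k-1/2}`; the value `φ 0` is the user's choice. -/
structure IsStandardScheme {d : ℕ} (τ : ℝ) (N : ℕ) (f : ℝ → Vec d) (u₀ : Vec d) (p₀ : L2 d)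
    (u : ℕ → Vec d) (p φ : ℕ → L2 d) : Prop where
  initial_velocity : u 0 = u₀
  initial_pressure : p 0 = p₀
  /-- The velocity update, with the pressure predictor `p^{⋆,k+1/2} = p^{k-1/2} + φ^{k-1/2}`. -/
  velocity : ∀ k < N, ∃ G : Vec d, (∀ i, HasWD (unitIdx i) (p k + φ k) (G i)) ∧
    VelocityStep d τ G (f ((k + 1 / 2 : ℝ) * τ)) (u k) (u (k + 1))
  /-- The penalty step `A φ^{k+1/2} = - τ⁻¹ ∇·u^{k+1}`. -/
  penalty : ∀ k < N, ∃ g : L2 d, HasWeakDiv (u (k + 1)) g ∧ HasA d (φ (k + 1)) (-(τ⁻¹ • g))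
  /-- The pressure update. -/
  pressure : ∀ k < N, p (k + 1) = p k + φ (k + 1)

end DirSplit

open DirSplit

/-! Velocities are expanded in products of sines and pressures in products of cosines, so that every
operator of the scheme becomes a multiplier. Eliminating the intermediate fields leaves
Crank-Nicolson with the additional splitting term `τ/4 B (u' - u)` (`VelocityStep.coef_eq`). The
errors then solve a Hilbert space recursion with a velocity error `E`, a pressure error `α` measured
through the square root of `A`, exact pressure increments `δ` and a residual `R`. The penalty step
says that `τ⁻¹ D E` is the increment `φ` in these coordinates, and `‖D x‖ ≤ ‖J x‖` because `A`
dominates `-Δ`.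

Testing a step with `E (k+1) + E k` gives an exact balance for an energy containing two consecutive
pressure errors (`energy_identity`). This energy is coercive in spite of its negative term
(`IsSplitting.energy_bounds`).

The norm `‖·‖_△` is dual to the norm of `Z`, so the pressure error is read off from the momentum
equation: it is bounded by `τ⁻¹ ‖J (E (k+1) - E k)‖`, `‖G (E (k+1) + E k)‖`, `τ ‖Z (E (k+1) - E k)‖`
and the residual (`IsSplitting.pressure_bound_of_stepBounds`). First order in `ℓ²` follows from the
sums in `StepBounds`, and these are proved by writing the error as a sum of two parts.

The forced part carries the residual and smooth pressure increments. Its time differences solve the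
same recursion with data of order `τ²`, which gives increments of order `τ²`
(`IsSplitting.forced_bounds`). The start-up part carries the arbitrary `φ^{-1/2}`, of which only an
`L²` bound is known, and the irregular first pressure increment. It is homogeneous after the first
step, with energy of order `τ³` only. Differences of such an energy bound are too weak, so a second
test with `E (k+1) - E k` supplies the sum of the squared increments (`IsSplitting.increment_step`,
`IsSplitting.homogeneous_bounds`).

The rest realizes the abstract setting: completeness of the trigonometric systems
(`eq_zero_of_coef_eq_zero`), passage from test functions to sines and cosines (`weak_identity`),
consistency of order `τ²` (`exists_consistency`), and the proof that the discrete velocities are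
regular enough to be elements of the abstract space (`IsSpectral.exists_emb_eq_of_step`). -/

namespace DirSplit

/-! ### An abstract penalty scheme in Hilbert spaces -/

section Abstract

variable {V H P : Type*}
  [NormedAddCommGroup V] [InnerProductSpace ℝ V]
  [NormedAddCommGroup H] [InnerProductSpace ℝ H]
  [NormedAddCommGroup P] [InnerProductSpace ℝ P]

/-- The operators of the abstract scheme: `J` embeds the velocities into `L²`, `G` is the gradient,
`Z` carries the norm of the splitting term and `D` is the divergence. -/
structure IsSplitting (τ : ℝ) (J G Z : V →L[ℝ] H) (D : V →L[ℝ] P) : Prop where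
  inner_eq : ∀ x y, inner ℝ x y = inner ℝ (J x) (J y) + τ / 2 * inner ℝ (G x) (G y)
    + τ ^ 2 / 4 * inner ℝ (Z x) (Z y)
  div_le : ∀ x, ‖D x‖ ≤ ‖J x‖
  emb_le : ∀ x, ‖J x‖ ≤ ‖G x‖
  grad_le : ∀ x, ‖G x‖ ≤ ‖Z x‖

/-- The weak form of the velocity step from `e` to `e'`, tested with `v`. -/
noncomputable def momentum (τ : ℝ) (J G Z : V →L[ℝ] H) (e e' v : V) : ℝ :=
  τ⁻¹ * inner ℝ (J (e' - e)) (J v) + 1 / 2 * inner ℝ (G (e' + e)) (G v)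
    + τ / 4 * inner ℝ (Z (e' - e)) (Z v)

/-- The discrete energy. -/
noncomputable def energy (τ : ℝ) (J Z : V →L[ℝ] H) (D : V →L[ℝ] P) (e : V) (α : P) : ℝ :=
  ‖J e‖ ^ 2 + τ ^ 2 / 4 * ‖Z e‖ ^ 2
    + τ ^ 2 * (1 / 2 * ‖α‖ ^ 2 + 1 / 2 * ‖α + τ⁻¹ • D e‖ ^ 2 - ‖τ⁻¹ • D e‖ ^ 2)

/-- With `φ = τ⁻¹ • D e`, the negative term is absorbed by `‖J e‖²`, since `τ ‖φ‖ ≤ ‖J e‖`. What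
remains bounds `α` and `α + φ`, hence their difference `φ`, and this in turn gives back control of
`‖J e‖`. -/
lemma IsSplitting.energy_bounds {τ : ℝ} {J G Z : V →L[ℝ] H} {D : V →L[ℝ] P}
    (h : IsSplitting τ J G Z D) (hτ : 0 < τ) (e : V) (α : P) :
    0 ≤ energy τ J Z D e α ∧ ‖J e‖ ≤ 3 * √(energy τ J Z D e α) ∧
    τ * ‖Z e‖ ≤ 2 * √(energy τ J Z D e α) ∧
    τ * ‖α‖ ≤ 2 * √(energy τ J Z D e α) ∧
    τ * ‖(2 : ℝ) • α + τ⁻¹ • D e‖ ≤ 2 * √(energy τ J Z D e α) ∧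
    τ * ‖τ⁻¹ • D e‖ ≤ ‖J e‖ := by
  have hφ : τ * ‖τ⁻¹ • D e‖ ≤ ‖J e‖ := by
    rw [norm_smul, Real.norm_of_nonneg (by positivity), ← mul_assoc, mul_inv_cancel₀ hτ.ne', one_mul]
    exact h.div_le e
  set φ := τ⁻¹ • D e with hφd
  set W := energy τ J Z D e α with hW
  have hWe : W = ‖J e‖ ^ 2 + τ ^ 2 / 4 * ‖Z e‖ ^ 2
    + τ ^ 2 * (1 / 2 * ‖α‖ ^ 2 + 1 / 2 * ‖α + φ‖ ^ 2 - ‖φ‖ ^ 2) := rfl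
  have h1 : (τ * ‖φ‖) ^ 2 ≤ ‖J e‖ ^ 2 := pow_le_pow_left₀ (by positivity) hφ 2
  have hZ : 0 ≤ τ ^ 2 / 4 * ‖Z e‖ ^ 2 := by positivity
  have hA : 0 ≤ τ ^ 2 * ‖α‖ ^ 2 := by positivity
  have hB : 0 ≤ τ ^ 2 * ‖α + φ‖ ^ 2 := by positivity
  have hn : ‖φ‖ ≤ ‖α + φ‖ + ‖α‖ := by
    have := norm_sub_le (α + φ) α
    simpa using this
  have hn2 : ‖φ‖ ^ 2 ≤ 2 * (‖α + φ‖ ^ 2 + ‖α‖ ^ 2) := by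
    nlinarith [norm_nonneg φ, norm_nonneg α, norm_nonneg (α + φ), sq_nonneg (‖α + φ‖ - ‖α‖)]
  have hm : ‖(2 : ℝ) • α + φ‖ ≤ ‖α + φ‖ + ‖α‖ := by
    have := norm_add_le (α + φ) α
    have h2 : (2 : ℝ) • α + φ = α + φ + α := by rw [two_smul]; abel
    rwa [h2]
  have hm2 : ‖(2 : ℝ) • α + φ‖ ^ 2 ≤ 2 * (‖α + φ‖ ^ 2 + ‖α‖ ^ 2) := by
    nlinarith [norm_nonneg ((2 : ℝ) • α + φ), norm_nonneg α, norm_nonneg (α + φ),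
      sq_nonneg (‖α + φ‖ - ‖α‖)]
  have hn3 : τ ^ 2 * ‖φ‖ ^ 2 ≤ τ ^ 2 * (2 * (‖α + φ‖ ^ 2 + ‖α‖ ^ 2)) := by gcongr
  have hm3 : τ ^ 2 * ‖(2 : ℝ) • α + φ‖ ^ 2 ≤ τ ^ 2 * (2 * (‖α + φ‖ ^ 2 + ‖α‖ ^ 2)) := by gcongr
  have hW0 : 0 ≤ W := by rw [hWe]; nlinarith
  have key : ∀ x c : ℝ, 0 ≤ c → x ^ 2 ≤ c ^ 2 * W → x ≤ c * √W := by
    intro x c hc hx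
    have : x ≤ √(c ^ 2 * W) := Real.le_sqrt_of_sq_le hx
    rwa [Real.sqrt_mul (by positivity), Real.sqrt_sq hc] at this
  refine ⟨hW0, key _ _ (by norm_num) ?_, key _ _ (by norm_num) ?_, key _ _ (by norm_num) ?_,
    key _ _ (by norm_num) ?_, hφ⟩
  all_goals rw [hWe]; nlinarith

/-- The test function `e' + e` turns the `J` and `Z` terms into differences of squares. The pressure
pairing becomes a difference of pressure energies plus dissipation, because the new pressure error
plus the new `φ` equals `α + δ`: the two squares in the energy belong to consecutive pressure
errors. -/
lemma energy_identity {τ : ℝ} (hτ : 0 < τ) (J G Z : V →L[ℝ] H) (D : V →L[ℝ] P)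
    (e e' : V) (α δ : P) (R : H)
    (h : momentum τ J G Z e e' (e' + e) =
      inner ℝ R (J (e' + e)) + inner ℝ (α + δ - τ⁻¹ • D e) (D (e' + e))) :
    energy τ J Z D e' (α + δ - τ⁻¹ • D e') + τ / 2 * ‖G (e' + e)‖ ^ 2
        + τ ^ 2 / 2 * ‖τ⁻¹ • D e' + τ⁻¹ • D e‖ ^ 2 =
      energy τ J Z D e α + τ * inner ℝ R (J (e' + e))
        + τ ^ 2 * (inner ℝ ((2 : ℝ) • α + τ⁻¹ • D e) δ + ‖δ‖ ^ 2) := by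
  have hD : D (e' + e) = τ • (τ⁻¹ • D e' + τ⁻¹ • D e) := by
    rw [smul_add, smul_smul, smul_smul, mul_inv_cancel₀ hτ.ne', one_smul, one_smul, map_add]
  rw [hD] at h
  unfold energy momentum at *
  generalize τ⁻¹ • D e' = z at *
  generalize τ⁻¹ • D e = y at *
  have h' := congrArg (τ * ·) h
  simp only [mul_add, ← mul_assoc, mul_inv_cancel₀ hτ.ne', one_mul] at h'
  have hz : α + δ - z + z = α + δ := by abel
  rw [hz]
  simp only [← real_inner_self_eq_norm_sq, map_add, map_sub, inner_add_left, inner_add_right,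
    inner_sub_left, inner_sub_right, inner_smul_left, inner_smul_right, RCLike.conj_to_real]
    at h' ⊢
  rw [real_inner_comm (J e) (J e'), real_inner_comm (G e) (G e'), real_inner_comm (Z e) (Z e')] at h'
  rw [real_inner_comm (G e) (G e')]
  simp only [real_inner_comm α z, real_inner_comm α y, real_inner_comm δ z, real_inner_comm δ y,
    real_inner_comm α δ, real_inner_comm y z] at h' ⊢
  linear_combination h'

lemma le_add_of_sq_sub_sq_le {x y g h : ℝ} (hy : 0 ≤ y) (hg : 0 ≤ g) (hh : 0 ≤ h)
    (H : x ^ 2 ≤ y ^ 2 + g * (x + y) + h ^ 2) : x ≤ y + (g + h) := by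
  by_contra! hc
  nlinarith [mul_nonneg hh hy, mul_nonneg hg hh]

lemma IsSplitting.energy_step {τ : ℝ} {J G Z : V →L[ℝ] H} {D : V →L[ℝ] P}
    (h : IsSplitting τ J G Z D) (hτ : 0 < τ) (e e' : V) (α δ : P) (R : H)
    (hm : momentum τ J G Z e e' (e' + e) =
      inner ℝ R (J (e' + e)) + inner ℝ (α + δ - τ⁻¹ • D e) (D (e' + e))) :
    energy τ J Z D e' (α + δ - τ⁻¹ • D e') + τ / 2 * ‖G (e' + e)‖ ^ 2 ≤
      energy τ J Z D e α + (3 * τ * ‖R‖ + 2 * τ * ‖δ‖) *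
        (√(energy τ J Z D e' (α + δ - τ⁻¹ • D e')) + √(energy τ J Z D e α))
        + (τ * ‖δ‖) ^ 2 := by
  have hid := energy_identity hτ J G Z D e e' α δ R hm
  obtain ⟨-, hJ', -⟩ := h.energy_bounds hτ e' (α + δ - τ⁻¹ • D e')
  obtain ⟨-, hJ, -, -, hα, -⟩ := h.energy_bounds hτ e α
  set x := √(energy τ J Z D e' (α + δ - τ⁻¹ • D e'))
  set y := √(energy τ J Z D e α)
  have hx : 0 ≤ x := Real.sqrt_nonneg _
  have h1 : inner ℝ R (J (e' + e)) ≤ ‖R‖ * (3 * x + 3 * y) :=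
    (real_inner_le_norm _ _).trans (mul_le_mul_of_nonneg_left
      (by rw [map_add]; exact (norm_add_le _ _).trans (add_le_add hJ' hJ)) (norm_nonneg _))
  have h2 : τ ^ 2 * inner ℝ ((2 : ℝ) • α + τ⁻¹ • D e) δ ≤ τ * ‖δ‖ * (2 * y) := by
    calc τ ^ 2 * inner ℝ ((2 : ℝ) • α + τ⁻¹ • D e) δ
        ≤ τ ^ 2 * (‖(2 : ℝ) • α + τ⁻¹ • D e‖ * ‖δ‖) := by
          gcongr; exact real_inner_le_norm _ _
      _ = τ * ‖δ‖ * (τ * ‖(2 : ℝ) • α + τ⁻¹ • D e‖) := by ring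
      _ ≤ τ * ‖δ‖ * (2 * y) := by gcongr
  have h3 : τ * inner ℝ R (J (e' + e)) ≤ τ * (‖R‖ * (3 * x + 3 * y)) := by gcongr
  have h4 : 0 ≤ τ ^ 2 / 2 * ‖τ⁻¹ • D e' + τ⁻¹ • D e‖ ^ 2 := by positivity
  have h5 : 0 ≤ τ * ‖δ‖ * (2 * x) := by positivity
  nlinarith

/-- The forcing in `IsSplitting.energy_step` multiplies the sum of the two square roots, which
cancels against the difference of squares. The root of the energy therefore grows additively,
without a Gronwall factor. -/
lemma IsSplitting.sqrt_energy_step {τ : ℝ} {J G Z : V →L[ℝ] H} {D : V →L[ℝ] P}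
    (h : IsSplitting τ J G Z D) (hτ : 0 < τ) (e e' : V) (α δ : P) (R : H)
    (hm : momentum τ J G Z e e' (e' + e) =
      inner ℝ R (J (e' + e)) + inner ℝ (α + δ - τ⁻¹ • D e) (D (e' + e))) :
    √(energy τ J Z D e' (α + δ - τ⁻¹ • D e')) ≤
      √(energy τ J Z D e α) + (3 * τ * ‖R‖ + 3 * τ * ‖δ‖) := by
  have hs := h.energy_step hτ e e' α δ R hm
  have h1 := Real.sq_sqrt (h.energy_bounds hτ e' (α + δ - τ⁻¹ • D e')).1
  have h2 := Real.sq_sqrt (h.energy_bounds hτ e α).1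
  have h3 : 0 ≤ τ / 2 * ‖G (e' + e)‖ ^ 2 := by positivity
  have := le_add_of_sq_sub_sq_le (x := √(energy τ J Z D e' (α + δ - τ⁻¹ • D e')))
    (y := √(energy τ J Z D e α)) (g := 3 * τ * ‖R‖ + 2 * τ * ‖δ‖) (h := τ * ‖δ‖)
    (Real.sqrt_nonneg _) (by positivity) (by positivity) (by linarith)
  linarith

/-- Testing a homogeneous step with the increment of the velocity. -/
lemma IsSplitting.increment_step {τ : ℝ} {J G Z : V →L[ℝ] H} {D : V →L[ℝ] P}
    (h : IsSplitting τ J G Z D) (hτ : 0 < τ) (e e' : V) (α : P)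
    (hm : momentum τ J G Z e e' (e' - e) = inner ℝ (α - τ⁻¹ • D e) (D (e' - e))) :
    τ⁻¹ / 4 * ‖J (e' - e)‖ ^ 2 + 1 / 2 * ‖G e'‖ ^ 2 ≤
      1 / 2 * ‖G e‖ ^ 2
        + τ * (inner ℝ (α - τ⁻¹ • D e') (τ⁻¹ • D e') - inner ℝ α (τ⁻¹ • D e))
        + τ / 4 * ‖τ⁻¹ • D e' + τ⁻¹ • D e‖ ^ 2 := by
  have hD : D (e' - e) = τ • (τ⁻¹ • D e' - τ⁻¹ • D e) := by
    rw [smul_sub, smul_smul, smul_smul, mul_inv_cancel₀ hτ.ne', one_smul, one_smul, map_sub]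
  have hle : τ * ‖τ⁻¹ • D e' - τ⁻¹ • D e‖ ^ 2 ≤ τ⁻¹ * ‖J (e' - e)‖ ^ 2 := by
    have h1 := h.div_le (e' - e)
    rw [hD, norm_smul, Real.norm_of_nonneg hτ.le] at h1
    have h2 : (τ * ‖τ⁻¹ • D e' - τ⁻¹ • D e‖) ^ 2 ≤ ‖J (e' - e)‖ ^ 2 := by gcongr
    calc τ * ‖τ⁻¹ • D e' - τ⁻¹ • D e‖ ^ 2
        = τ⁻¹ * (τ * ‖τ⁻¹ • D e' - τ⁻¹ • D e‖) ^ 2 := by field_simp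
      _ ≤ _ := by gcongr
  have hZ : 0 ≤ τ / 4 * ‖Z (e' - e)‖ ^ 2 := by positivity
  rw [hD] at hm
  unfold momentum at hm
  generalize τ⁻¹ • D e' = z at *
  generalize τ⁻¹ • D e = y at *
  have hG : inner ℝ (G (e' + e)) (G (e' - e)) = ‖G e'‖ ^ 2 - ‖G e‖ ^ 2 := by
    simp only [map_add, map_sub, inner_add_left, inner_sub_right, real_inner_self_eq_norm_sq]
    rw [real_inner_comm (G e) (G e')]; ring
  rw [hG, real_inner_self_eq_norm_sq, real_inner_self_eq_norm_sq] at hm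
  -- The bracket telescopes along the scheme. The weight `3/4` is absorbed by `hle`, which leaves
  -- `1/4` of the increment term, and the square of `z + y` is the dissipation in `energy_identity`.
  have hq : inner ℝ (α - y) (τ • (z - y)) =
      τ * (inner ℝ (α - z) z - inner ℝ α y) + 3 / 4 * (τ * ‖z - y‖ ^ 2) + τ / 4 * ‖z + y‖ ^ 2 := by
    simp only [← real_inner_self_eq_norm_sq, inner_add_left, inner_add_right,
      inner_sub_left, inner_sub_right, inner_smul_right, real_inner_comm y z]
    ring
  linarith

/-- Summed bounds on the velocities of the abstract scheme. -/
structure StepBounds (τ : ℝ) (N : ℕ) (K : ℝ) (J G Z : V →L[ℝ] H) (E : ℕ → V) : Prop where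
  -- The powers of `τ` are those for which each contribution to the final sum `τ ∑ κ²` is of order
  -- `τ²`.
  emb : ∑ k ∈ Finset.Ico 1 N, ‖J (E (k + 1) - E k)‖ ^ 2 ≤ K * τ ^ 3
  grad : ∑ k ∈ Finset.Ico 1 N, ‖G (E (k + 1) + E k)‖ ^ 2 ≤ K * τ
  split : τ * ∑ k ∈ Finset.Ico 1 N, ‖Z (E (k + 1) - E k)‖ ^ 2 ≤ K
  first : ‖J (E 1)‖ ^ 2 ≤ K * τ ^ 3

lemma norm_add_sq_le_two {X : Type*} [SeminormedAddCommGroup X] (x y : X) :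
    ‖x + y‖ ^ 2 ≤ 2 * ‖x‖ ^ 2 + 2 * ‖y‖ ^ 2 := by
  nlinarith [norm_add_le x y, norm_nonneg (x + y), norm_nonneg x, norm_nonneg y,
    sq_nonneg (‖x‖ - ‖y‖)]

lemma StepBounds.add {τ : ℝ} {N : ℕ} {K L : ℝ} {J G Z : V →L[ℝ] H} {E F : ℕ → V} (hτ : 0 < τ)
    (hE : StepBounds τ N K J G Z E) (hF : StepBounds τ N L J G Z F) :
    StepBounds τ N (2 * (K + L)) J G Z (fun k => E k + F k) := by
  have key : ∀ (A : V →L[ℝ] H) (x y : ℕ → V),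
      ∑ k ∈ Finset.Ico 1 N, ‖A (x k + y k)‖ ^ 2 ≤
        2 * ∑ k ∈ Finset.Ico 1 N, ‖A (x k)‖ ^ 2 + 2 * ∑ k ∈ Finset.Ico 1 N, ‖A (y k)‖ ^ 2 := by
    intro A x y
    rw [Finset.mul_sum, Finset.mul_sum, ← Finset.sum_add_distrib]
    refine Finset.sum_le_sum fun k _ => ?_
    rw [map_add]
    exact norm_add_sq_le_two _ _
  have hs : ∀ k, E (k + 1) + F (k + 1) - (E k + F k) = (E (k + 1) - E k) + (F (k + 1) - F k) :=
    fun k => by abel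
  have ha : ∀ k, E (k + 1) + F (k + 1) + (E k + F k) = (E (k + 1) + E k) + (F (k + 1) + F k) :=
    fun k => by abel
  obtain ⟨e1, e2, e3, e4⟩ := hE
  obtain ⟨f1, f2, f3, f4⟩ := hF
  refine ⟨?_, ?_, ?_, ?_⟩
  · simp only [hs]
    refine (key _ _ _).trans ?_
    linarith
  · simp only [ha]
    refine (key _ _ _).trans ?_
    linarith
  · simp only [hs]
    have := mul_le_mul_of_nonneg_left
      (key Z (fun k => E (k + 1) - E k) (fun k => F (k + 1) - F k)) hτ.le
    linarith
  · have := norm_add_sq_le_two (J (E 1)) (J (F 1))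
    simp only [map_add]
    linarith

/-- An energy of order `τ³` alone bounds the squared `J` increments by `τ³` each, hence their sum
only by `τ²`. The missing power comes from the test with the increments, whose right-hand side
consists of telescoping pairings and of the dissipation already controlled by the energy. -/
lemma IsSplitting.homogeneous_bounds {τ K L : ℝ} {N : ℕ} {J G Z : V →L[ℝ] H} {D : V →L[ℝ] P}
    (h : IsSplitting τ J G Z D) (hτ : 0 < τ) (hL : N * τ ≤ L) (hL' : τ ≤ L) (hK : 0 ≤ K)
    (hN : 1 ≤ N)
    (E : ℕ → V) (α : ℕ → P)
    (hα : ∀ k, 1 ≤ k → k < N → α (k + 1) = α k - τ⁻¹ • D (E (k + 1)))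
    (hstep : ∀ k, 1 ≤ k → k < N → ∀ v, momentum τ J G Z (E k) (E (k + 1)) v =
      inner ℝ (α k - τ⁻¹ • D (E k)) (D v))
    (hW : energy τ J Z D (E 1) (α 1) ≤ K * τ ^ 3) (hG : ‖G (E 1)‖ ^ 2 ≤ K * τ ^ 2)
    (hJ : ‖J (E 1)‖ ^ 2 ≤ K * τ ^ 3) :
    StepBounds τ N (K * (52 + 2 * L + 16 * L ^ 2)) J G Z E := by
  have hen : ∀ n, 1 ≤ n → n ≤ N → energy τ J Z D (E n) (α n)
      + ∑ k ∈ Finset.Ico 1 n, (τ / 2 * ‖G (E (k + 1) + E k)‖ ^ 2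
        + τ ^ 2 / 2 * ‖τ⁻¹ • D (E (k + 1)) + τ⁻¹ • D (E k)‖ ^ 2) =
      energy τ J Z D (E 1) (α 1) := by
    intro n hn
    induction n, hn using Nat.le_induction with
    | base => intro _; simp
    | succ n hn ih =>
      intro hnN
      rw [Finset.sum_Ico_succ_top hn, ← ih (by omega), hα n hn (by omega)]
      have := energy_identity hτ J G Z D (E n) (E (n + 1)) (α n) 0 0
        (by rw [hstep n hn (by omega)]; simp)
      simp only [add_zero, inner_zero_left, inner_zero_right, norm_zero, mul_zero, ne_eq,
        OfNat.ofNat_ne_zero, not_false_eq_true, zero_pow] at this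
      linarith
  have hinc : ∀ n, 1 ≤ n → n ≤ N →
      τ⁻¹ / 4 * ∑ k ∈ Finset.Ico 1 n, ‖J (E (k + 1) - E k)‖ ^ 2 + 1 / 2 * ‖G (E n)‖ ^ 2 ≤
      1 / 2 * ‖G (E 1)‖ ^ 2
        + τ * (inner ℝ (α n) (τ⁻¹ • D (E n)) - inner ℝ (α 1) (τ⁻¹ • D (E 1)))
        + τ / 4 * ∑ k ∈ Finset.Ico 1 n, ‖τ⁻¹ • D (E (k + 1)) + τ⁻¹ • D (E k)‖ ^ 2 := by
    intro n hn
    induction n, hn using Nat.le_induction with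
    | base => intro _; simp
    | succ n hn ih =>
      intro hnN
      rw [Finset.sum_Ico_succ_top hn, Finset.sum_Ico_succ_top hn, hα n hn (by omega)]
      have := h.increment_step hτ (E n) (E (n + 1)) (α n) (hstep n hn (by omega) _)
      have := ih (by omega)
      linarith
  set W := energy τ J Z D (E 1) (α 1)
  have hW0 : 0 ≤ W := (h.energy_bounds hτ (E 1) (α 1)).1
  have hWn : ∀ n, 1 ≤ n → n ≤ N → √(energy τ J Z D (E n) (α n)) ≤ √W := by
    intro n h1 h2
    refine Real.sqrt_le_sqrt ?_
    rw [← hen n h1 h2]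
    exact le_add_of_nonneg_right (Finset.sum_nonneg fun k _ => by positivity)
  have hsq := Real.sq_sqrt hW0
  have hs0 := Real.sqrt_nonneg W
  have hτ3 : 0 ≤ K * τ ^ 3 := by positivity
  have hL0 : 0 ≤ L := hτ.le.trans hL'
  have hdis := hen N hN le_rfl
  rw [Finset.sum_add_distrib, ← Finset.mul_sum, ← Finset.mul_sum] at hdis
  have hEN := (h.energy_bounds hτ (E N) (α N)).1
  set SG := ∑ k ∈ Finset.Ico 1 N, ‖G (E (k + 1) + E k)‖ ^ 2
  set Sφ := ∑ k ∈ Finset.Ico 1 N, ‖τ⁻¹ • D (E (k + 1)) + τ⁻¹ • D (E k)‖ ^ 2 with hSφ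
  have hSG0 : 0 ≤ SG := Finset.sum_nonneg fun k _ => by positivity
  have hSφ0 : 0 ≤ Sφ := Finset.sum_nonneg fun k _ => by positivity
  have hpair : ∀ n, 1 ≤ n → n ≤ N → τ ^ 2 * |inner ℝ (α n) (τ⁻¹ • D (E n))| ≤ 6 * W := by
    intro n h1 h2
    obtain ⟨-, b1, -, b2, -, b3⟩ := h.energy_bounds hτ (E n) (α n)
    have hw := hWn n h1 h2
    have c1 : τ * ‖α n‖ ≤ 2 * √W := by linarith
    have c2 : τ * ‖τ⁻¹ • D (E n)‖ ≤ 3 * √W := by linarith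
    calc τ ^ 2 * |inner ℝ (α n) (τ⁻¹ • D (E n))|
        ≤ τ ^ 2 * (‖α n‖ * ‖τ⁻¹ • D (E n)‖) := by gcongr; exact abs_real_inner_le_norm _ _
      _ = (τ * ‖α n‖) * (τ * ‖τ⁻¹ • D (E n)‖) := by ring
      _ ≤ (2 * √W) * (3 * √W) := by gcongr
      _ = 6 * W := by linear_combination 6 * hsq
  have hτG : τ * SG ≤ 2 * (K * τ ^ 3) := by nlinarith [sq_nonneg τ]
  refine ⟨?_, ?_, ?_, ?_⟩
  · have h1 := hinc N hN le_rfl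
    set SJ := ∑ k ∈ Finset.Ico 1 N, ‖J (E (k + 1) - E k)‖ ^ 2
    have h2 := mul_le_mul_of_nonneg_left h1 (show 0 ≤ 4 * τ by positivity)
    have h3 : 4 * τ * (τ⁻¹ / 4 * SJ + 1 / 2 * ‖G (E N)‖ ^ 2) = SJ + 2 * τ * ‖G (E N)‖ ^ 2 := by
      field_simp
      ring
    rw [h3] at h2
    have p1 := (abs_le.1 (le_refl |inner ℝ (α 1) (τ⁻¹ • D (E 1))|)).1
    have p2 := (abs_le.1 (le_refl |inner ℝ (α N) (τ⁻¹ • D (E N))|)).2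
    have q1 := hpair 1 le_rfl hN
    have q2 := hpair N hN le_rfl
    have h4 : 0 ≤ 2 * τ * ‖G (E N)‖ ^ 2 := by positivity
    have h5 : τ * ‖G (E 1)‖ ^ 2 ≤ τ * (K * τ ^ 2) := by gcongr
    -- The constant is `2 + 48 + 2`: the initial gradient, the two end pairings of size `6 W` each
    -- multiplied by four, and the dissipation `τ² Sφ ≤ 2 W`.
    have h6 : SJ ≤ 52 * (K * τ ^ 3) := by nlinarith [sq_nonneg τ]
    calc SJ ≤ 52 * (K * τ ^ 3) := h6
      _ ≤ (52 + 2 * L + 16 * L ^ 2) * (K * τ ^ 3) :=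
        mul_le_mul_of_nonneg_right (by nlinarith) hτ3
      _ = _ := by ring
  · have h1 : SG ≤ 2 * (K * τ ^ 2) := by
      have : τ * SG ≤ τ * (2 * (K * τ ^ 2)) := by linarith
      exact le_of_mul_le_mul_left this hτ
    calc SG ≤ 2 * (K * τ ^ 2) := h1
      _ = (2 * τ) * (K * τ) := by ring
      _ ≤ (52 + 2 * L + 16 * L ^ 2) * (K * τ) :=
        mul_le_mul_of_nonneg_right (by nlinarith) (by positivity)
      _ = _ := by ring
  -- For the splitting term the crude pointwise energy bound suffices: summing it over at most `L /
  -- τ` steps leaves a factor `τ` to spare.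
  · have h1 : ∀ k ∈ Finset.Ico 1 N, τ ^ 2 * ‖Z (E (k + 1) - E k)‖ ^ 2 ≤ 16 * (K * τ ^ 3) := by
      intro k hk
      rw [Finset.mem_Ico] at hk
      have b1 := (h.energy_bounds hτ (E k) (α k)).2.2.1
      have b2 := (h.energy_bounds hτ (E (k + 1)) (α (k + 1))).2.2.1
      have w1 := hWn k hk.1 hk.2.le
      have w2 := hWn (k + 1) (by omega) (by omega)
      have b3 : ‖Z (E (k + 1) - E k)‖ ≤ ‖Z (E (k + 1))‖ + ‖Z (E k)‖ := by
        rw [map_sub]; exact norm_sub_le _ _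
      have b4 : τ * ‖Z (E (k + 1) - E k)‖ ≤ 4 * √W := by
        have := mul_le_mul_of_nonneg_left b3 hτ.le
        linarith
      have b5 : (τ * ‖Z (E (k + 1) - E k)‖) ^ 2 ≤ (4 * √W) ^ 2 := by gcongr
      nlinarith
    have h2 := Finset.sum_le_sum h1
    rw [← Finset.mul_sum, Finset.sum_const, Nat.card_Ico, nsmul_eq_mul] at h2
    have h3 : ((N - 1 : ℕ) : ℝ) ≤ N := by exact_mod_cast Nat.sub_le _ _
    set SZ := ∑ k ∈ Finset.Ico 1 N, ‖Z (E (k + 1) - E k)‖ ^ 2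
    have h4 : τ * (τ * SZ) ≤ τ * (16 * K * L * τ) := by
      calc τ * (τ * SZ) = τ ^ 2 * SZ := by ring
        _ ≤ N * (16 * (K * τ ^ 3)) := h2.trans (by gcongr)
        _ = 16 * K * τ ^ 2 * (N * τ) := by ring
        _ ≤ 16 * K * τ ^ 2 * L := by gcongr
        _ = _ := by ring
    have h5 := le_of_mul_le_mul_left h4 hτ
    calc τ * SZ ≤ 16 * K * L * τ := h5
      _ ≤ 16 * K * L * L := by gcongr
      _ ≤ _ := by nlinarith [mul_nonneg hK hL0]
  · calc _ ≤ K * τ ^ 3 := hJ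
      _ ≤ (52 + 2 * L + 16 * L ^ 2) * (K * τ ^ 3) :=
        le_mul_of_one_le_left hτ3 (by nlinarith)
      _ = _ := by ring

end Abstract

/-! ### The first step, the forced part and the recovery of the pressure -/

section Abstract

variable {V H P : Type*}
  [NormedAddCommGroup V] [InnerProductSpace ℝ V]
  [NormedAddCommGroup H] [InnerProductSpace ℝ H]
  [NormedAddCommGroup P] [InnerProductSpace ℝ P]

lemma momentum_sub (τ : ℝ) (J G Z : V →L[ℝ] H) (e₀ e₁ f₀ f₁ v : V) :
    momentum τ J G Z (e₁ - e₀) (f₁ - f₀) v =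
      momentum τ J G Z e₁ f₁ v - momentum τ J G Z e₀ f₀ v := by
  simp only [momentum, map_add, map_sub, inner_add_left, inner_sub_left]
  ring

/-- Here the data are bounded against `‖J e‖`, which the term `τ⁻¹ ‖J e‖²` absorbs. This gives `J e`
of order `τ²`, half an order better than in `first_homogeneous`. -/
lemma IsSplitting.first_forced {τ C : ℝ} {J G Z : V →L[ℝ] H} {D : V →L[ℝ] P}
    (h : IsSplitting τ J G Z D) (hτ : 0 < τ) (hC : 0 ≤ C) (e : V) (δ : P)
    (hm : momentum τ J G Z 0 e e ≤ C * τ * ‖J e‖) (hδ : ‖δ‖ ≤ C * τ) :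
    ‖J e‖ ≤ C * τ ^ 2 ∧ ‖G e‖ ^ 2 ≤ 2 * C ^ 2 * τ ^ 3 ∧
      √(energy τ J Z D e (δ - τ⁻¹ • D e)) ≤ 3 * C * τ ^ 2 := by
  simp only [momentum, sub_zero, add_zero, real_inner_self_eq_norm_sq] at hm
  have h1 : 0 ≤ τ⁻¹ * ‖J e‖ ^ 2 := by positivity
  have h2 : 0 ≤ 1 / 2 * ‖G e‖ ^ 2 := by positivity
  have h3 : 0 ≤ τ / 4 * ‖Z e‖ ^ 2 := by positivity
  have hJ : ‖J e‖ ≤ C * τ ^ 2 := by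
    rcases (norm_nonneg (J e)).eq_or_lt with h0 | h0
    · rw [← h0]; positivity
    · have : τ⁻¹ * ‖J e‖ ^ 2 ≤ C * τ * ‖J e‖ := by linarith
      have h5 : ‖J e‖ * ‖J e‖ ≤ (C * τ ^ 2) * ‖J e‖ := by
        have := mul_le_mul_of_nonneg_left this hτ.le
        rw [← mul_assoc, mul_inv_cancel₀ hτ.ne'] at this
        nlinarith
      exact le_of_mul_le_mul_right h5 h0
  have h6 : C * τ * ‖J e‖ ≤ C * τ * (C * τ ^ 2) := by gcongr
  have hZ : τ ^ 2 / 4 * ‖Z e‖ ^ 2 ≤ C ^ 2 * τ ^ 4 := by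
    have : τ * (τ / 4 * ‖Z e‖ ^ 2) ≤ τ * (C * τ * (C * τ ^ 2)) :=
      mul_le_mul_of_nonneg_left (by linarith) hτ.le
    linarith
  refine ⟨hJ, by linarith, ?_⟩
  refine (Real.sqrt_le_sqrt (y := (3 * C * τ ^ 2) ^ 2) ?_).trans
    (by rw [Real.sqrt_sq (by positivity)])
  have hφ := (h.energy_bounds hτ e (δ - τ⁻¹ • D e)).2.2.2.2.2
  have hd : τ * ‖δ - τ⁻¹ • D e‖ ≤ 2 * (C * τ ^ 2) := by
    have := mul_le_mul_of_nonneg_left (norm_sub_le δ (τ⁻¹ • D e)) hτ.le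
    have := mul_le_mul_of_nonneg_left hδ hτ.le
    linarith
  have hd2 : (τ * ‖δ - τ⁻¹ • D e‖) ^ 2 ≤ (2 * (C * τ ^ 2)) ^ 2 := by gcongr
  have hδ2 : (τ * ‖δ‖) ^ 2 ≤ (τ * (C * τ)) ^ 2 := by gcongr
  have hJ2 : ‖J e‖ ^ 2 ≤ (C * τ ^ 2) ^ 2 := by gcongr
  have h7 : 0 ≤ τ ^ 2 * ‖τ⁻¹ • D e‖ ^ 2 := by positivity
  unfold energy
  rw [sub_add_cancel]
  nlinarith

/-- A start-up functional bounded only against `‖G e‖` has to be absorbed by the viscous term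
through Young's inequality. The cost is an energy of order `τ³` instead of `τ⁴`. -/
lemma first_homogeneous {τ C L : ℝ} {J G Z : V →L[ℝ] H} {D : V →L[ℝ] P}
    (hτ : 0 < τ) (hτL : τ ≤ L) (e : V) (γ : P)
    (hm : momentum τ J G Z 0 e e ≤ C * τ * ‖G e‖) (hγ : ‖γ‖ ≤ C * τ) :
    ‖J e‖ ^ 2 ≤ C ^ 2 * (4 + 2 * L) * τ ^ 3 ∧ ‖G e‖ ^ 2 ≤ C ^ 2 * (4 + 2 * L) * τ ^ 2 ∧
      energy τ J Z D e (γ - τ⁻¹ • D e) ≤ C ^ 2 * (4 + 2 * L) * τ ^ 3 := by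
  simp only [momentum, sub_zero, add_zero, real_inner_self_eq_norm_sq] at hm
  have h1 : 0 ≤ τ⁻¹ * ‖J e‖ ^ 2 := by positivity
  have h3 : 0 ≤ τ / 4 * ‖Z e‖ ^ 2 := by positivity
  have h4 : C * τ * ‖G e‖ ≤ 1 / 4 * ‖G e‖ ^ 2 + C ^ 2 * τ ^ 2 := by
    nlinarith [sq_nonneg (1 / 2 * ‖G e‖ - C * τ)]
  have h5 : τ * (τ⁻¹ * ‖J e‖ ^ 2 + τ / 4 * ‖Z e‖ ^ 2) ≤ τ * (C ^ 2 * τ ^ 2) := by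
    gcongr
    have : 0 ≤ ‖G e‖ ^ 2 := by positivity
    linarith
  rw [mul_add, ← mul_assoc, mul_inv_cancel₀ hτ.ne', one_mul] at h5
  have hL : 0 ≤ 2 * L := by linarith
  have hL2 : 0 ≤ C ^ 2 * (2 * L) * τ ^ 2 := by positivity
  have hL3 : 0 ≤ C ^ 2 * (2 * L) * τ ^ 3 := by positivity
  have hC3 : 0 ≤ C ^ 2 * τ ^ 3 := by positivity
  have h6 : 0 ≤ τ * (τ / 4 * ‖Z e‖ ^ 2) := by positivity
  refine ⟨by nlinarith, by nlinarith, ?_⟩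
  have hγ2 : ‖γ‖ ^ 2 ≤ (C * τ) ^ 2 := by gcongr
  have hd : ‖γ - τ⁻¹ • D e‖ ^ 2 ≤ 2 * ‖γ‖ ^ 2 + 2 * ‖τ⁻¹ • D e‖ ^ 2 := by
    have := norm_add_sq_le_two γ (-(τ⁻¹ • D e))
    rwa [norm_neg, ← sub_eq_add_neg] at this
  have hd2 : τ ^ 2 * (1 / 2 * ‖γ - τ⁻¹ • D e‖ ^ 2 + 1 / 2 * ‖γ‖ ^ 2 - ‖τ⁻¹ • D e‖ ^ 2) ≤
      τ ^ 2 * (2 * (C * τ) ^ 2) := by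
    gcongr
    nlinarith
  have hd3 : τ ^ 2 * (2 * (C * τ) ^ 2) ≤ C ^ 2 * (2 * L) * τ ^ 3 := by
    calc τ ^ 2 * (2 * (C * τ) ^ 2) = 2 * C ^ 2 * τ ^ 3 * τ := by ring
      _ ≤ 2 * C ^ 2 * τ ^ 3 * L := by gcongr
      _ = _ := by ring
  unfold energy
  rw [sub_add_cancel]
  nlinarith

/-- The recursion is linear with constant coefficients, so the increments of its solution solve it
again, now driven by second differences of the pressure. Their energy stays of order `τ⁴`, and its
dissipation controls `G`. -/
lemma IsSplitting.forced_bounds {τ C L : ℝ} {N : ℕ} {J G Z : V →L[ℝ] H} {D : V →L[ℝ] P}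
    (h : IsSplitting τ J G Z D) (hτ : 0 < τ) (hL : N * τ ≤ L) (hL' : τ ≤ L) (hC : 0 ≤ C)
    (hN : 1 ≤ N) (E : ℕ → V) (α δ : ℕ → P) (R : ℕ → H) (hE0 : E 0 = 0) (hα0 : α 0 = 0)
    (hα : ∀ k < N, α (k + 1) = α k + δ k - τ⁻¹ • D (E (k + 1)))
    (hstep : ∀ k < N, ∀ v, momentum τ J G Z (E k) (E (k + 1)) v =
      inner ℝ (R k) (J v) + inner ℝ (α k + δ k - τ⁻¹ • D (E k)) (D v))
    (hR : ∀ k < N, ‖R k‖ ≤ C * τ ^ 2) (hδ : ∀ k < N, ‖δ k‖ ≤ C * τ)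
    (hδ2 : ∀ k, k + 1 < N → ‖δ (k + 1) - δ k‖ ≤ C * τ ^ 2)
    {K₁ K₂ K₃ : ℝ} (hK₁ : K₁ = C * (1 + L)) (hK₂ : K₂ = 3 * K₁ + 9 * C * L)
    (hK₃ : K₃ = K₂ ^ 2 + 16 * L * C * K₂ + L ^ 2 * C ^ 2) :
    StepBounds τ N (9 * K₂ ^ 2 * L + 4 * L ^ 2 * (K₁ ^ 2 + K₃) + 4 * K₂ ^ 2 * L ^ 3 + K₁ ^ 2 * L)
      J G Z E := by
  have hL0 : 0 ≤ L := hτ.le.trans hL'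
  have hK₁0 : 0 ≤ K₁ := by rw [hK₁]; positivity
  have hK₂0 : 0 ≤ K₂ := by rw [hK₂]; positivity
  have hK₃0 : 0 ≤ K₃ := by rw [hK₃]; positivity
  have hCK : C ≤ K₁ := by rw [hK₁]; nlinarith
  set d : ℕ → V := fun k => E (k + 1) - E k with hd
  set β : ℕ → P := fun k => α (k + 1) - α k with hβ
  have hdstep : ∀ k, k + 1 < N → ∀ v, momentum τ J G Z (d k) (d (k + 1)) v =
      inner ℝ (R (k + 1) - R k) (J v)
        + inner ℝ (β k + (δ (k + 1) - δ k) - τ⁻¹ • D (d k)) (D v) := by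
    intro k hk v
    rw [hd, momentum_sub, hstep (k + 1) hk, hstep k (by omega), hβ]
    simp only [map_sub, smul_sub, inner_sub_left, inner_add_left]
    ring
  have hβs : ∀ k, k + 1 < N → β (k + 1) = β k + (δ (k + 1) - δ k) - τ⁻¹ • D (d (k + 1)) := by
    intro k hk
    simp only [hβ, hd, hα (k + 1) hk, hα k (by omega), map_sub, smul_sub]
    abel
  have hd0 : d 0 = E 1 := by simp [hd, hE0]
  have hβ0 : β 0 = δ 0 - τ⁻¹ • D (d 0) := by
    simp [hβ, hα 0 (by omega), hα0, hd0]
  have hfirst : ‖J (d 0)‖ ≤ K₁ * τ ^ 2 ∧ ‖G (d 0)‖ ^ 2 ≤ 2 * K₁ ^ 2 * τ ^ 3 ∧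
      √(energy τ J Z D (d 0) (β 0)) ≤ 3 * K₁ * τ ^ 2 := by
    rw [hβ0]
    refine h.first_forced hτ hK₁0 (d 0) (δ 0) ?_ ((hδ 0 (by omega)).trans (by gcongr))
    have := hstep 0 (by omega) (E 1)
    rw [hE0, hα0, zero_add, zero_add, map_zero, smul_zero, sub_zero] at this
    rw [hd0, this]
    have i1 := (real_inner_le_norm (R 0) (J (E 1))).trans
      (mul_le_mul_of_nonneg_right (hR 0 (by omega)) (norm_nonneg _))
    have i2 := (real_inner_le_norm (δ 0) (D (E 1))).trans
      (mul_le_mul (hδ 0 (by omega)) (h.div_le _) (norm_nonneg _) (by positivity))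
    have i3 : C * τ ^ 2 * ‖J (E 1)‖ ≤ C * τ * ‖J (E 1)‖ * L := by
      calc C * τ ^ 2 * ‖J (E 1)‖ = C * τ * ‖J (E 1)‖ * τ := by ring
        _ ≤ _ := by gcongr
    rw [hK₁]
    linarith
  obtain ⟨hJ0, hG0, hW0⟩ := hfirst
  -- No cancellation between residuals is needed: order `τ²` already adds only `τ³` per step to the
  -- root of the energy.
  have hRd : ∀ k, k + 1 < N → ‖R (k + 1) - R k‖ ≤ 2 * C * τ ^ 2 := fun k hk => by
    have := norm_sub_le (R (k + 1)) (R k)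
    have := hR (k + 1) hk
    have := hR k (by omega)
    linarith
  have hsqrt : ∀ k < N, √(energy τ J Z D (d k) (β k)) ≤ 3 * K₁ * τ ^ 2 + k * (9 * C * τ ^ 3) := by
    intro k
    induction k with
    | zero => intro _; simpa using hW0
    | succ k ih =>
      intro hk
      have h1 := ih (by omega)
      have h2 := h.sqrt_energy_step hτ (d k) (d (k + 1)) (β k) (δ (k + 1) - δ k) (R (k + 1) - R k)
        (hdstep k hk _)
      rw [← hβs k hk] at h2
      have h3 : 3 * τ * ‖R (k + 1) - R k‖ ≤ 3 * τ * (2 * C * τ ^ 2) := by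
        gcongr; exact hRd k hk
      have h4 : 3 * τ * ‖δ (k + 1) - δ k‖ ≤ 3 * τ * (C * τ ^ 2) := by
        gcongr; exact hδ2 k hk
      push_cast
      linarith
  have hsq : ∀ k < N, √(energy τ J Z D (d k) (β k)) ≤ K₂ * τ ^ 2 := by
    intro k hk
    refine (hsqrt k hk).trans ?_
    have hkN : (k : ℝ) * τ ≤ L := by
      refine le_trans ?_ hL
      have : (k : ℝ) ≤ N := by exact_mod_cast hk.le
      gcongr
    calc 3 * K₁ * τ ^ 2 + k * (9 * C * τ ^ 3) = 3 * K₁ * τ ^ 2 + 9 * C * τ ^ 2 * (k * τ) := by ring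
      _ ≤ 3 * K₁ * τ ^ 2 + 9 * C * τ ^ 2 * L := by gcongr
      _ = _ := by rw [hK₂]; ring
  have hdis : ∀ n < N, energy τ J Z D (d n) (β n)
      + τ / 2 * ∑ k ∈ Finset.range n, ‖G (d (k + 1) + d k)‖ ^ 2 ≤
      K₂ ^ 2 * τ ^ 4 + n * (16 * C * K₂ * τ ^ 5 + C ^ 2 * τ ^ 6) := by
    intro n
    induction n with
    | zero =>
      intro hn
      have h1 := Real.sq_sqrt (h.energy_bounds hτ (d 0) (β 0)).1
      have h2 : √(energy τ J Z D (d 0) (β 0)) ^ 2 ≤ (K₂ * τ ^ 2) ^ 2 := by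
        gcongr; exact hsq 0 hn
      simp only [Finset.range_zero, Finset.sum_empty, mul_zero, add_zero, Nat.cast_zero, zero_mul]
      nlinarith
    | succ n ih =>
      intro hn
      have h1 := ih (by omega)
      have h2 := h.energy_step hτ (d n) (d (n + 1)) (β n) (δ (n + 1) - δ n) (R (n + 1) - R n)
        (hdstep n hn _)
      rw [← hβs n hn] at h2
      have h3 := hRd n hn
      have h4 := hδ2 n hn
      have h5 : (3 * τ * ‖R (n + 1) - R n‖ + 2 * τ * ‖δ (n + 1) - δ n‖) *
          (√(energy τ J Z D (d (n + 1)) (β (n + 1))) + √(energy τ J Z D (d n) (β n))) ≤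
          (3 * τ * (2 * C * τ ^ 2) + 2 * τ * (C * τ ^ 2)) * (K₂ * τ ^ 2 + K₂ * τ ^ 2) := by
        gcongr
        · exact hsq _ hn
        · exact hsq _ (by omega)
      have h6 : (τ * ‖δ (n + 1) - δ n‖) ^ 2 ≤ (τ * (C * τ ^ 2)) ^ 2 := by gcongr
      rw [Finset.sum_range_succ]
      push_cast
      linarith
  set S := ∑ k ∈ Finset.range (N - 1), ‖G (d (k + 1) + d k)‖ ^ 2 with hS
  have hS0 : 0 ≤ S := Finset.sum_nonneg fun k _ => by positivity
  have hSle : S ≤ 2 * K₃ * τ ^ 3 := by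
    have h1 := hdis (N - 1) (by omega)
    have h2 := (h.energy_bounds hτ (d (N - 1)) (β (N - 1))).1
    have h3 : ((N - 1 : ℕ) : ℝ) ≤ N := by exact_mod_cast Nat.sub_le _ _
    have h4 : ((N - 1 : ℕ) : ℝ) * (16 * C * K₂ * τ ^ 5 + C ^ 2 * τ ^ 6) ≤
        (16 * L * C * K₂ + L ^ 2 * C ^ 2) * τ ^ 4 := by
      calc ((N - 1 : ℕ) : ℝ) * (16 * C * K₂ * τ ^ 5 + C ^ 2 * τ ^ 6)
          ≤ N * (16 * C * K₂ * τ ^ 5 + C ^ 2 * τ ^ 6) := by gcongr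
        _ = (N * τ) * (16 * C * K₂ * τ ^ 4 + C ^ 2 * τ ^ 4 * τ) := by ring
        _ ≤ L * (16 * C * K₂ * τ ^ 4 + C ^ 2 * τ ^ 4 * L) := by gcongr
        _ = _ := by ring
    have h5 : τ * S ≤ τ * (2 * K₃ * τ ^ 3) := by rw [hK₃]; linarith
    exact le_of_mul_le_mul_left h5 hτ
  -- The sums `E (k+1) + E k` are recovered by telescoping from the dissipated quantities `G (d
  -- (j+1) + d j)`. Cauchy-Schwarz costs a factor `N`, so `S` of order `τ³` yields order `τ²`.
  have hGk : ∀ k, 1 ≤ k → k < N →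
      ‖G (E (k + 1) + E k)‖ ^ 2 ≤ 4 * K₁ ^ 2 * τ ^ 3 + 4 * K₃ * L * τ ^ 2 := by
    intro k hk1 hk
    have htel : E (k + 1) + E k = E 1 + ∑ j ∈ Finset.range k, (d (j + 1) + d j) := by
      have := Finset.sum_range_sub (fun j => E (j + 1) + E j) k
      have e : ∀ j, d (j + 1) + d j = E (j + 1 + 1) + E (j + 1) - (E (j + 1) + E j) :=
        fun j => by simp only [hd]; abel
      simp only [e, this, hE0, zero_add]
      abel
    rw [htel, map_add, map_sum]
    refine (norm_add_sq_le_two _ _).trans ?_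
    have h1 : ‖∑ j ∈ Finset.range k, G (d (j + 1) + d j)‖ ^ 2 ≤ N * S := by
      calc ‖∑ j ∈ Finset.range k, G (d (j + 1) + d j)‖ ^ 2
          ≤ (∑ j ∈ Finset.range k, ‖G (d (j + 1) + d j)‖) ^ 2 := by
            gcongr; exact norm_sum_le _ _
        _ ≤ k * ∑ j ∈ Finset.range k, ‖G (d (j + 1) + d j)‖ ^ 2 := by
            simpa using sq_sum_le_card_mul_sum_sq (s := Finset.range k)
              (f := fun j => ‖G (d (j + 1) + d j)‖)
        _ ≤ N * S := by
            have hkN : (k : ℝ) ≤ N := by exact_mod_cast hk.le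
            refine mul_le_mul hkN (Finset.sum_le_sum_of_subset_of_nonneg ?_ fun _ _ _ => ?_)
              (Finset.sum_nonneg fun _ _ => ?_) (by positivity)
            · intro j hj
              simp only [Finset.mem_range] at hj ⊢
              omega
            all_goals positivity
    have h2 : N * S ≤ 2 * K₃ * L * τ ^ 2 := by
      calc N * S ≤ N * (2 * K₃ * τ ^ 3) := by gcongr
        _ = 2 * K₃ * τ ^ 2 * (N * τ) := by ring
        _ ≤ 2 * K₃ * τ ^ 2 * L := by gcongr
        _ = _ := by ring
    rw [hd0] at hG0
    linarith
  have hcard : ∀ (F : ℕ → ℝ) (c : ℝ), 0 ≤ c → (∀ k, 1 ≤ k → k < N → F k ≤ c) →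
      ∑ k ∈ Finset.Ico 1 N, F k ≤ N * c := by
    intro F c hc hF
    refine (Finset.sum_le_sum (g := fun _ => c) fun k hk => ?_).trans ?_
    · rw [Finset.mem_Ico] at hk
      exact hF k hk.1 hk.2
    · rw [Finset.sum_const, Nat.card_Ico, nsmul_eq_mul]
      have h3 : ((N - 1 : ℕ) : ℝ) ≤ N := by exact_mod_cast Nat.sub_le _ _
      gcongr
  refine ⟨?_, ?_, ?_, ?_⟩
  · calc ∑ k ∈ Finset.Ico 1 N, ‖J (E (k + 1) - E k)‖ ^ 2 ≤ N * (3 * (K₂ * τ ^ 2)) ^ 2 := by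
          refine hcard _ _ (by positivity) fun k _ hk => ?_
          gcongr
          exact (h.energy_bounds hτ (d k) (β k)).2.1.trans
            (mul_le_mul_of_nonneg_left (hsq k hk) (by norm_num))
      _ = 9 * K₂ ^ 2 * τ ^ 3 * (N * τ) := by ring
      _ ≤ 9 * K₂ ^ 2 * τ ^ 3 * L := by gcongr
      _ = (9 * K₂ ^ 2 * L) * τ ^ 3 := by ring
      _ ≤ _ := by
        gcongr
        have : 0 ≤ 4 * L ^ 2 * (K₁ ^ 2 + K₃) + 4 * K₂ ^ 2 * L ^ 3 + K₁ ^ 2 * L := by positivity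
        linarith
  · calc ∑ k ∈ Finset.Ico 1 N, ‖G (E (k + 1) + E k)‖ ^ 2
        ≤ N * (4 * K₁ ^ 2 * τ ^ 3 + 4 * K₃ * L * τ ^ 2) :=
          hcard _ _ (by positivity) fun k h1 h2 => hGk k h1 h2
      _ = (N * τ) * (4 * K₁ ^ 2 * (τ * τ) + 4 * K₃ * L * τ) := by ring
      _ ≤ L * (4 * K₁ ^ 2 * (L * τ) + 4 * K₃ * L * τ) := by gcongr
      _ = (4 * L ^ 2 * (K₁ ^ 2 + K₃)) * τ := by ring
      _ ≤ _ := by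
        gcongr
        have : 0 ≤ 9 * K₂ ^ 2 * L + 4 * K₂ ^ 2 * L ^ 3 + K₁ ^ 2 * L := by positivity
        linarith
  · calc τ * ∑ k ∈ Finset.Ico 1 N, ‖Z (E (k + 1) - E k)‖ ^ 2 ≤ τ * (N * (2 * (K₂ * τ)) ^ 2) := by
          gcongr
          refine hcard _ _ (by positivity) fun k _ hk => ?_
          gcongr
          have h1 := (h.energy_bounds hτ (d k) (β k)).2.2.1.trans
            (mul_le_mul_of_nonneg_left (hsq k hk) (by norm_num))
          refine le_of_mul_le_mul_left (h1.trans (le_of_eq ?_)) hτ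
          ring
      _ = 4 * K₂ ^ 2 * τ ^ 2 * (N * τ) := by ring
      _ ≤ 4 * K₂ ^ 2 * L ^ 2 * L := by gcongr
      _ = 4 * K₂ ^ 2 * L ^ 3 := by ring
      _ ≤ _ := by
        have : 0 ≤ 9 * K₂ ^ 2 * L + 4 * L ^ 2 * (K₁ ^ 2 + K₃) + K₁ ^ 2 * L := by positivity
        linarith
  · rw [hd0] at hJ0
    calc ‖J (E 1)‖ ^ 2 ≤ (K₁ * τ ^ 2) ^ 2 := by gcongr
      _ = K₁ ^ 2 * τ ^ 3 * τ := by ring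
      _ ≤ K₁ ^ 2 * τ ^ 3 * L := by gcongr
      _ = (K₁ ^ 2 * L) * τ ^ 3 := by ring
      _ ≤ _ := by
        gcongr
        have : 0 ≤ 9 * K₂ ^ 2 * L + 4 * L ^ 2 * (K₁ ^ 2 + K₃) + 4 * K₂ ^ 2 * L ^ 3 := by positivity
        linarith

lemma abs_inner_le_mul {X : Type*} [NormedAddCommGroup X] [InnerProductSpace ℝ X] {a b : X} {r s : ℝ}
    (ha : ‖a‖ ≤ r) (hb : ‖b‖ ≤ s) : |inner ℝ a b| ≤ r * s :=
  (abs_real_inner_le_norm a b).trans (mul_le_mul ha hb (norm_nonneg _) ((norm_nonneg _).trans ha))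

/-- The new pressure error is the predictor error in the momentum equation minus `τ⁻¹ D` of the
velocity increment. Hence its pairing with `D v` is expressed by velocities, and each term is
bounded against `‖Z v‖`. -/
lemma IsSplitting.pressure_bound_of_stepBounds {τ C K L : ℝ} {N : ℕ}
    {J G Z : V →L[ℝ] H} {D : V →L[ℝ] P} (h : IsSplitting τ J G Z D) (hτ : 0 < τ) (hτL : τ ≤ L)
    (hNL : N * τ ≤ L) (hNpos : 0 < N) (hC : 0 ≤ C) (hK0 : 0 ≤ K)
    {E : ℕ → V} {α δ : ℕ → P} {R : ℕ → H} (hα0 : α 0 = 0)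
    (hα : ∀ k < N, α (k + 1) = α k + δ k - τ⁻¹ • D (E (k + 1)))
    (hstep : ∀ k, 1 ≤ k → k < N → ∀ v, momentum τ J G Z (E k) (E (k + 1)) v =
      inner ℝ (R k) (J v) + inner ℝ (α k + δ k - τ⁻¹ • D (E k)) (D v))
    (hR : ∀ k < N, ‖R k‖ ≤ C * τ ^ 2) (hδ : ∀ k < N, ‖δ k‖ ≤ C * τ)
    (hS : StepBounds τ N K J G Z E) :
    ∃ κ : ℕ → ℝ, (∀ k < N, 0 ≤ κ k ∧ ∀ v, |inner ℝ (α (k + 1)) (D v)| ≤ κ k * ‖Z v‖) ∧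
      τ * ∑ k ∈ Finset.range N, κ k ^ 2 ≤ (2 * C ^ 2 * L + 22 * K + 4 * C ^ 2 * L ^ 3) * τ ^ 2 := by
  have hL0 : 0 ≤ L := hτ.le.trans hτL
  obtain ⟨s1, s2, s3, s4⟩ := hS
  set x : ℕ → ℝ := fun k => ‖J (E (k + 1) - E k)‖ with hx
  set y : ℕ → ℝ := fun k => ‖G (E (k + 1) + E k)‖ with hy
  set z : ℕ → ℝ := fun k => ‖Z (E (k + 1) - E k)‖ with hz
  -- The first step has no momentum equation of the required form, so `α 1` is estimated directly.
  -- It is only of order `√τ`, which is enough for a single term with weight `τ`. The factor `2` at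
  -- `τ⁻¹` counts the time derivative and the divergence of the increment.
  set κ : ℕ → ℝ := fun k => if k = 0 then ‖α 1‖ else
    2 * τ⁻¹ * x k + 1 / 2 * y k + τ / 4 * z k + C * τ ^ 2 with hκ
  have hκ1 : ∀ k, 1 ≤ k → κ k = 2 * τ⁻¹ * x k + 1 / 2 * y k + τ / 4 * z k + C * τ ^ 2 :=
    fun k hk => by simp only [hκ]; rw [if_neg (by omega)]
  have hJZ : ∀ v, ‖J v‖ ≤ ‖Z v‖ := fun v => (h.emb_le v).trans (h.grad_le v)
  have hDZ : ∀ v, ‖D v‖ ≤ ‖Z v‖ := fun v => (h.div_le v).trans (hJZ v)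
  refine ⟨κ, fun k hk => ?_, ?_⟩
  · rcases Nat.eq_zero_or_pos k with rfl | hk0
    · refine ⟨by simp [hκ], fun v => ?_⟩
      simp only [hκ, if_true, zero_add]
      exact (abs_real_inner_le_norm _ _).trans
        (mul_le_mul_of_nonneg_left (hDZ v) (norm_nonneg _))
    · rw [hκ1 k hk0]
      refine ⟨by positivity, fun v => ?_⟩
      have h1 : inner ℝ (α (k + 1)) (D v) = momentum τ J G Z (E k) (E (k + 1)) v
          - inner ℝ (R k) (J v) - inner ℝ (τ⁻¹ • D (E (k + 1) - E k)) (D v) := by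
        rw [hstep k hk0 hk, hα k hk]
        simp only [map_sub, smul_sub, inner_sub_left, inner_add_left]
        ring
      have i1 := abs_le.1 (abs_inner_le_mul (a := J (E (k + 1) - E k)) (b := J v) le_rfl (hJZ v))
      have i2 := abs_le.1 (abs_inner_le_mul (a := G (E (k + 1) + E k)) (b := G v) le_rfl (h.grad_le v))
      have i3 := abs_le.1 (abs_inner_le_mul (a := Z (E (k + 1) - E k)) (b := Z v) le_rfl le_rfl)
      have i4 := abs_le.1 (abs_inner_le_mul (a := R k) (b := J v) (hR k hk) (hJZ v))
      have i5 := abs_le.1 (abs_inner_le_mul (a := D (E (k + 1) - E k)) (b := D v) (h.div_le _) (hDZ v))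
      have hi : 0 < τ⁻¹ := by positivity
      rw [h1, real_inner_smul_left, abs_le]
      unfold momentum
      have m1 := mul_le_mul_of_nonneg_left i1.1 hi.le
      have m1' := mul_le_mul_of_nonneg_left i1.2 hi.le
      have m3 := mul_le_mul_of_nonneg_left i3.1 (show 0 ≤ τ / 4 by positivity)
      have m3' := mul_le_mul_of_nonneg_left i3.2 (show 0 ≤ τ / 4 by positivity)
      have m5 := mul_le_mul_of_nonneg_left i5.1 hi.le
      have m5' := mul_le_mul_of_nonneg_left i5.2 hi.le
      obtain ⟨i2a, i2b⟩ := i2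
      obtain ⟨i4a, i4b⟩ := i4
      constructor <;> linarith
  · have hsplit : ∑ k ∈ Finset.range N, κ k ^ 2 = ‖α 1‖ ^ 2 + ∑ k ∈ Finset.Ico 1 N, κ k ^ 2 := by
      rw [Finset.range_eq_Ico, Finset.sum_eq_sum_Ico_succ_bot hNpos]
      simp [hκ]
    have hα1 : τ * ‖α 1‖ ^ 2 ≤ (2 * C ^ 2 * L + 2 * K) * τ ^ 2 := by
      have e1 : α 1 = δ 0 + -(τ⁻¹ • D (E 1)) := by
        rw [hα 0 hNpos, hα0]; simp [sub_eq_add_neg]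
      have e2 : ‖τ⁻¹ • D (E 1)‖ ≤ τ⁻¹ * ‖J (E 1)‖ := by
        rw [norm_smul, Real.norm_of_nonneg (by positivity)]
        gcongr; exact h.div_le _
      have e3 := norm_add_sq_le_two (δ 0) (-(τ⁻¹ • D (E 1)))
      rw [← e1, norm_neg] at e3
      have e4 : ‖τ⁻¹ • D (E 1)‖ ^ 2 ≤ K * τ := by
        calc ‖τ⁻¹ • D (E 1)‖ ^ 2 ≤ (τ⁻¹ * ‖J (E 1)‖) ^ 2 := by gcongr
          _ = (τ⁻¹) ^ 2 * ‖J (E 1)‖ ^ 2 := by ring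
          _ ≤ (τ⁻¹) ^ 2 * (K * τ ^ 3) := by gcongr
          _ = K * τ := by field_simp
      have e5 : ‖δ 0‖ ^ 2 ≤ (C * τ) ^ 2 := by gcongr; exact hδ 0 hNpos
      calc τ * ‖α 1‖ ^ 2 ≤ τ * (2 * (C * τ) ^ 2 + 2 * (K * τ)) := by gcongr; linarith
        _ = (2 * C ^ 2 * τ + 2 * K) * τ ^ 2 := by ring
        _ ≤ _ := by gcongr
    have hκk : ∀ k ∈ Finset.Ico 1 N, κ k ^ 2 ≤
        16 * (τ⁻¹) ^ 2 * x k ^ 2 + y k ^ 2 + τ ^ 2 * z k ^ 2 + 4 * C ^ 2 * τ ^ 4 := by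
      intro k hk
      rw [Finset.mem_Ico] at hk
      rw [hκ1 k hk.1]
      have hq : ∀ a b c d : ℝ, (a + b + c + d) ^ 2 ≤ 4 * (a ^ 2 + b ^ 2 + c ^ 2 + d ^ 2) := by
        intro a b c d
        nlinarith [sq_nonneg (a - b), sq_nonneg (a - c), sq_nonneg (a - d), sq_nonneg (b - c),
          sq_nonneg (b - d), sq_nonneg (c - d)]
      refine (hq _ _ _ _).trans ?_
      have : 0 ≤ τ ^ 2 * z k ^ 2 := by positivity
      nlinarith
    have hs := Finset.sum_le_sum hκk
    simp only [Finset.sum_add_distrib, ← Finset.mul_sum, Finset.sum_const, Nat.card_Ico,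
      nsmul_eq_mul] at hs
    have h3 : ((N - 1 : ℕ) : ℝ) ≤ N := by exact_mod_cast Nat.sub_le _ _
    have t1 : τ * (16 * (τ⁻¹) ^ 2 * ∑ k ∈ Finset.Ico 1 N, x k ^ 2) ≤ 16 * K * τ ^ 2 := by
      calc τ * (16 * (τ⁻¹) ^ 2 * ∑ k ∈ Finset.Ico 1 N, x k ^ 2)
          ≤ τ * (16 * (τ⁻¹) ^ 2 * (K * τ ^ 3)) := by gcongr
        _ = _ := by field_simp
    have t2 : τ * ∑ k ∈ Finset.Ico 1 N, y k ^ 2 ≤ K * τ ^ 2 := by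
      calc τ * ∑ k ∈ Finset.Ico 1 N, y k ^ 2 ≤ τ * (K * τ) := by gcongr
        _ = _ := by ring
    have t3 : τ * (τ ^ 2 * ∑ k ∈ Finset.Ico 1 N, z k ^ 2) ≤ K * τ ^ 2 := by
      calc τ * (τ ^ 2 * ∑ k ∈ Finset.Ico 1 N, z k ^ 2)
          = τ ^ 2 * (τ * ∑ k ∈ Finset.Ico 1 N, z k ^ 2) := by ring
        _ ≤ τ ^ 2 * K := by gcongr
        _ = _ := by ring
    have t4 : τ * (((N - 1 : ℕ) : ℝ) * (4 * C ^ 2 * τ ^ 4)) ≤ 4 * C ^ 2 * L ^ 3 * τ ^ 2 := by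
      calc τ * (((N - 1 : ℕ) : ℝ) * (4 * C ^ 2 * τ ^ 4)) ≤ τ * (N * (4 * C ^ 2 * τ ^ 4)) := by gcongr
        _ = 4 * C ^ 2 * (N * τ) * τ ^ 2 * τ ^ 2 := by ring
        _ ≤ 4 * C ^ 2 * L * L ^ 2 * τ ^ 2 := by gcongr
        _ = _ := by ring
    have hs' := mul_le_mul_of_nonneg_left hs hτ.le
    rw [hsplit, mul_add]
    have hKτ : 0 ≤ K * τ ^ 2 := by positivity
    linarith

end Abstract

/-! ### Solvability and the combination of the two parts -/

section Abstract

variable {V H P : Type*}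
  [NormedAddCommGroup V] [InnerProductSpace ℝ V] [CompleteSpace V]
  [NormedAddCommGroup H] [InnerProductSpace ℝ H] [CompleteSpace H]
  [NormedAddCommGroup P] [InnerProductSpace ℝ P] [CompleteSpace P]

open ContinuousLinearMap in
/-- Solvability of the abstract scheme. -/
lemma IsSplitting.exists_solution {τ : ℝ} {J G Z : V →L[ℝ] H} {D : V →L[ℝ] P}
    (h : IsSplitting τ J G Z D) (hτ : 0 < τ) (δ : ℕ → P) (R : ℕ → H) :
    ∃ (E : ℕ → V) (α : ℕ → P), E 0 = 0 ∧ α 0 = 0 ∧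
      (∀ k, α (k + 1) = α k + δ k - τ⁻¹ • D (E (k + 1))) ∧
      ∀ k v, momentum τ J G Z (E k) (E (k + 1)) v =
        inner ℝ (R k) (J v) + inner ℝ (α k + δ k - τ⁻¹ • D (E k)) (D v) := by
  -- The implicit operator of the step is the inner product of `V` itself, so the Riesz
  -- representation by adjoints solves it explicitly.
  let next : ℕ → V → P → V := fun k e a =>
    e - τ • (adjoint G) (G e) + τ • ((adjoint J) (R k) + (adjoint D) (a + δ k - τ⁻¹ • D e))
  let S : ℕ → V × P := fun n => Nat.rec (0, 0) (fun k s =>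
    (next k s.1 s.2, s.2 + δ k - τ⁻¹ • D (next k s.1 s.2))) n
  refine ⟨fun k => (S k).1, fun k => (S k).2, rfl, rfl, fun k => rfl, fun k v => ?_⟩
  have hE : (S (k + 1)).1 = next k (S k).1 (S k).2 := rfl
  set e := (S k).1
  set a := (S k).2
  have hin : inner ℝ (next k e a - e) v = τ * (-inner ℝ (G e) (G v) + inner ℝ (R k) (J v)
      + inner ℝ (a + δ k - τ⁻¹ • D e) (D v)) := by
    have : next k e a - e = τ • (-(adjoint G) (G e) + (adjoint J) (R k)
        + (adjoint D) (a + δ k - τ⁻¹ • D e)) := by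
      simp only [next, smul_add, smul_neg]; abel
    rw [this, real_inner_smul_left, inner_add_left, inner_add_left, inner_neg_left,
      adjoint_inner_left, adjoint_inner_left, adjoint_inner_left]
  rw [h.inner_eq] at hin
  change momentum τ J G Z e (S (k + 1)).1 v =
    inner ℝ (R k) (J v) + inner ℝ (a + δ k - τ⁻¹ • D e) (D v)
  rw [hE]
  unfold momentum
  have hG : inner ℝ (G (next k e a + e)) (G v) =
      inner ℝ (G (next k e a - e)) (G v) + 2 * inner ℝ (G e) (G v) := by
    simp only [map_add, map_sub, inner_add_left, inner_sub_left]; ring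
  rw [hG]
  have := congrArg (τ⁻¹ * ·) hin
  simp only [← mul_assoc, inv_mul_cancel₀ hτ.ne', one_mul, mul_add] at this
  have e1 : τ⁻¹ * (τ / 2) = 1 / 2 := by field_simp
  have e2 : τ⁻¹ * (τ ^ 2 / 4) = τ / 4 := by field_simp
  rw [e1, e2] at this
  linarith

/-- The a priori estimate for the pressure of the abstract scheme. -/
theorem exists_pressure_bound (T C : ℝ) (hT : 0 < T) (hC : 0 ≤ C) :
    ∃ c : ℝ, 0 ≤ c ∧ ∀ (τ : ℝ) (N : ℕ), 0 < τ → ((N : ℝ) - 1 / 2) * τ ≤ T →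
      ∀ (J G Z : V →L[ℝ] H) (D : V →L[ℝ] P), IsSplitting τ J G Z D →
      ∀ (E : ℕ → V) (α δ : ℕ → P) (R : ℕ → H) (ℓ : V → ℝ), E 0 = 0 → α 0 = 0 →
        (∀ k < N, α (k + 1) = α k + δ k - τ⁻¹ • D (E (k + 1))) →
        (∀ v, |ℓ v| ≤ C * τ * ‖G v‖) →
        (0 < N → ∀ v, momentum τ J G Z (E 0) (E 1) v = inner ℝ (R 0) (J v) + ℓ v) →
        (∀ k, 1 ≤ k → k < N → ∀ v, momentum τ J G Z (E k) (E (k + 1)) v =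
          inner ℝ (R k) (J v) + inner ℝ (α k + δ k - τ⁻¹ • D (E k)) (D v)) →
        (∀ k < N, ‖R k‖ ≤ C * τ ^ 2) → (∀ k < N, ‖δ k‖ ≤ C * τ) →
        (∀ k, 1 ≤ k → k + 1 < N → ‖δ (k + 1) - δ k‖ ≤ C * τ ^ 2) →
        ∃ κ : ℕ → ℝ, (∀ k < N, 0 ≤ κ k ∧ ∀ v, |inner ℝ (α (k + 1)) (D v)| ≤ κ k * ‖Z v‖) ∧
          τ * ∑ k ∈ Finset.range N, κ k ^ 2 ≤ (c * τ) ^ 2 := by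
  -- For `N ≥ 1` one has `N ≤ 2 (N - 1/2)`, so both `N τ` and `τ` are at most `2 T`.
  set L := 2 * T with hLdef
  set K₁ := C * (1 + L) with hK₁
  set K₂ := 3 * K₁ + 9 * C * L with hK₂
  set K₃ := K₂ ^ 2 + 16 * L * C * K₂ + L ^ 2 * C ^ 2 with hK₃
  set Ka := 9 * K₂ ^ 2 * L + 4 * L ^ 2 * (K₁ ^ 2 + K₃) + 4 * K₂ ^ 2 * L ^ 3 + K₁ ^ 2 * L with hKa
  set Kb := (2 * C) ^ 2 * (4 + 2 * L) * (52 + 2 * L + 16 * L ^ 2) with hKb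
  set K := 2 * (Ka + Kb) with hK
  have hL0 : 0 ≤ L := by positivity
  have hK0 : 0 ≤ K := by positivity
  refine ⟨√(2 * C ^ 2 * L + 22 * K + 4 * C ^ 2 * L ^ 3), Real.sqrt_nonneg _, ?_⟩
  intro τ N hτ hN J G Z D h E α δ R ℓ hE0 hα0 hα hℓ hfirst hstep hR hδ hδ2
  rcases Nat.eq_zero_or_pos N with rfl | hNpos
  · exact ⟨0, fun k hk => absurd hk (by omega), by simp; positivity⟩
  have hN1 : (1 : ℝ) ≤ N := by exact_mod_cast hNpos
  have hτL : τ ≤ L := by nlinarith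
  have hNL : N * τ ≤ L := by nlinarith
  -- No second-difference bound is assumed between `δ 0` and `δ 1`. Replacing `δ 0` by `δ 1` makes
  -- this difference vanish in the forced part, and the discrepancy, of order `τ`, goes to the
  -- start-up part.
  set δa : ℕ → P := fun k => if k = 0 then (if 1 < N then δ 1 else δ 0) else δ k with hδa
  have hδas : ∀ k, 1 ≤ k → δa k = δ k := fun k hk => by
    simp only [hδa]; rw [if_neg (by omega)]
  have hδab : ∀ k < N, ‖δa k‖ ≤ C * τ := by
    intro k hk
    simp only [hδa]
    split_ifs with h1 h2
    · exact hδ 1 h2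
    · exact hδ 0 hNpos
    · exact hδ k hk
  have hδad : ∀ k, k + 1 < N → ‖δa (k + 1) - δa k‖ ≤ C * τ ^ 2 := by
    intro k hk
    rw [hδas _ (by omega)]
    rcases Nat.eq_zero_or_pos k with rfl | hk0
    · have : δa 0 = δ 1 := by simp only [hδa, if_true]; rw [if_pos (by omega)]
      rw [this, zero_add, sub_self, norm_zero]; positivity
    · rw [hδas k hk0]; exact hδ2 k hk0 hk
  obtain ⟨Ea, αa, hEa0, hαa0, hαa, hma⟩ := h.exists_solution hτ δa R
  have hA := h.forced_bounds hτ hNL hτL hC hNpos Ea αa δa R hEa0 hαa0 (fun k _ => hαa k)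
    (fun k _ => hma k) hR hδab hδad hK₁ hK₂ hK₃
  -- The start-up part: from the second step on, residuals and pressure increments cancel.
  set Eb : ℕ → V := fun k => E k - Ea k with hEb
  set αb : ℕ → P := fun k => α k - αa k with hαb
  have hEb0 : Eb 0 = 0 := by simp [hEb, hE0, hEa0]
  have hαb1 : αb 1 = (δ 0 - δa 0) - τ⁻¹ • D (Eb 1) := by
    simp only [hαb, hEb, hα 0 hNpos, hαa, hα0, hαa0, map_sub, smul_sub]
    abel_nf
  have hγ : ‖δ 0 - δa 0‖ ≤ 2 * C * τ := by
    have := norm_sub_le (δ 0) (δa 0)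
    have := hδ 0 hNpos
    have := hδab 0 hNpos
    linarith
  have hfb : momentum τ J G Z 0 (Eb 1) (Eb 1) ≤ 2 * C * τ * ‖G (Eb 1)‖ := by
    have h1 : momentum τ J G Z 0 (Eb 1) (Eb 1) = ℓ (Eb 1) - inner ℝ (δa 0) (D (Eb 1)) := by
      rw [← hEb0]
      simp only [hEb]
      rw [momentum_sub, hfirst hNpos, hma, hαa0, hEa0]
      simp
    have h2 := (le_abs_self _).trans (hℓ (Eb 1))
    have h3 : -inner ℝ (δa 0) (D (Eb 1)) ≤ C * τ * ‖G (Eb 1)‖ := by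
      refine (neg_le_abs _).trans ((abs_real_inner_le_norm _ _).trans ?_)
      exact mul_le_mul (hδab 0 hNpos) ((h.div_le _).trans (h.emb_le _)) (norm_nonneg _)
        (by positivity)
    linarith
  obtain ⟨b1, b2, b3⟩ := first_homogeneous (D := D) hτ hτL (Eb 1) (δ 0 - δa 0) hfb hγ
  have hB : StepBounds τ N Kb J G Z Eb := by
    refine h.homogeneous_bounds hτ hNL hτL (by positivity) hNpos Eb αb ?_ ?_ (hαb1 ▸ b3) b2 b1
    · intro k hk hkN
      simp only [hαb, hEb, hα k hkN, hαa, hδas k hk, map_sub, smul_sub]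
      abel
    · intro k hk hkN v
      simp only [hαb, hEb]
      rw [momentum_sub, hstep k hk hkN, hma, hδas k hk]
      simp only [map_sub, smul_sub, inner_sub_left, inner_add_left]
      ring
  have hS := hA.add hτ hB
  have hsum : (fun k => Ea k + Eb k) = E := by funext k; simp [hEb]
  rw [hsum, ← hK] at hS
  rw [mul_pow, Real.sq_sqrt (by positivity)]
  exact h.pressure_bound_of_stepBounds hτ hτL hNL hNpos hC hK0 hα0 hα hstep hR hδ hS

end Abstract

/-! ### Trigonometric systems on the unit cube -/

/-- The normalised sines (`b = true`) and cosines (`b = false`) on `(0,1)`, indexed by their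
frequency; the sine of frequency zero vanishes. -/
noncomputable def tr (b : Bool) (k : ℕ) (x : ℝ) : ℝ :=
  if b then √2 * Real.sin (k * Real.pi * x)
  else (if k = 0 then 1 else √2) * Real.cos (k * Real.pi * x)

lemma tr_true_zero : tr true 0 = 0 := by funext x; simp [tr]

lemma contDiff_tr (b : Bool) (k : ℕ) : ContDiff ℝ ∞ (tr b k) := by
  unfold tr
  cases b
  · simp only [Bool.false_eq_true, if_false]; fun_prop
  · simp only [if_true]; fun_prop

lemma tr_true_boundary (k : ℕ) : tr true k 0 = 0 ∧ tr true k 1 = 0 := by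
  simp [tr, Real.sin_nat_mul_pi]

lemma deriv_tr_true (k : ℕ) : deriv (tr true k) = fun x => (k * Real.pi) * tr false k x := by
  funext x
  have h : HasDerivAt (tr true k) (√2 * (Real.cos (k * Real.pi * x) * (k * Real.pi))) x := by
    have h1 : HasDerivAt (fun x : ℝ => k * Real.pi * x) (k * Real.pi) x := by
      simpa using (hasDerivAt_id x).const_mul (k * Real.pi)
    exact (h1.sin).const_mul √2
  rw [h.deriv]
  rcases eq_or_ne k 0 with rfl | hk
  · simp
  · simp only [tr, Bool.false_eq_true, if_false, if_neg hk]; ring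

lemma deriv_tr_false (k : ℕ) : deriv (tr false k) = fun x => -(k * Real.pi) * tr true k x := by
  funext x
  have h : HasDerivAt (tr false k)
      ((if k = 0 then 1 else √2) * (-Real.sin (k * Real.pi * x) * (k * Real.pi))) x := by
    have h1 : HasDerivAt (fun x : ℝ => k * Real.pi * x) (k * Real.pi) x := by
      simpa using (hasDerivAt_id x).const_mul (k * Real.pi)
    exact (h1.cos).const_mul (if k = 0 then 1 else √2)
  rw [h.deriv]
  rcases eq_or_ne k 0 with rfl | hk
  · simp
  · simp only [tr, if_true, if_neg hk]; ring

lemma integral_cos_int (m : ℤ) :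
    ∫ x in (0 : ℝ)..1, Real.cos (m * Real.pi * x) = if m = 0 then 1 else 0 := by
  split_ifs with h
  · simp [h]
  · have hc : (m : ℝ) * Real.pi ≠ 0 := mul_ne_zero (by exact_mod_cast h) Real.pi_ne_zero
    rw [intervalIntegral.integral_comp_mul_left (fun y => Real.cos y) hc]
    simp [Real.sin_int_mul_pi]

lemma integral_tr_mul_tr (b : Bool) (k l : ℕ) :
    ∫ x in Ioo (0 : ℝ) 1, tr b k x * tr b l x =
      if k = l ∧ (b = true → k ≠ 0) then 1 else 0 := by
  rw [← integral_Ioc_eq_integral_Ioo, ← intervalIntegral.integral_of_le zero_le_one]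
  have i1 : ∀ m : ℤ, IntervalIntegrable (fun x : ℝ => Real.cos (m * Real.pi * x)) volume 0 1 :=
    fun m => (by fun_prop : Continuous fun x : ℝ => Real.cos (m * Real.pi * x)).intervalIntegrable _ _
  have h2 : √2 * √2 = 2 := Real.mul_self_sqrt zero_le_two
  cases b
  · have e : ∀ x : ℝ, tr false k x * tr false l x =
        (if k = 0 then 1 else √2) * (if l = 0 then 1 else √2) / 2 *
        (Real.cos (((k : ℤ) - l : ℤ) * Real.pi * x) + Real.cos (((k : ℤ) + l : ℤ) * Real.pi * x)) := by
      intro x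
      simp only [tr, Bool.false_eq_true, if_false]
      push_cast
      rw [show ((k : ℝ) - l) * Real.pi * x = k * Real.pi * x - l * Real.pi * x by ring,
        show ((k : ℝ) + l) * Real.pi * x = k * Real.pi * x + l * Real.pi * x by ring,
        Real.cos_add, Real.cos_sub]
      ring
    simp only [e]
    rw [intervalIntegral.integral_const_mul, intervalIntegral.integral_add (i1 _) (i1 _),
      integral_cos_int, integral_cos_int]
    rcases eq_or_ne k l with rfl | hkl
    · rcases eq_or_ne k 0 with rfl | hk
      · norm_num
      · rw [if_neg hk, if_pos (by omega), if_neg (by omega), h2]; simp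
    · rw [if_neg (by omega : ¬ ((k : ℤ) - l = 0)), if_neg (by omega : ¬ ((k : ℤ) + l = 0))]
      simp [hkl]
  · have e : ∀ x : ℝ, tr true k x * tr true l x =
        Real.cos (((k : ℤ) - l : ℤ) * Real.pi * x) - Real.cos (((k : ℤ) + l : ℤ) * Real.pi * x) := by
      intro x
      simp only [tr, if_true]
      push_cast
      rw [show ((k : ℝ) - l) * Real.pi * x = k * Real.pi * x - l * Real.pi * x by ring,
        show ((k : ℝ) + l) * Real.pi * x = k * Real.pi * x + l * Real.pi * x by ring,
        Real.cos_add, Real.cos_sub]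
      linear_combination (Real.sin (k * Real.pi * x) * Real.sin (l * Real.pi * x)) * h2
    simp only [e]
    rw [intervalIntegral.integral_sub (i1 _) (i1 _), integral_cos_int, integral_cos_int]
    rcases eq_or_ne k l with rfl | hkl
    · rcases eq_or_ne k 0 with rfl | hk
      · simp
      · rw [if_pos (by omega), if_neg (by omega)]; simp [hk]
    · rw [if_neg (by omega : ¬ ((k : ℤ) - l = 0)), if_neg (by omega : ¬ ((k : ℤ) + l = 0))]
      simp [hkl]

/-- The span of each system is stable under multiplication by `cos (π x)`. This is all that the
completeness proof requires of the systems besides a mode without zeros. -/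
lemma exists_cos_mul_tr (b : Bool) (k : ℕ) : ∃ (c₁ c₂ : ℝ) (l₁ l₂ : ℕ), ∀ x,
    Real.cos (Real.pi * x) * tr b k x = c₁ * tr b l₁ x + c₂ * tr b l₂ x := by
  have h0 : √2 ≠ 0 := by positivity
  rcases k with _ | k
  · cases b
    · exact ⟨(√2)⁻¹, 0, 1, 0, fun x => by simp [tr]⟩
    · exact ⟨0, 0, 0, 0, fun x => by simp [tr_true_zero]⟩
  · have e1 : ∀ x : ℝ, ((k + 1 + 1 : ℕ) : ℝ) * Real.pi * x =
        ((k + 1 : ℕ) : ℝ) * Real.pi * x + Real.pi * x := fun x => by push_cast; ring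
    have e2 : ∀ x : ℝ, (k : ℝ) * Real.pi * x =
        ((k + 1 : ℕ) : ℝ) * Real.pi * x - Real.pi * x := fun x => by push_cast; ring
    cases b
    -- The quotient accounts for the different normalization of the constant cosine.
    · refine ⟨1 / 2, √2 / 2 / (if k = 0 then 1 else √2), k + 2, k, fun x => ?_⟩
      have hk : (if k = 0 then (1 : ℝ) else √2) ≠ 0 := by split_ifs <;> simp
      simp only [tr, Bool.false_eq_true, if_false, Nat.add_eq_zero_iff, one_ne_zero, and_false,
        OfNat.ofNat_ne_zero]
      rw [← mul_assoc _ _ (Real.cos (k * Real.pi * x)), div_mul_cancel₀ _ hk, e1, e2, Real.cos_add,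
        Real.cos_sub]
      ring
    · refine ⟨1 / 2, 1 / 2, k + 2, k, fun x => ?_⟩
      simp only [tr, if_true]
      rw [e1, e2, Real.sin_add, Real.sin_sub]
      ring

variable {d : ℕ}

/-- The product function `x ↦ ∏ θ_j(x_j)`. -/
def fprod (θ : Fin d → ℝ → ℝ) (x : Fin d → ℝ) : ℝ := ∏ j, θ j (x j)

/-- Products of sines and cosines. -/
noncomputable def trig (σ : Fin d → Bool) (n : Fin d → ℕ) : (Fin d → ℝ) → ℝ :=
  fprod fun j => tr (σ j) (n j)

lemma contDiff_fprod {θ : Fin d → ℝ → ℝ} (h : ∀ j, ContDiff ℝ ∞ (θ j)) :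
    ContDiff ℝ ∞ (fprod θ) := by
  unfold fprod
  exact contDiff_prod fun j _ => (h j).comp (contDiff_apply ℝ ℝ j)

lemma contDiff_trig (σ : Fin d → Bool) (n : Fin d → ℕ) : ContDiff ℝ ∞ (trig σ n) :=
  contDiff_fprod fun _ => contDiff_tr _ _

lemma continuous_trig (σ : Fin d → Bool) (n : Fin d → ℕ) : Continuous (trig σ n) :=
  (contDiff_trig σ n).continuous

lemma isOpen_cube : IsOpen (cube d) := isOpen_set_pi finite_univ fun _ _ => isOpen_Ioo

lemma vol_eq_pi : vol d = Measure.pi fun _ => volume.restrict (Ioo (0 : ℝ) 1) := by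
  rw [← Measure.restrict_pi_pi]; rfl

lemma cube_subset_Icc : cube d ⊆ Icc 0 1 := fun _ hx =>
  ⟨fun j => (hx j trivial).1.le, fun j => (hx j trivial).2.le⟩

instance isFiniteMeasure_vol : IsFiniteMeasure (vol d) := by
  rw [vol_eq_pi]; infer_instance

lemma _root_.Continuous.memLp_vol {ψ : (Fin d → ℝ) → ℝ} (h : Continuous ψ) (p : ℝ≥0∞) :
    MemLp ψ p (vol d) := by
  obtain ⟨C, hC⟩ := (isCompact_Icc (a := (0 : Fin d → ℝ)) (b := 1)).exists_bound_of_continuousOn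
    h.continuousOn
  refine MemLp.of_bound h.aestronglyMeasurable C ?_
  filter_upwards [ae_restrict_mem isOpen_cube.measurableSet] with x hx
  exact hC x (cube_subset_Icc hx)

/-- A continuous function as an element of `L²(Ω)`. -/
noncomputable def toL2 (ψ : (Fin d → ℝ) → ℝ) (h : Continuous ψ) : L2 d := (h.memLp_vol 2).toLp

lemma coeFn_toL2 {ψ : (Fin d → ℝ) → ℝ} (h : Continuous ψ) : toL2 ψ h =ᵐ[vol d] ψ :=
  MemLp.coeFn_toLp _

lemma inner_toL2 {ψ : (Fin d → ℝ) → ℝ} (h : Continuous ψ) (u : L2 d) :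
    inner ℝ (toL2 ψ h) u = ∫ x in cube d, u x * ψ x := by
  rw [L2.inner_def]
  refine integral_congr_ae ?_
  filter_upwards [coeFn_toL2 h] with x hx
  rw [hx]; rfl

lemma integrable_mul_continuous (u : L2 d) {ψ : (Fin d → ℝ) → ℝ} (h : Continuous ψ) :
    Integrable (fun x => u x * ψ x) (vol d) :=
  (Lp.memLp u).integrable_mul (h.memLp_vol 2)

/-- The trigonometric coefficients of a function. -/
noncomputable def coef (σ : Fin d → Bool) (n : Fin d → ℕ) (u : L2 d) : ℝ :=
  inner ℝ (toL2 (trig σ n) (continuous_trig σ n)) u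

lemma coef_eq_integral (σ : Fin d → Bool) (n : Fin d → ℕ) (u : L2 d) :
    coef σ n u = ∫ x in cube d, u x * trig σ n x := inner_toL2 _ _

@[simp] lemma coef_add (σ : Fin d → Bool) (n : Fin d → ℕ) (u v : L2 d) :
    coef σ n (u + v) = coef σ n u + coef σ n v := inner_add_right _ _ _

@[simp] lemma coef_sub (σ : Fin d → Bool) (n : Fin d → ℕ) (u v : L2 d) :
    coef σ n (u - v) = coef σ n u - coef σ n v := inner_sub_right _ _ _

@[simp] lemma coef_neg (σ : Fin d → Bool) (n : Fin d → ℕ) (u : L2 d) :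
    coef σ n (-u) = -coef σ n u := inner_neg_right _ _

@[simp] lemma coef_smul (σ : Fin d → Bool) (n : Fin d → ℕ) (c : ℝ) (u : L2 d) :
    coef σ n (c • u) = c * coef σ n u := real_inner_smul_right _ _ _

@[simp] lemma coef_zero (σ : Fin d → Bool) (n : Fin d → ℕ) : coef σ n (0 : L2 d) = 0 :=
  inner_zero_right _

lemma coef_sum {ι : Type*} (s : Finset ι) (σ : Fin d → Bool) (n : Fin d → ℕ) (u : ι → L2 d) :
    coef σ n (∑ i ∈ s, u i) = ∑ i ∈ s, coef σ n (u i) := inner_sum _ _ _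

/-- The frequencies for which the product `trig σ n` does not vanish. -/
def Supp (σ : Fin d → Bool) : Set (Fin d → ℕ) := {n | ∀ j, σ j = true → n j ≠ 0}

lemma trig_eq_zero {σ : Fin d → Bool} {n : Fin d → ℕ} (h : n ∉ Supp σ) : trig σ n = 0 := by
  simp only [Supp, mem_ofPred_eq, not_forall, not_not] at h
  obtain ⟨j, hj, hn⟩ := h
  funext x
  refine Finset.prod_eq_zero (Finset.mem_univ j) ?_
  simp [hj, hn, tr_true_zero]

lemma coef_eq_zero {σ : Fin d → Bool} {n : Fin d → ℕ} (h : n ∉ Supp σ) (u : L2 d) :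
    coef σ n u = 0 := by
  rw [coef_eq_integral, trig_eq_zero h]; simp

lemma integral_trig_mul_trig (σ : Fin d → Bool) (n m : Fin d → ℕ) :
    ∫ x in cube d, trig σ n x * trig σ m x =
      ∏ j, if n j = m j ∧ (σ j = true → n j ≠ 0) then (1 : ℝ) else 0 := by
  change ∫ x, _ ∂(vol d) = _
  rw [vol_eq_pi]
  simp only [trig, fprod, ← Finset.prod_mul_distrib]
  rw [integral_fintype_prod_eq_prod (fun j x => tr (σ j) (n j) x * tr (σ j) (m j) x)]
  simp only [integral_tr_mul_tr]

lemma orthonormal_trig (σ : Fin d → Bool) :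
    Orthonormal ℝ fun n : Supp σ => toL2 (trig σ n.1) (continuous_trig σ n.1) := by
  classical
  rw [orthonormal_iff_ite]
  intro n m
  rw [inner_toL2]
  have h : ∫ x in cube d, toL2 (trig σ m.1) (continuous_trig σ m.1) x * trig σ n.1 x =
      ∫ x in cube d, trig σ m.1 x * trig σ n.1 x := by
    refine integral_congr_ae ?_
    filter_upwards [coeFn_toL2 (continuous_trig σ m.1)] with x hx
    rw [hx]
  rw [h, integral_trig_mul_trig]
  split_ifs with hnm
  · subst hnm
    refine Finset.prod_eq_one fun j _ => ?_
    rw [if_pos ⟨rfl, n.2 j⟩]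
  · obtain ⟨j, hj⟩ := Function.ne_iff.1 (fun h => hnm (Subtype.ext h))
    exact Finset.prod_eq_zero (Finset.mem_univ j) (if_neg fun h => hj h.1.symm)

/-! ### Completeness of the trigonometric systems and Parseval's identity -/

/-- The projection of `ℝ^d` onto the closed cube. -/
def clamp (x : Fin d → ℝ) : Icc (0 : Fin d → ℝ) 1 :=
  ⟨fun j => max 0 (min 1 (x j)), fun _ => le_max_left _ _,
    fun _ => max_le zero_le_one (min_le_left _ _)⟩

lemma continuous_clamp : Continuous (clamp (d := d)) := by
  refine Continuous.subtype_mk ?_ _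
  fun_prop

lemma clamp_of_mem {x : Fin d → ℝ} (hx : x ∈ cube d) : (clamp x : Fin d → ℝ) = x := by
  funext j
  have := hx j trivial
  simp only [clamp]
  rw [min_eq_right this.2.le, max_eq_right this.1.le]

lemma trig_update (σ : Fin d → Bool) (n : Fin d → ℕ) (j : Fin d) (l : ℕ) (x : Fin d → ℝ) :
    trig σ (Function.update n j l) x =
      tr (σ j) l (x j) * ∏ i ∈ Finset.univ.erase j, tr (σ i) (n i) (x i) := by
  unfold trig fprod
  rw [← Finset.mul_prod_erase _ _ (Finset.mem_univ j)]
  dsimp only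
  rw [Function.update_self]
  congr 1
  refine Finset.prod_congr rfl fun i hi => ?_
  rw [Function.update_of_ne (Finset.ne_of_mem_erase hi)]

lemma exists_cos_mul_trig (σ : Fin d → Bool) (n : Fin d → ℕ) (j : Fin d) :
    ∃ (c₁ c₂ : ℝ) (m₁ m₂ : Fin d → ℕ), ∀ x,
      Real.cos (Real.pi * x j) * trig σ n x = c₁ * trig σ m₁ x + c₂ * trig σ m₂ x := by
  obtain ⟨c₁, c₂, l₁, l₂, h⟩ := exists_cos_mul_tr (σ j) (n j)
  refine ⟨c₁, c₂, Function.update n j l₁, Function.update n j l₂, fun x => ?_⟩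
  have e := trig_update σ n j (n j) x
  rw [Function.update_eq_self] at e
  rw [e, trig_update, trig_update, ← mul_assoc, h]
  ring

/-- A square integrable function whose trigonometric coefficients vanish is zero. -/
theorem eq_zero_of_coef_eq_zero (σ : Fin d → Bool) (f : L2 d) (hf : ∀ n, coef σ n f = 0) :
    f = 0 := by
  have hint : ∀ n (h : C(Icc (0 : Fin d → ℝ) 1, ℝ)),
      Integrable (fun x => f x * (trig σ n x * h (clamp x))) (vol d) := fun n h =>
    integrable_mul_continuous f
      ((continuous_trig σ n).mul (h.continuous.comp continuous_clamp))
  -- The aim is `Λ n = 0` for all `n`. Stone-Weierstrass needs a compact space, hence the closed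
  -- cube; composition with `clamp` makes `h` a function on the whole space and changes nothing on
  -- the open cube.
  let Λ : (Fin d → ℕ) → C(Icc (0 : Fin d → ℝ) 1, ℝ) →L[ℝ] ℝ := fun n =>
    LinearMap.mkContinuous
      { toFun := fun h => ∫ x in cube d, f x * (trig σ n x * h (clamp x))
        map_add' := fun h g => by
          rw [← integral_add (hint n h) (hint n g)]
          refine integral_congr_ae (ae_of_all _ fun x => ?_)
          simp only [ContinuousMap.add_apply]; ring
        map_smul' := fun c h => by
          rw [RingHom.id_apply, smul_eq_mul, ← integral_const_mul]
          refine integral_congr_ae (ae_of_all _ fun x => ?_)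
          simp only [ContinuousMap.smul_apply, smul_eq_mul]; ring }
      (∫ x in cube d, |f x * trig σ n x|) fun h => by
        change ‖∫ x in cube d, f x * (trig σ n x * h (clamp x))‖ ≤ _
        rw [mul_comm, ← integral_const_mul]
        refine norm_integral_le_of_norm_le
          ((integrable_mul_continuous f (continuous_trig σ n)).abs.const_mul _)
          (ae_of_all _ fun x => ?_)
        rw [← mul_assoc, norm_mul, mul_comm, Real.norm_eq_abs (_ * _)]
        exact mul_le_mul_of_nonneg_right (h.norm_coe_le_norm _) (abs_nonneg _)
  have hΛ : ∀ n h, Λ n h = ∫ x in cube d, f x * (trig σ n x * h (clamp x)) := fun _ _ => rfl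
  let cosc : Fin d → C(Icc (0 : Fin d → ℝ) 1, ℝ) := fun j =>
    ⟨fun x => Real.cos (Real.pi * x.1 j), Real.continuous_cos.comp (continuous_const.mul
      ((continuous_apply j).comp continuous_subtype_val))⟩
  have hmul : ∀ j (g : C(Icc (0 : Fin d → ℝ) 1, ℝ)), (∀ n, Λ n g = 0) →
      ∀ n, Λ n (cosc j * g) = 0 := by
    intro j g hg n
    obtain ⟨c₁, c₂, m₁, m₂, h⟩ := exists_cos_mul_trig σ n j
    have e : Λ n (cosc j * g) = c₁ * Λ m₁ g + c₂ * Λ m₂ g := by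
      rw [hΛ, hΛ, hΛ, ← integral_const_mul, ← integral_const_mul,
        ← integral_add ((hint m₁ g).const_mul _) ((hint m₂ g).const_mul _)]
      refine setIntegral_congr_fun isOpen_cube.measurableSet fun x hx => ?_
      have := h x
      simp only [ContinuousMap.mul_apply, cosc, ContinuousMap.coe_mk, clamp_of_mem hx]
      linear_combination (f x * g (clamp x)) * this
    rw [e, hg, hg]; ring
  let A : Subalgebra ℝ C(Icc (0 : Fin d → ℝ) 1, ℝ) := Algebra.adjoin ℝ (range cosc)
  -- The vanishing is claimed for all `n` simultaneously, since multiplication by a cosine shifts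
  -- the frequency.
  have hA : ∀ a ∈ A, ∀ g : C(Icc (0 : Fin d → ℝ) 1, ℝ), (∀ n, Λ n g = 0) →
      ∀ n, Λ n (a * g) = 0 := by
    intro a ha
    induction ha using Algebra.adjoin_induction with
    | mem a ha => obtain ⟨j, rfl⟩ := ha; exact hmul j
    | algebraMap r =>
      intro g hg n
      rw [← Algebra.smul_def, map_smul, hg, smul_zero]
    | add a b _ _ ha hb =>
      intro g hg n
      rw [add_mul, map_add, ha g hg, hb g hg, add_zero]
    | mul a b _ _ ha hb =>
      intro g hg n
      rw [mul_assoc]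
      exact ha _ (hb g hg) n
  have hsep : A.SeparatesPoints := by
    intro x y hxy
    obtain ⟨j, hj⟩ := Function.ne_iff.1 (fun h => hxy (Subtype.ext h))
    refine ⟨cosc j, ⟨cosc j, Algebra.subset_adjoin ⟨j, rfl⟩, rfl⟩, fun h => hj ?_⟩
    have hx : Real.pi * x.1 j ∈ Icc 0 Real.pi :=
      ⟨mul_nonneg Real.pi_pos.le (x.2.1 j), mul_le_of_le_one_right Real.pi_pos.le (x.2.2 j)⟩
    have hy : Real.pi * y.1 j ∈ Icc 0 Real.pi :=
      ⟨mul_nonneg Real.pi_pos.le (y.2.1 j), mul_le_of_le_one_right Real.pi_pos.le (y.2.2 j)⟩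
    exact mul_left_cancel₀ Real.pi_ne_zero (Real.injOn_cos hx hy h)
  have hone : ∀ n, Λ n 1 = 0 := fun n => by
    rw [hΛ, ← hf n, coef_eq_integral]
    simp
  have hall : ∀ (g : C(Icc (0 : Fin d → ℝ) 1, ℝ)) n, Λ n g = 0 := by
    intro g n
    have hcl : IsClosed {g | Λ n g = 0} := isClosed_eq (Λ n).continuous continuous_const
    have hsub : (A : Set C(Icc (0 : Fin d → ℝ) 1, ℝ)) ⊆ {g | Λ n g = 0} := fun a ha => by
      have := hA a ha 1 hone n
      rwa [mul_one] at this
    have hg : g ∈ A.topologicalClosure := by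
      rw [ContinuousMap.subalgebra_topologicalClosure_eq_top_of_separatesPoints A hsep]
      trivial
    exact closure_minimal hsub hcl hg
  -- The lowest mode has no zero in the open cube, so it can be divided out of `f * trig σ n₀ = 0`.
  let n₀ : Fin d → ℕ := fun j => if σ j then 1 else 0
  have hpos : ∀ x ∈ cube d, trig σ n₀ x ≠ 0 := by
    intro x hx
    unfold trig fprod
    refine Finset.prod_ne_zero_iff.2 fun j _ => ?_
    have hj := hx j trivial
    cases hσ : σ j
    · simp [tr, n₀, hσ]
    · have : 0 < Real.sin (Real.pi * x j) :=
        Real.sin_pos_of_pos_of_lt_pi (mul_pos Real.pi_pos hj.1)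
          (mul_lt_of_lt_one_right Real.pi_pos hj.2)
      simp [tr, n₀, hσ, this.ne']
  have hae : ∀ᵐ x ∂(volume : Measure (Fin d → ℝ)), x ∈ cube d → f x * trig σ n₀ x = 0 := by
    refine isOpen_cube.ae_eq_zero_of_integral_contDiff_smul_eq_zero
      (IntegrableOn.locallyIntegrableOn
        (integrable_mul_continuous f (continuous_trig σ n₀))) fun g hg _ hgs => ?_
    have := hall ⟨fun x => g x.1, hg.continuous.comp continuous_subtype_val⟩ n₀
    rw [hΛ] at this
    rw [← this, ← setIntegral_eq_integral_of_forall_compl_eq_zero (s := cube d)]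
    · refine setIntegral_congr_fun isOpen_cube.measurableSet fun x hx => ?_
      simp only [smul_eq_mul, ContinuousMap.coe_mk, clamp_of_mem hx]
      ring
    · intro x hx
      have : g x = 0 := image_eq_zero_of_notMem_tsupport fun h => hx (hgs h)
      rw [this, zero_smul]
  rw [Lp.eq_zero_iff_ae_eq_zero]
  filter_upwards [(ae_restrict_iff' isOpen_cube.measurableSet).2 hae,
    ae_restrict_mem isOpen_cube.measurableSet] with x hx hxc
  exact (mul_eq_zero.1 hx).resolve_right (hpos x hxc)

/-- The Hilbert basis of products of sines and cosines. -/
noncomputable def trigBasis (σ : Fin d → Bool) : HilbertBasis (Supp σ) ℝ (L2 d) :=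
  HilbertBasis.mkOfOrthogonalEqBot (orthonormal_trig σ) <| by
    rw [Submodule.eq_bot_iff]
    intro f hf
    refine eq_zero_of_coef_eq_zero σ f fun n => ?_
    by_cases hn : n ∈ Supp σ
    · exact (Submodule.mem_orthogonal _ _).1 hf _ (Submodule.subset_span ⟨⟨n, hn⟩, rfl⟩)
    · exact coef_eq_zero hn f

lemma inner_trigBasis (σ : Fin d → Bool) (n : Supp σ) (u : L2 d) :
    inner ℝ (trigBasis σ n) u = coef σ n.1 u := by
  rw [trigBasis, HilbertBasis.coe_mkOfOrthogonalEqBot]; rfl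

/-- Parseval's identity. -/
lemma hasSum_coef_mul_coef (σ : Fin d → Bool) (u v : L2 d) :
    HasSum (fun n => coef σ n u * coef σ n v) (inner ℝ u v) := by
  have h := (trigBasis σ).hasSum_inner_mul_inner u v
  refine (hasSum_subtype_iff_of_support_subset (s := Supp σ) ?_).1 ?_
  · intro n hn
    by_contra hc
    exact hn (by simp [coef_eq_zero hc])
  · refine h.congr_fun fun n => ?_
    rw [Function.comp_apply, inner_trigBasis, real_inner_comm, inner_trigBasis]

lemma hasSum_coef_sq (σ : Fin d → Bool) (u : L2 d) :
    HasSum (fun n => coef σ n u ^ 2) (‖u‖ ^ 2) := by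
  have := hasSum_coef_mul_coef σ u u
  rw [real_inner_self_eq_norm_sq] at this
  simpa only [sq] using this

lemma ext_coef (σ : Fin d → Bool) {u v : L2 d} (h : ∀ n, coef σ n u = coef σ n v) : u = v := by
  rw [← sub_eq_zero]
  exact eq_zero_of_coef_eq_zero σ _ fun n => by rw [coef_sub, h, sub_self]

/-- The theorem of Riesz and Fischer. -/
lemma exists_coef_eq (σ : Fin d → Bool) (c : (Fin d → ℕ) → ℝ) (hc : Summable fun n => c n ^ 2)
    (h0 : ∀ n, n ∉ Supp σ → c n = 0) : ∃ u : L2 d, ∀ n, coef σ n u = c n := by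
  have hm : Memℓp (fun n : Supp σ => c n.1) 2 := by
    refine memℓp_gen ?_
    have h2 : Summable fun n : Supp σ => c n.1 ^ 2 := hc.comp_injective Subtype.val_injective
    simpa using h2
  refine ⟨(trigBasis σ).repr.symm ⟨_, hm⟩, fun n => ?_⟩
  by_cases hn : n ∈ Supp σ
  · rw [← inner_trigBasis σ ⟨n, hn⟩, ← HilbertBasis.repr_apply_apply,
      LinearIsometryEquiv.apply_symm_apply]
  · rw [coef_eq_zero hn, h0 n hn]

/-- Multiplier operators between trigonometric systems. -/
lemma exists_multiplier (σ σ' : Fin d → Bool) (w : (Fin d → ℕ) → ℝ) (C : ℝ)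
    (hw : ∀ n ∈ Supp σ, |w n| ≤ C) (h : Supp σ ⊆ Supp σ') :
    ∃ A : L2 d →L[ℝ] L2 d, ∀ u n, coef σ' n (A u) = w n * coef σ n u := by
  have hsq : ∀ u n, (w n * coef σ n u) ^ 2 ≤ C ^ 2 * coef σ n u ^ 2 := by
    intro u n
    by_cases hn : n ∈ Supp σ
    · rw [mul_pow]
      refine mul_le_mul_of_nonneg_right ?_ (sq_nonneg _)
      rw [← sq_abs (w n)]
      exact pow_le_pow_left₀ (abs_nonneg _) (hw n hn) 2
    · simp [coef_eq_zero hn]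
  have hex : ∀ u, ∃ v : L2 d, ∀ n, coef σ' n v = w n * coef σ n u := fun u =>
    exists_coef_eq σ' _ (Summable.of_nonneg_of_le (fun _ => sq_nonneg _) (hsq u)
      ((hasSum_coef_sq σ u).summable.mul_left _))
      fun n hn => by rw [coef_eq_zero fun h' => hn (h h'), mul_zero]
  choose A hA using hex
  refine ⟨LinearMap.mkContinuous
    { toFun := A
      map_add' := fun u v => ext_coef σ' fun n => by rw [coef_add, hA, hA, hA, coef_add, mul_add]
      map_smul' := fun c u => ext_coef σ' fun n => by
        rw [RingHom.id_apply, coef_smul, hA, hA, coef_smul]; ring } |C| fun u => ?_, hA⟩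
  change ‖A u‖ ≤ _
  refine abs_le_of_sq_le_sq' ?_ (by positivity) |>.2
  rw [mul_pow, sq_abs]
  refine hasSum_le (fun n => ?_) (hasSum_coef_sq σ' (A u)) ((hasSum_coef_sq σ u).mul_left _)
  rw [hA]
  exact hsq u n

open Filter Topology

/-! ### Derivatives of product functions -/

lemma fprod_update (θ : Fin d → ℝ → ℝ) (i : Fin d) (χ : ℝ → ℝ) (x : Fin d → ℝ) :
    fprod (Function.update θ i χ) x = χ (x i) * ∏ j ∈ Finset.univ.erase i, θ j (x j) := by
  unfold fprod
  rw [← Finset.mul_prod_erase _ _ (Finset.mem_univ i), Function.update_self]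
  congr 1
  refine Finset.prod_congr rfl fun j hj => ?_
  rw [Function.update_of_ne (Finset.ne_of_mem_erase hj)]

lemma contDiff_update {θ : Fin d → ℝ → ℝ} (h : ∀ j, ContDiff ℝ ∞ (θ j)) (i : Fin d) {χ : ℝ → ℝ}
    (hχ : ContDiff ℝ ∞ χ) (j : Fin d) : ContDiff ℝ ∞ (Function.update θ i χ j) := by
  rcases eq_or_ne j i with rfl | hj
  · rwa [Function.update_self]
  · rw [Function.update_of_ne hj]; exact h j

lemma contDiff_deriv {χ : ℝ → ℝ} (h : ContDiff ℝ ∞ χ) : ContDiff ℝ ∞ (deriv χ) :=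
  (contDiff_infty_iff_deriv.1 h).2

lemma contDiff_iterate_deriv {χ : ℝ → ℝ} (h : ContDiff ℝ ∞ χ) (a : ℕ) :
    ContDiff ℝ ∞ (deriv^[a] χ) := by
  induction a with
  | zero => exact h
  | succ a ih => rw [Function.iterate_succ_apply']; exact contDiff_deriv ih

lemma pderiv_fprod {θ : Fin d → ℝ → ℝ} (h : ∀ j, ContDiff ℝ ∞ (θ j)) (i : Fin d) :
    pderiv i (fprod θ) = fprod (Function.update θ i (deriv (θ i))) := by
  funext x
  have hd : DifferentiableAt ℝ (fprod θ) x := (contDiff_fprod h).differentiable (by simp) x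
  rw [pderiv, ← hd.lineDeriv_eq_fderiv, fprod_update]
  have e : (fun t : ℝ => fprod θ (x + t • Pi.single i 1)) =
      fun t => θ i (x i + t) * ∏ j ∈ Finset.univ.erase i, θ j (x j) := by
    funext t
    have := fprod_update θ i (θ i) (x + t • Pi.single i 1)
    rw [Function.update_eq_self] at this
    rw [this]
    congr 1
    · simp
    · refine Finset.prod_congr rfl fun j hj => ?_
      simp [Finset.ne_of_mem_erase hj]
  rw [lineDeriv, e]
  have h1 : HasDerivAt (fun t : ℝ => θ i (x i + t)) (deriv (θ i) (x i)) 0 := by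
    have h2 : HasDerivAt (θ i) (deriv (θ i) (x i)) (x i + 0) := by
      rw [add_zero]
      exact ((h i).differentiable (by simp) (x i)).hasDerivAt
    simpa using h2.comp_const_add (x i) 0
  exact (h1.mul_const _).deriv

lemma pderiv_iterate_fprod {θ : Fin d → ℝ → ℝ} (h : ∀ j, ContDiff ℝ ∞ (θ j)) (i : Fin d) (a : ℕ) :
    (pderiv i)^[a] (fprod θ) = fprod (Function.update θ i (deriv^[a] (θ i))) := by
  induction a with
  | zero => simp
  | succ a ih =>
    rw [Function.iterate_succ_apply', ih,
      pderiv_fprod (contDiff_update h i (contDiff_iterate_deriv (h i) a))]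
    simp [Function.iterate_succ_apply' deriv]

lemma mderiv_fprod {θ : Fin d → ℝ → ℝ} (h : ∀ j, ContDiff ℝ ∞ (θ j)) (α : Fin d → ℕ) :
    mderiv α (fprod θ) = fprod fun j => deriv^[α j] (θ j) := by
  have key : ∀ l : List (Fin d), l.Nodup →
      l.foldr (fun i χ => (pderiv i)^[α i] χ) (fprod θ) =
        fprod fun j => if j ∈ l then deriv^[α j] (θ j) else θ j := by
    intro l
    induction l with
    | nil => intro _; simp
    | cons i l ih =>
      intro hl
      rw [List.nodup_cons] at hl
      rw [List.foldr_cons, ih hl.2, pderiv_iterate_fprod]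
      · congr 1
        funext j
        rcases eq_or_ne j i with rfl | hj
        · simp [hl.1]
        · simp [hj]
      · intro j
        split_ifs
        · exact contDiff_iterate_deriv (h j) _
        · exact h j
  rw [mderiv, key _ (List.nodup_finRange d)]
  simp

/-! ### Cutoff functions -/

/-- A smooth cutoff function, equal to one in `(0,1)` away from the boundary. -/
noncomputable def cutoff (m : ℕ) (x : ℝ) : ℝ :=
  Real.smoothTransition ((m + 1) * x - 1) * Real.smoothTransition ((m + 1) * (1 - x) - 1)

lemma contDiff_cutoff (m : ℕ) : ContDiff ℝ ∞ (cutoff m) := by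
  unfold cutoff
  exact (Real.smoothTransition.contDiff.comp (by fun_prop)).mul
    (Real.smoothTransition.contDiff.comp (by fun_prop))

lemma abs_cutoff_le (m : ℕ) (x : ℝ) : |cutoff m x| ≤ 1 := by
  unfold cutoff
  rw [abs_of_nonneg (mul_nonneg (Real.smoothTransition.nonneg _) (Real.smoothTransition.nonneg _))]
  exact mul_le_one₀ (Real.smoothTransition.le_one _) (Real.smoothTransition.nonneg _)
    (Real.smoothTransition.le_one _)

lemma tsupport_cutoff (m : ℕ) : tsupport (cutoff m) ⊆ Icc (1 / (m + 1 : ℝ)) (1 - 1 / (m + 1 : ℝ)) := by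
  refine closure_minimal ?_ isClosed_Icc
  intro x hx
  have hm : (0 : ℝ) < m + 1 := by positivity
  rw [Function.mem_support, cutoff, mul_ne_zero_iff] at hx
  have h1 : 0 < (m + 1 : ℝ) * x - 1 := by
    by_contra! h; exact hx.1 (Real.smoothTransition.zero_of_nonpos h)
  have h2 : 0 < (m + 1 : ℝ) * (1 - x) - 1 := by
    by_contra! h; exact hx.2 (Real.smoothTransition.zero_of_nonpos h)
  refine ⟨?_, ?_⟩
  · rw [div_le_iff₀ hm]; linarith
  · rw [le_sub_comm, div_le_iff₀ hm]; linarith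

lemma hasCompactSupport_cutoff_mul (m : ℕ) (χ : ℝ → ℝ) :
    HasCompactSupport (fun x => cutoff m x * χ x) ∧
      tsupport (fun x => cutoff m x * χ x) ⊆ Ioo 0 1 := by
  have h := (tsupport_mul_subset_left (f := cutoff m) (g := χ)).trans (tsupport_cutoff m)
  have hm : (0 : ℝ) < 1 / (m + 1 : ℝ) := by positivity
  exact ⟨isCompact_Icc.of_isClosed_subset (isClosed_tsupport _) h,
    h.trans fun x hx => ⟨hm.trans_le hx.1, hx.2.trans_lt (by linarith)⟩⟩

lemma eventually_cutoff_eq_one {x : ℝ} (hx : x ∈ Ioo (0 : ℝ) 1) :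
    ∀ᶠ m : ℕ in atTop, cutoff m =ᶠ[𝓝 x] fun _ => 1 := by
  have h1 : Tendsto (fun m : ℕ => ((m : ℝ) + 1) * x) atTop atTop :=
    Tendsto.atTop_mul_const hx.1 (tendsto_atTop_add_const_right _ _ tendsto_natCast_atTop_atTop)
  have h2 : Tendsto (fun m : ℕ => ((m : ℝ) + 1) * (1 - x)) atTop atTop :=
    Tendsto.atTop_mul_const (sub_pos.2 hx.2)
      (tendsto_atTop_add_const_right _ _ tendsto_natCast_atTop_atTop)
  filter_upwards [h1.eventually_gt_atTop 2, h2.eventually_gt_atTop 2] with m hm1 hm2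
  have c1 : ∀ᶠ y in 𝓝 x, 2 < ((m : ℝ) + 1) * y :=
    (continuousAt_const.mul continuousAt_id).eventually (lt_mem_nhds hm1)
  have c2 : ∀ᶠ y in 𝓝 x, 2 < ((m : ℝ) + 1) * (1 - y) :=
    (continuousAt_const.mul (continuousAt_const.sub continuousAt_id)).eventually (lt_mem_nhds hm2)
  filter_upwards [c1, c2] with y h1 h2
  rw [cutoff, Real.smoothTransition.one_of_one_le (by linarith),
    Real.smoothTransition.one_of_one_le (by linarith), mul_one]

lemma eventually_iterate_deriv_cutoff_mul (χ : ℝ → ℝ) (a : ℕ) {x : ℝ} (hx : x ∈ Ioo (0 : ℝ) 1) :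
    ∀ᶠ m : ℕ in atTop, deriv^[a] (fun y => cutoff m y * χ y) x = deriv^[a] χ x := by
  filter_upwards [eventually_cutoff_eq_one hx] with m hm
  have h0 : (fun y => cutoff m y * χ y) =ᶠ[𝓝 x] χ := by
    filter_upwards [hm] with y hy
    rw [hy, one_mul]
  have : ∀ a, deriv^[a] (fun y => cutoff m y * χ y) =ᶠ[𝓝 x] deriv^[a] χ := by
    intro a
    induction a with
    | zero => exact h0
    | succ a ih =>
      rw [Function.iterate_succ_apply', Function.iterate_succ_apply']
      exact ih.deriv
  exact (this a).self_of_nhds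

lemma exists_abs_deriv_smoothTransition_le :
    ∃ M, 0 ≤ M ∧ ∀ y, |deriv Real.smoothTransition y| ≤ M ∧
      (1 < y → deriv Real.smoothTransition y = 0) := by
  have hc : Continuous (deriv Real.smoothTransition) :=
    (contDiff_deriv Real.smoothTransition.contDiff).continuous
  obtain ⟨M, hM⟩ := (isCompact_Icc (a := (0 : ℝ)) (b := 1)).exists_bound_of_continuousOn
    hc.continuousOn
  have hM0 : 0 ≤ M := (norm_nonneg _).trans (hM 0 (by simp))
  have h1 : ∀ y, 1 < y → deriv Real.smoothTransition y = 0 := by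
    intro y hy
    have : Real.smoothTransition =ᶠ[𝓝 y] fun _ => 1 := by
      filter_upwards [lt_mem_nhds hy] with z hz
      exact Real.smoothTransition.one_of_one_le hz.le
    rw [this.deriv_eq, deriv_const]
  have h0 : ∀ y, y < 0 → deriv Real.smoothTransition y = 0 := by
    intro y hy
    have : Real.smoothTransition =ᶠ[𝓝 y] fun _ => 0 := by
      filter_upwards [gt_mem_nhds hy] with z hz
      exact Real.smoothTransition.zero_of_nonpos hz.le
    rw [this.deriv_eq, deriv_const]
  refine ⟨M, hM0, fun y => ⟨?_, h1 y⟩⟩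
  rcases lt_or_ge y 0 with hy | hy
  · rw [h0 y hy]; simpa
  rcases lt_or_ge 1 y with hy' | hy'
  · rw [h1 y hy']; simpa
  · exact hM y ⟨hy, hy'⟩

/-- The derivatives of `cutoff m * χ` are bounded uniformly in `m` if `χ` vanishes at `0` and `1`. -/
lemma exists_abs_deriv_cutoff_mul_le {χ : ℝ → ℝ} (h : ContDiff ℝ ∞ χ) (h0 : χ 0 = 0)
    (h1 : χ 1 = 0) :
    ∃ C, ∀ m : ℕ, ∀ x ∈ Ioo (0 : ℝ) 1, |deriv (fun y => cutoff m y * χ y) x| ≤ C := by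
  obtain ⟨M, hM0, hM⟩ := exists_abs_deriv_smoothTransition_le
  obtain ⟨B, hB⟩ := (isCompact_Icc (a := (0 : ℝ)) (b := 1)).exists_bound_of_continuousOn
    (contDiff_deriv h).continuous.continuousOn
  have hB0 : 0 ≤ B := (norm_nonneg _).trans (hB 0 (by simp))
  have hχ : Differentiable ℝ χ := h.differentiable (by simp)
  have hlip : ∀ x ∈ Icc (0 : ℝ) 1, ∀ y ∈ Icc (0 : ℝ) 1, |χ y - χ x| ≤ B * |y - x| := by
    intro x hx y hy
    exact (convex_Icc (0 : ℝ) 1).norm_image_sub_le_of_norm_deriv_le (fun z _ => hχ z) hB hx hy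
  refine ⟨2 * M * B + 2 * M * B + B, fun m x hx => ?_⟩
  have hx' : x ∈ Icc (0 : ℝ) 1 := Ioo_subset_Icc_self hx
  set r : ℝ := m + 1 with hr
  have hr0 : 0 < r := by positivity
  have hS := Real.smoothTransition.contDiff.differentiable (n := ∞) (by simp)
  have d1 : HasDerivAt (fun y => Real.smoothTransition (r * y - 1))
      (deriv Real.smoothTransition (r * x - 1) * r) x := by
    have hin : HasDerivAt (fun y => r * y - 1) r x := by
      simpa using ((hasDerivAt_id x).const_mul r).sub_const 1
    exact (hS (r * x - 1)).hasDerivAt.comp x hin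
  have d2 : HasDerivAt (fun y => Real.smoothTransition (r * (1 - y) - 1))
      (deriv Real.smoothTransition (r * (1 - x) - 1) * (-r)) x := by
    have hin : HasDerivAt (fun y => r * (1 - y) - 1) (-r) x := by
      simpa using (((hasDerivAt_id x).const_sub 1).const_mul r).sub_const 1
    exact (hS (r * (1 - x) - 1)).hasDerivAt.comp x hin
  have d3 := (d1.mul d2).mul (hχ x).hasDerivAt
  have e : deriv (fun y => cutoff m y * χ y) x = _ := d3.deriv
  rw [e]
  -- Where the derivative of the cutoff does not vanish, `r x ≤ 2`; the factor `r` is then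
  -- compensated by `|χ x| ≤ B x`. The other end of the interval is symmetric.
  have b1 : |deriv Real.smoothTransition (r * x - 1) * r * χ x| ≤ 2 * M * B := by
    have hχx : |χ x| ≤ B * x := by
      have := hlip 0 (by simp) x hx'
      rwa [h0, sub_zero, sub_zero, abs_of_pos hx.1] at this
    rcases lt_or_ge 1 (r * x - 1) with hy | hy
    · rw [(hM _).2 hy]; simp; positivity
    · rw [abs_mul, abs_mul, abs_of_pos hr0]
      calc |deriv Real.smoothTransition (r * x - 1)| * r * |χ x| ≤ M * r * (B * x) := by
            gcongr; exact (hM _).1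
        _ = M * B * (r * x) := by ring
        _ ≤ M * B * 2 := by gcongr; linarith
        _ = _ := by ring
  have b2 : |deriv Real.smoothTransition (r * (1 - x) - 1) * (-r) * χ x| ≤ 2 * M * B := by
    have hχx : |χ x| ≤ B * (1 - x) := by
      have := hlip x hx' 1 (by simp)
      rwa [h1, zero_sub, abs_neg, abs_of_pos (sub_pos.2 hx.2)] at this
    rcases lt_or_ge 1 (r * (1 - x) - 1) with hy | hy
    · rw [(hM _).2 hy]; simp; positivity
    · rw [abs_mul, abs_mul, abs_neg, abs_of_pos hr0]
      calc |deriv Real.smoothTransition (r * (1 - x) - 1)| * r * |χ x| ≤ M * r * (B * (1 - x)) := by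
            gcongr; exact (hM _).1
        _ = M * B * (r * (1 - x)) := by ring
        _ ≤ M * B * 2 := by gcongr; linarith
        _ = _ := by ring
  have b3 : |deriv χ x| ≤ B := hB x hx'
  have s1 : ∀ y, |Real.smoothTransition y| ≤ 1 := fun y => by
    rw [abs_of_nonneg (Real.smoothTransition.nonneg _)]; exact Real.smoothTransition.le_one _
  have hsplit : ∀ a b c e f g : ℝ, |a * c| ≤ 2 * M * B → |e * c| ≤ 2 * M * B → |b| ≤ 1 → |f| ≤ 1 →
      |g| ≤ B → |(a * b + f * e) * c + f * b * g| ≤ 2 * M * B + 2 * M * B + B := by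
    intro a b c e f g ha he hb hf hg
    have t1 : |a * c * b| ≤ 2 * M * B := by
      rw [abs_mul]; exact (mul_le_of_le_one_right (abs_nonneg _) hb).trans ha
    have t2 : |e * c * f| ≤ 2 * M * B := by
      rw [abs_mul]; exact (mul_le_of_le_one_right (abs_nonneg _) hf).trans he
    have t3 : |f * b * g| ≤ B := by
      rw [abs_mul, abs_mul]
      exact (mul_le_of_le_one_left (abs_nonneg _)
        (mul_le_one₀ hf (abs_nonneg _) hb)).trans hg
    have : (a * b + f * e) * c + f * b * g = a * c * b + e * c * f + f * b * g := by ring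
    rw [this]
    exact (abs_add_three _ _ _).trans (by linarith)
  exact hsplit _ _ _ _ _ _ b1 b2 (s1 _) (s1 _) b3

/-! ### Extension of weak identities to products of sines and cosines -/

/-- Green's formula without boundary term holds for all smooth functions. -/
lemma HasWDZeroTrace.integral_eq {i : Fin d} {u g : L2 d} (h : HasWDZeroTrace i u g)
    {ψ : (Fin d → ℝ) → ℝ} (hψ : ContDiff ℝ ∞ ψ) :
    ∫ x in cube d, u x * pderiv i ψ x = - ∫ x in cube d, g x * ψ x := by
  -- In the supremum norm the cube lies in the ball of radius `2`, where the bump equals one.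
  -- Compact support of `ψ` is therefore no restriction.
  let b : ContDiffBump (0 : Fin d → ℝ) := ⟨2, 3, by norm_num, by norm_num⟩
  have hb : ∀ x ∈ cube d, (fun y => b y * ψ y) =ᶠ[𝓝 x] ψ := by
    intro x hx
    have hx' : x ∈ Metric.ball (0 : Fin d → ℝ) 2 := by
      rw [mem_ball_zero_iff]
      refine lt_of_le_of_lt ((pi_norm_le_iff_of_nonneg zero_le_one).2 fun j => ?_) one_lt_two
      have := hx j trivial
      rw [Real.norm_of_nonneg this.1.le]
      exact this.2.le
    filter_upwards [Metric.isOpen_ball.mem_nhds hx'] with y hy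
    rw [b.one_of_mem_closedBall (Metric.ball_subset_closedBall hy), one_mul]
  have h1 := h (fun y => b y * ψ y) (b.contDiff.mul hψ) b.hasCompactSupport.mul_right
  rw [setIntegral_congr_fun (g := fun x => u x * pderiv i ψ x) isOpen_cube.measurableSet,
    setIntegral_congr_fun (f := fun x => g x * (b x * ψ x)) (g := fun x => g x * ψ x)
      isOpen_cube.measurableSet] at h1
  · exact h1
  · intro x hx
    have := (hb x hx).self_of_nhds
    simp only at this ⊢
    rw [this]
  · intro x hx
    simp only [pderiv]
    rw [(hb x hx).fderiv_eq]

lemma tendsto_integral_fprod (u : L2 d) {θ : Fin d → ℝ → ℝ} (hθ : ∀ j, Continuous (θ j)) (i : Fin d)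
    {ρ : ℕ → ℝ → ℝ} {ρ₀ : ℝ → ℝ} (hρ : ∀ m, Continuous (ρ m)) (C : ℝ)
    (hC : ∀ m, ∀ x ∈ Ioo (0 : ℝ) 1, |ρ m x| ≤ C)
    (hlim : ∀ x ∈ Ioo (0 : ℝ) 1, Tendsto (fun m => ρ m x) atTop (𝓝 (ρ₀ x))) :
    Tendsto (fun m => ∫ x in cube d, u x * fprod (Function.update θ i (ρ m)) x) atTop
      (𝓝 (∫ x in cube d, u x * fprod (Function.update θ i ρ₀) x)) := by
  simp only [fprod_update]
  set Θ : (Fin d → ℝ) → ℝ := fun x => ∏ j ∈ Finset.univ.erase i, θ j (x j)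
  have hΘ : Continuous Θ := continuous_finsetProd _ fun j _ => (hθ j).comp (continuous_apply j)
  refine tendsto_integral_of_dominated_convergence (fun x => C * |u x * Θ x|) (fun m => ?_)
    ((integrable_mul_continuous u hΘ).abs.const_mul C) (fun m => ?_) ?_
  · exact (integrable_mul_continuous u
      (((hρ m).comp (continuous_apply i)).mul hΘ)).aestronglyMeasurable
  · filter_upwards [ae_restrict_mem isOpen_cube.measurableSet] with x hx
    have := hC m (x i) (hx i trivial)
    rw [Real.norm_eq_abs, show u x * (ρ m (x i) * Θ x) = ρ m (x i) * (u x * Θ x) by ring, abs_mul]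
    exact mul_le_mul_of_nonneg_right this (abs_nonneg _)
  · filter_upwards [ae_restrict_mem isOpen_cube.measurableSet] with x hx
    exact ((hlim (x i) (hx i trivial)).mul_const _).const_mul _

/-- The functions of one variable that may be used in place of test functions in direction `i`,
if `u` is differentiated `a` times. -/
def Adm (u : L2 d) (i : Fin d) (a : ℕ) (χ : ℝ → ℝ) : Prop :=
  a = 0 ∨ (a = 1 ∧ ((χ 0 = 0 ∧ χ 1 = 0) ∨ ∃ g, HasWDZeroTrace i u g)) ∨
    (a = 2 ∧ (χ 0 = 0 ∧ χ 1 = 0) ∧ ∃ g, HasWDZeroTrace i u g)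

lemma Adm.cutoff_mul {u : L2 d} {i : Fin d} {a : ℕ} {χ : ℝ → ℝ} (h : Adm u i a χ) (m : ℕ) :
    Adm u i a (fun x => cutoff m x * χ x) := by
  have hv : χ 0 = 0 ∧ χ 1 = 0 → cutoff m 0 * χ 0 = 0 ∧ cutoff m 1 * χ 1 = 0 :=
    fun h => by simp [h.1, h.2]
  rcases h with h | ⟨h, h' | h'⟩ | ⟨h, h', h''⟩
  · exact Or.inl h
  · exact Or.inr (Or.inl ⟨h, Or.inl (hv h')⟩)
  · exact Or.inr (Or.inl ⟨h, Or.inr h'⟩)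
  · exact Or.inr (Or.inr ⟨h, hv h', h''⟩)

lemma HasWDZeroTrace.integral_fprod {i : Fin d} {u g : L2 d} (h : HasWDZeroTrace i u g)
    {θ : Fin d → ℝ → ℝ} (hθ : ∀ j, ContDiff ℝ ∞ (θ j)) {χ : ℝ → ℝ} (hχ : ContDiff ℝ ∞ χ) :
    ∫ x in cube d, u x * fprod (Function.update θ i (deriv χ)) x =
      - ∫ x in cube d, g x * fprod (Function.update θ i χ) x := by
  rw [← h.integral_eq (contDiff_fprod (contDiff_update hθ i hχ)),
    pderiv_fprod (contDiff_update hθ i hχ)]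
  simp

lemma Adm.tendsto {u : L2 d} {i : Fin d} {a : ℕ} {χ : ℝ → ℝ} (h : Adm u i a χ)
    (hχ : ContDiff ℝ ∞ χ) {θ : Fin d → ℝ → ℝ} (hθ : ∀ j, ContDiff ℝ ∞ (θ j)) :
    Tendsto (fun m => ∫ x in cube d,
        u x * fprod (Function.update θ i (deriv^[a] fun y => cutoff m y * χ y)) x) atTop
      (𝓝 (∫ x in cube d, u x * fprod (Function.update θ i (deriv^[a] χ)) x)) := by
  have hcm : ∀ m, ContDiff ℝ ∞ (fun y => cutoff m y * χ y) := fun m => (contDiff_cutoff m).mul hχ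
  have hθc : ∀ j, Continuous (θ j) := fun j => (hθ j).continuous
  have zero : ∀ v : L2 d, Tendsto (fun m => ∫ x in cube d,
        v x * fprod (Function.update θ i (fun y => cutoff m y * χ y)) x) atTop
      (𝓝 (∫ x in cube d, v x * fprod (Function.update θ i χ) x)) := by
    intro v
    obtain ⟨C, hC⟩ := (isCompact_Icc (a := (0 : ℝ)) (b := 1)).exists_bound_of_continuousOn
      hχ.continuous.continuousOn
    refine tendsto_integral_fprod v hθc i (fun m => (hcm m).continuous) C (fun m x hx => ?_)
      fun x hx => ?_
    · rw [abs_mul]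
      exact (mul_le_of_le_one_left (abs_nonneg _) (abs_cutoff_le m x)).trans
        (hC x (Ioo_subset_Icc_self hx))
    · exact tendsto_const_nhds.congr' <|
        (eventually_iterate_deriv_cutoff_mul χ 0 hx).mono fun m hm => hm.symm
  have one : (χ 0 = 0 ∧ χ 1 = 0) → ∀ v : L2 d, Tendsto (fun m => ∫ x in cube d,
        v x * fprod (Function.update θ i (deriv fun y => cutoff m y * χ y)) x) atTop
      (𝓝 (∫ x in cube d, v x * fprod (Function.update θ i (deriv χ)) x)) := by
    intro hv v
    obtain ⟨C, hC⟩ := exists_abs_deriv_cutoff_mul_le hχ hv.1 hv.2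
    refine tendsto_integral_fprod v hθc i (fun m => (contDiff_deriv (hcm m)).continuous) C hC
      fun x hx => ?_
    exact tendsto_const_nhds.congr' <|
      (eventually_iterate_deriv_cutoff_mul χ 1 hx).mono fun m hm => hm.symm
  -- The derivative of the cutoff is harmless only in front of a function vanishing at the ends.
  -- Otherwise Green's formula first moves one derivative onto `u`; at order two this reduces to the
  -- case of order one.
  rcases h with rfl | ⟨rfl, h' | ⟨g, hg⟩⟩ | ⟨rfl, h', g, hg⟩
  · exact zero u
  · exact one h' u
  · simp only [Function.iterate_one]
    simp only [hg.integral_fprod hθ (hcm _), hg.integral_fprod hθ hχ]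
    exact (zero g).neg
  · have e : ∀ f : ℝ → ℝ, deriv^[2] f = deriv (deriv f) := fun f => rfl
    simp only [e, hg.integral_fprod hθ (contDiff_deriv (hcm _)),
      hg.integral_fprod hθ (contDiff_deriv hχ)]
    exact (one h' g).neg

lemma isTest_fprod {θ : Fin d → ℝ → ℝ} (hθ : ∀ j, ContDiff ℝ ∞ (θ j))
    (h : ∀ j, HasCompactSupport (θ j) ∧ tsupport (θ j) ⊆ Ioo 0 1) : IsTest (fprod θ) := by
  have hs : tsupport (fprod θ) ⊆ univ.pi fun j => tsupport (θ j) := by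
    refine closure_minimal (fun x hx j _ => ?_) (isClosed_set_pi fun j _ => isClosed_tsupport _)
    refine subset_tsupport _ fun h0 => hx ?_
    exact Finset.prod_eq_zero (Finset.mem_univ j) h0
  refine ⟨contDiff_fprod hθ, ?_, hs.trans fun x hx j _ => (h j).2 (hx j trivial)⟩
  exact (isCompact_univ_pi fun j => (h j).1).of_isClosed_subset (isClosed_tsupport _) hs

/-- A weak identity extends from test functions to products of admissible functions. -/
theorem weak_identity {ι : Type*} (s : Finset ι) (c : ι → ℝ) (α : ι → Fin d → ℕ) (u g : L2 d)
    (h : ∀ ψ : (Fin d → ℝ) → ℝ, IsTest ψ →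
      ∑ t ∈ s, c t * ∫ x in cube d, u x * mderiv (α t) ψ x = ∫ x in cube d, g x * ψ x)
    (θ : Fin d → ℝ → ℝ) (hθ : ∀ j, ContDiff ℝ ∞ (θ j))
    (hadm : ∀ t ∈ s, ∀ j, Adm u j (α t j) (θ j)) :
    ∑ t ∈ s, c t * ∫ x in cube d, u x * fprod (fun j => deriv^[α t j] (θ j)) x =
      ∫ x in cube d, g x * fprod θ x := by
  classical
  -- `S` collects the directions in which the factor need not have compact support. Each induction
  -- step removes one direction by a cutoff and passes to the limit.
  suffices H : ∀ (S : Finset (Fin d)) (θ : Fin d → ℝ → ℝ), (∀ j, ContDiff ℝ ∞ (θ j)) →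
      (∀ t ∈ s, ∀ j, Adm u j (α t j) (θ j)) →
      (∀ j, j ∉ S → HasCompactSupport (θ j) ∧ tsupport (θ j) ⊆ Ioo 0 1) →
      ∑ t ∈ s, c t * ∫ x in cube d, u x * fprod (fun j => deriv^[α t j] (θ j)) x =
        ∫ x in cube d, g x * fprod θ x from
    H Finset.univ θ hθ hadm fun j hj => absurd (Finset.mem_univ j) hj
  intro S
  induction S using Finset.induction_on with
  | empty =>
    intro θ hθ _ hsupp
    rw [← h _ (isTest_fprod hθ fun j => hsupp j (Finset.notMem_empty j))]
    simp only [mderiv_fprod hθ]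
  | insert i S _ ih =>
    intro θ hθ hadm hsupp
    set θm : ℕ → Fin d → ℝ → ℝ := fun m => Function.update θ i fun y => cutoff m y * θ i y with hθm
    have hm : ∀ m, ∑ t ∈ s, c t * ∫ x in cube d, u x * fprod (fun j => deriv^[α t j] (θm m j)) x =
        ∫ x in cube d, g x * fprod (θm m) x := by
      intro m
      refine ih (θm m) (contDiff_update hθ i ((contDiff_cutoff m).mul (hθ i))) ?_ ?_
      · intro t ht j
        rcases eq_or_ne j i with rfl | hj
        · simp only [hθm, Function.update_self]; exact (hadm t ht j).cutoff_mul m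
        · simp only [hθm, Function.update_of_ne hj]; exact hadm t ht j
      · intro j hj
        rcases eq_or_ne j i with rfl | hji
        · simp only [hθm, Function.update_self]; exact hasCompactSupport_cutoff_mul m _
        · simp only [hθm, Function.update_of_ne hji]; exact hsupp j (by simp [hji, hj])
    have hupd : ∀ (m : ℕ) (β : Fin d → ℕ), (fun j => deriv^[β j] (θm m j)) =
        Function.update (fun j => deriv^[β j] (θ j)) i
          (deriv^[β i] fun y => cutoff m y * θ i y) := by
      intro m β
      funext j
      rcases eq_or_ne j i with rfl | hj
      · simp [hθm]
      · simp [hθm, Function.update_of_ne hj]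
    have hself : ∀ β : Fin d → ℕ, (fun j => deriv^[β j] (θ j)) =
        Function.update (fun j => deriv^[β j] (θ j)) i (deriv^[β i] (θ i)) := fun β => by simp
    have l1 : Tendsto (fun m => ∑ t ∈ s, c t * ∫ x in cube d,
        u x * fprod (fun j => deriv^[α t j] (θm m j)) x) atTop
        (𝓝 (∑ t ∈ s, c t * ∫ x in cube d, u x * fprod (fun j => deriv^[α t j] (θ j)) x)) := by
      refine tendsto_finsetSum _ fun t ht => Tendsto.const_mul _ ?_
      rw [hself (α t)]
      simp only [hupd _ (α t)]
      exact (hadm t ht i).tendsto (hθ i) fun j => contDiff_iterate_deriv (hθ j) _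
    have l2 : Tendsto (fun m => ∫ x in cube d, g x * fprod (θm m) x) atTop
        (𝓝 (∫ x in cube d, g x * fprod θ x)) := by
      have := (show Adm g i 0 (θ i) from Or.inl rfl).tendsto (hθ i) hθ
      simpa using this
    simp only [hm] at l1
    exact tendsto_nhds_unique l1 l2

/-! ### Coefficients of weak derivatives -/

lemma iterate_deriv_tr_add_two (b : Bool) (k : ℕ) :
    deriv^[2] (tr b k) = fun x => -((k * Real.pi) ^ 2) * tr b k x := by
  have e : deriv^[2] (tr b k) = deriv (deriv (tr b k)) := rfl
  rw [e]
  cases b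
  · rw [deriv_tr_false]
    funext x
    rw [deriv_const_mul _ ((contDiff_tr true k).differentiable (by simp) x), deriv_tr_true]
    ring
  · rw [deriv_tr_true]
    funext x
    rw [deriv_const_mul _ ((contDiff_tr false k).differentiable (by simp) x), deriv_tr_false]
    ring

/-- The factor produced by differentiating `tr b k` at most twice. -/
noncomputable def trFactor (b : Bool) (a k : ℕ) : ℝ :=
  if a = 0 then 1 else if a = 1 then (if b then k * Real.pi else -(k * Real.pi))
  else -((k * Real.pi) ^ 2)

/-- The type of the derivative of `tr b k` of order `a`. -/
def trType (b : Bool) (a : ℕ) : Bool := if a = 1 then !b else b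

lemma iterate_deriv_tr (b : Bool) {a : ℕ} (ha : a ≤ 2) (k : ℕ) :
    deriv^[a] (tr b k) = fun x => trFactor b a k * tr (trType b a) k x := by
  interval_cases a
  · funext x; simp [trFactor, trType]
  · simp only [Function.iterate_one]
    cases b
    · rw [deriv_tr_false]; simp [trFactor, trType]
    · rw [deriv_tr_true]; simp [trFactor, trType]
  · rw [iterate_deriv_tr_add_two]; simp [trFactor, trType]

lemma integral_mul_fprod_iterate_deriv (u : L2 d) (σ : Fin d → Bool) (n α : Fin d → ℕ)
    (hα : ∀ j, α j ≤ 2) :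
    ∫ x in cube d, u x * fprod (fun j => deriv^[α j] (tr (σ j) (n j))) x =
      (∏ j, trFactor (σ j) (α j) (n j)) * coef (fun j => trType (σ j) (α j)) n u := by
  rw [coef_eq_integral, ← integral_const_mul]
  refine integral_congr_ae (ae_of_all _ fun x => ?_)
  simp only [fprod, trig, iterate_deriv_tr _ (hα _), Finset.prod_mul_distrib]
  ring

lemma Adm.zero {u : L2 d} {i : Fin d} {χ : ℝ → ℝ} : Adm u i 0 χ := Or.inl rfl

lemma Adm.sin_one {u : L2 d} {i : Fin d} {k : ℕ} : Adm u i 1 (tr true k) :=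
  Or.inr (Or.inl ⟨rfl, Or.inl (tr_true_boundary k)⟩)

lemma Adm.trace_one {u : L2 d} {i : Fin d} {χ : ℝ → ℝ} (h : ∃ g, HasWDZeroTrace i u g) :
    Adm u i 1 χ := Or.inr (Or.inl ⟨rfl, Or.inr h⟩)

lemma Adm.trace_two {u : L2 d} {i : Fin d} {k : ℕ} (h : ∃ g, HasWDZeroTrace i u g) :
    Adm u i 2 (tr true k) := Or.inr (Or.inr ⟨rfl, tr_true_boundary k, h⟩)

lemma Adm.le_two {u : L2 d} {i : Fin d} {a : ℕ} {χ : ℝ → ℝ} (h : Adm u i a χ) : a ≤ 2 := by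
  rcases h with h | h | h <;> omega

/-- The coefficients of a combination of weak derivatives. -/
lemma coef_of_weak {ι : Type*} (s : Finset ι) (c : ι → ℝ) (α : ι → Fin d → ℕ) (u g : L2 d)
    (h : ∀ ψ : (Fin d → ℝ) → ℝ, IsTest ψ →
      ∑ t ∈ s, c t * ∫ x in cube d, u x * mderiv (α t) ψ x = ∫ x in cube d, g x * ψ x)
    (σ : Fin d → Bool) (n : Fin d → ℕ) (hadm : ∀ t ∈ s, ∀ j, Adm u j (α t j) (tr (σ j) (n j))) :
    coef σ n g = ∑ t ∈ s, c t * ((∏ j, trFactor (σ j) (α t j) (n j)) *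
      coef (fun j => trType (σ j) (α t j)) n u) := by
  rw [coef_eq_integral, trig, ← weak_identity s c α u g h _ (fun j => contDiff_tr _ _) hadm]
  refine Finset.sum_congr rfl fun t ht => ?_
  rw [integral_mul_fprod_iterate_deriv u σ n (α t) fun j => (hadm t ht j).le_two]

lemma HasWD.coef_eq {α : Fin d → ℕ} {u g : L2 d} (h : HasWD α u g) (σ : Fin d → Bool)
    (n : Fin d → ℕ) (hadm : ∀ j, Adm u j (α j) (tr (σ j) (n j))) :
    coef σ n g = (-1) ^ (∑ j, α j) * ((∏ j, trFactor (σ j) (α j) (n j)) *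
      coef (fun j => trType (σ j) (α j)) n u) := by
  have := coef_of_weak {()} (fun _ => (-1) ^ (∑ j, α j)) (fun _ => α) u g (fun ψ hψ => by
    rw [Finset.sum_singleton, h ψ hψ, ← mul_assoc, ← mul_pow]; simp) σ n fun _ _ => hadm
  simpa using this

/-- The type of the products of sines. -/
def sinT : Fin d → Bool := fun _ => true

/-- The type of the products of cosines. -/
def cosT : Fin d → Bool := fun _ => false

lemma mderiv_unitIdx (i : Fin d) (ψ : (Fin d → ℝ) → ℝ) : mderiv (unitIdx i) ψ = pderiv i ψ := by
  have key : ∀ l : List (Fin d), l.Nodup →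
      l.foldr (fun j χ => (pderiv j)^[unitIdx i j] χ) ψ = if i ∈ l then pderiv i ψ else ψ := by
    intro l
    induction l with
    | nil => simp
    | cons j l ih =>
      intro hl
      rw [List.nodup_cons] at hl
      rw [List.foldr_cons, ih hl.2]
      rcases eq_or_ne i j with rfl | hij
      · simp [hl.1, unitIdx]
      · simp [hij, unitIdx]
  rw [mderiv, key _ (List.nodup_finRange d), if_pos (List.mem_finRange i)]

lemma prod_trFactor_unitIdx (σ : Fin d → Bool) (n : Fin d → ℕ) (i : Fin d) :
    ∏ j, trFactor (σ j) (unitIdx i j) (n j) = trFactor (σ i) 1 (n i) := by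
  rw [Finset.prod_eq_single i]
  · simp [unitIdx]
  · intro j _ hj
    simp [unitIdx, Pi.single_eq_of_ne hj, trFactor]
  · simp

lemma trType_unitIdx (σ : Fin d → Bool) (i : Fin d) :
    (fun j => trType (σ j) (unitIdx i j)) = Function.update σ i (!σ i) := by
  funext j
  rcases eq_or_ne j i with rfl | hj
  · simp [unitIdx, trType]
  · simp [unitIdx, trType, hj]

lemma sum_unitIdx (i : Fin d) : ∑ j, unitIdx i j = 1 := by
  simp [unitIdx]

lemma HasWD.coef_unitIdx {i : Fin d} {u g : L2 d} (h : HasWD (unitIdx i) u g) {σ : Fin d → Bool}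
    (hσ : σ i = true) (n : Fin d → ℕ) :
    coef σ n g = -(n i * Real.pi) * coef (Function.update σ i false) n u := by
  rw [h.coef_eq σ n fun j => ?_, prod_trFactor_unitIdx, trType_unitIdx, sum_unitIdx, hσ]
  · simp [trFactor]
  · rcases eq_or_ne j i with rfl | hj
    · simp only [unitIdx, Pi.single_eq_same, hσ]; exact Adm.sin_one
    · simp only [unitIdx, Pi.single_eq_of_ne hj]; exact Adm.zero

lemma HasWDZeroTrace.coef_eq {i : Fin d} {u g : L2 d} (h : HasWDZeroTrace i u g)
    {σ : Fin d → Bool} (hσ : σ i = false) (n : Fin d → ℕ) :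
    coef σ n g = n i * Real.pi * coef (Function.update σ i true) n u := by
  have h1 := h.integral_eq (contDiff_trig σ n)
  rw [← coef_eq_integral] at h1
  have h2 : ∫ x in cube d, u x * pderiv i (trig σ n) x =
      -(n i * Real.pi) * coef (Function.update σ i true) n u := by
    rw [trig, ← mderiv_unitIdx, mderiv_fprod fun j => contDiff_tr _ _,
      integral_mul_fprod_iterate_deriv u σ n (unitIdx i), prod_trFactor_unitIdx, trType_unitIdx, hσ]
    · simp [trFactor]
    · intro j
      rcases eq_or_ne j i with rfl | hj
      · simp [unitIdx]
      · simp [unitIdx, Pi.single_eq_of_ne hj]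
  linarith

lemma Dirichlet1D.coef_eq {i : Fin d} {u h : L2 d} (H : Dirichlet1D i u h) {σ : Fin d → Bool}
    (hσ : σ i = true) (n : Fin d → ℕ) : coef σ n h = -((n i * Real.pi) ^ 2) * coef σ n u := by
  obtain ⟨g, h1, h2⟩ := H
  rw [h2.coef_unitIdx hσ, h1.coef_eq (by simp)]
  have : Function.update σ i true = σ := by rw [← hσ]; simp
  rw [Function.update_idem, this]
  ring

lemma Neumann1D.coef_eq {i : Fin d} {q h : L2 d} (H : Neumann1D i q h) {σ : Fin d → Bool}
    (hσ : σ i = false) (n : Fin d → ℕ) : coef σ n h = -((n i * Real.pi) ^ 2) * coef σ n q := by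
  obtain ⟨g, h1, h2⟩ := H
  rw [h2.coef_eq hσ, h1.coef_unitIdx (by simp)]
  have : Function.update σ i false = σ := by rw [← hσ]; simp
  rw [Function.update_idem, this]
  ring

lemma eq_zero_of_integral_test {g : L2 d}
    (h : ∀ ψ : (Fin d → ℝ) → ℝ, IsTest ψ → ∫ x in cube d, g x * ψ x = 0) : g = 0 :=
  eq_zero_of_coef_eq_zero sinT g fun n => by
    -- With an empty sum on the left, the extension of weak identities says that orthogonality to
    -- test functions implies orthogonality to all sines.
    rw [coef_of_weak (∅ : Finset Unit) (fun _ => 0) (fun _ => 0) 0 g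
      (fun ψ hψ => by rw [h ψ hψ]; simp) sinT n (by simp)]
    simp

lemma integral_sub_mul (f g : L2 d) {ψ : (Fin d → ℝ) → ℝ} (h : Continuous ψ) :
    ∫ x in cube d, (f - g : L2 d) x * ψ x =
      (∫ x in cube d, f x * ψ x) - ∫ x in cube d, g x * ψ x := by
  rw [← inner_toL2 h, ← inner_toL2 h, ← inner_toL2 h, inner_sub_right]

lemma contDiff_pderiv {i : Fin d} {ψ : (Fin d → ℝ) → ℝ} (h : ContDiff ℝ ∞ ψ) :
    ContDiff ℝ ∞ (pderiv i ψ) := by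
  unfold pderiv
  exact (h.fderiv_right (m := ∞) (by simp)).clm_apply contDiff_const

lemma contDiff_mderiv {ψ : (Fin d → ℝ) → ℝ} (h : ContDiff ℝ ∞ ψ) (α : Fin d → ℕ) :
    ContDiff ℝ ∞ (mderiv α ψ) := by
  unfold mderiv
  induction List.finRange d with
  | nil => exact h
  | cons i l ih =>
    rw [List.foldr_cons]
    generalize α i = a
    induction a with
    | zero => exact ih
    | succ a iha => rw [Function.iterate_succ_apply']; exact contDiff_pderiv iha

lemma HasWD.unique {α : Fin d → ℕ} {u g g' : L2 d} (h : HasWD α u g) (h' : HasWD α u g') :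
    g = g' := by
  rw [← sub_eq_zero]
  refine eq_zero_of_integral_test fun ψ hψ => ?_
  rw [integral_sub_mul _ _ hψ.1.continuous]
  have := (h ψ hψ).symm.trans (h' ψ hψ)
  have h0 : ((-1 : ℝ)) ^ (∑ i, α i) ≠ 0 := pow_ne_zero _ (by norm_num)
  rw [mul_left_cancel₀ h0 this, sub_self]

lemma HasWD.wd_eq {α : Fin d → ℕ} {u g : L2 d} (h : HasWD α u g) : wd α u = g := by
  have hw : WDiff α u := ⟨g, h⟩
  rw [wd, dif_pos hw]
  exact hw.choose_spec.unique h

lemma HasWD.sub {α : Fin d → ℕ} {u v g k : L2 d} (h : HasWD α u g) (h' : HasWD α v k) :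
    HasWD α (u - v) (g - k) := by
  intro ψ hψ
  rw [integral_sub_mul _ _ hψ.1.continuous, integral_sub_mul _ _ (contDiff_mderiv hψ.1 α).continuous,
    h ψ hψ, h' ψ hψ]
  ring

/-! ### Green's formula for test functions -/

lemma integral_test_mul_pderiv {ψ χ : (Fin d → ℝ) → ℝ} (hψ : IsTest ψ) (hχ : ContDiff ℝ ∞ χ)
    (i : Fin d) :
    ∫ x in cube d, ψ x * pderiv i χ x = - ∫ x in cube d, pderiv i ψ x * χ x := by
  have hz : ∀ x, x ∉ cube d → x ∉ tsupport ψ := fun x hx h => hx (hψ.2.2 h)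
  rw [setIntegral_eq_integral_of_forall_compl_eq_zero,
    setIntegral_eq_integral_of_forall_compl_eq_zero]
  · have hcs : HasCompactSupport (pderiv i ψ) := hψ.2.1.fderiv_apply (𝕜 := ℝ) _
    have hψc := hψ.1.continuous
    have hχc := hχ.continuous
    have hψd := (contDiff_pderiv (i := i) hψ.1).continuous
    have hχd := (contDiff_pderiv (i := i) hχ).continuous
    exact integral_mul_fderiv_eq_neg_fderiv_mul_of_integrable
      ((hψd.mul hχc).integrable_of_hasCompactSupport hcs.mul_right)
      ((hψc.mul hχd).integrable_of_hasCompactSupport hψ.2.1.mul_right)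
      ((hψc.mul hχc).integrable_of_hasCompactSupport hψ.2.1.mul_right)
      (fun x _ => hψ.1.differentiable (by simp) x) (fun x _ => hχ.differentiable (by simp) x)
  · intro x hx
    have : fderiv ℝ ψ x = 0 := by
      by_contra h
      exact hz x hx (tsupport_fderiv_subset ℝ (subset_tsupport _ h))
    simp [pderiv, this]
  · intro x hx
    rw [image_eq_zero_of_notMem_tsupport (hz x hx), zero_mul]

lemma integral_toL2_mul {ψ : (Fin d → ℝ) → ℝ} (h : Continuous ψ) (χ : (Fin d → ℝ) → ℝ) :
    ∫ x in cube d, toL2 ψ h x * χ x = ∫ x in cube d, ψ x * χ x := by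
  refine integral_congr_ae ?_
  filter_upwards [coeFn_toL2 h] with x hx
  rw [hx]

lemma IsTest.hasWDZeroTrace {ψ : (Fin d → ℝ) → ℝ} (hψ : IsTest ψ) (i : Fin d) :
    HasWDZeroTrace i (toL2 ψ hψ.1.continuous)
      (toL2 (pderiv i ψ) (contDiff_pderiv hψ.1).continuous) := by
  intro χ hχ _
  rw [integral_toL2_mul, integral_toL2_mul, integral_test_mul_pderiv hψ hχ]

lemma hasWD_toL2 {χ : (Fin d → ℝ) → ℝ} (hχ : ContDiff ℝ ∞ χ) (i : Fin d) :
    HasWD (unitIdx i) (toL2 χ hχ.continuous)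
      (toL2 (pderiv i χ) (contDiff_pderiv hχ).continuous) := by
  intro ψ hψ
  rw [integral_toL2_mul, integral_toL2_mul, mderiv_unitIdx, sum_unitIdx]
  have := integral_test_mul_pderiv hψ hχ i
  simp only [mul_comm (χ _), mul_comm (pderiv i χ _)]
  linarith

/-- Green's formula without boundary term holds for test functions, and both of its sides are
continuous under convergence in `H¹`. -/
lemma InH10.exists_hasWDZeroTrace {v : L2 d} (h : InH10 v) :
    ∀ i, ∃ g, HasWDZeroTrace i v g := by
  obtain ⟨g, -, hg⟩ := h
  refine fun i => ⟨g i, fun χ hχ hc => ?_⟩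
  choose ψ hψ hv hgi using fun k : ℕ => hg (ENNReal.ofReal (1 / (k + 1)))
    (ENNReal.ofReal_pos.2 (by positivity))
  have lim : ∀ (w : L2 d) (f : ℕ → (Fin d → ℝ) → ℝ) (hf : ∀ k, Continuous (f k)),
      (∀ k, eLpNorm (fun x => w x - f k x) 2 (vol d) < ENNReal.ofReal (1 / (k + 1))) →
      Tendsto (fun k => toL2 (f k) (hf k)) atTop (𝓝 w) := by
    intro w f hf hlt
    rw [tendsto_iff_norm_sub_tendsto_zero]
    refine squeeze_zero (fun _ => norm_nonneg _) (fun k => ?_) tendsto_one_div_add_atTop_nhds_zero_nat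
    rw [norm_sub_rev, Lp.norm_def]
    refine ENNReal.toReal_le_of_le_ofReal (by positivity) (le_trans (le_of_eq ?_) (hlt k).le)
    refine eLpNorm_congr_ae ?_
    filter_upwards [Lp.coeFn_sub w (toL2 (f k) (hf k)), coeFn_toL2 (hf k)] with x h1 h2
    rw [h1, Pi.sub_apply, h2]
  have l1 := lim v ψ (fun k => (hψ k).1.continuous) hv
  have l2 := lim (g i) (fun k => pderiv i (ψ k)) (fun k => (contDiff_pderiv (hψ k).1).continuous)
    fun k => hgi k i
  have c1 := contDiff_pderiv (i := i) hχ |>.continuous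
  have t1 := (tendsto_const_nhds (x := toL2 _ c1)).inner (𝕜 := ℝ) l1
  have t2 := ((tendsto_const_nhds (x := toL2 _ hχ.continuous)).inner (𝕜 := ℝ) l2).neg
  simp only [inner_toL2] at t1 t2
  have e : ∀ k, ∫ x in cube d, toL2 (ψ k) (hψ k).1.continuous x * pderiv i χ x =
      -∫ x in cube d, toL2 (pderiv i (ψ k)) (contDiff_pderiv (hψ k).1).continuous x * χ x :=
    fun k => (hψ k).hasWDZeroTrace i χ hχ hc
  simp only [e] at t1
  exact tendsto_nhds_unique t1 t2

/-! ### Weak derivatives from coefficients -/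

/-- Parseval's identity is applied in two systems: a smooth `ψ`, free on the boundary, is expanded
with a cosine in direction `i` and its derivative with a sine, which requires no boundary condition
on `ψ`. -/
lemma hasWDZeroTrace_of_coef {i : Fin d} {u g : L2 d}
    (h : ∀ n, coef (Function.update sinT i false) n g = n i * Real.pi * coef sinT n u) :
    HasWDZeroTrace i u g := by
  intro ψ hψ _
  have h1 := hasSum_coef_mul_coef sinT (toL2 _ (contDiff_pderiv (i := i) hψ).continuous) u
  have h2 := hasSum_coef_mul_coef (Function.update sinT i false) (toL2 _ hψ.continuous) g
  rw [inner_toL2] at h1 h2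
  refine h1.unique (h2.neg.congr_fun fun n => ?_)
  rw [(hasWD_toL2 hψ i).coef_unitIdx rfl, h]
  ring

lemma hasWD_of_coef {i : Fin d} {q g : L2 d}
    (h : ∀ n, coef (Function.update cosT i true) n g = -(n i * Real.pi) * coef cosT n q) :
    HasWD (unitIdx i) q g := by
  intro ψ hψ
  have h1 := hasSum_coef_mul_coef cosT (toL2 _ (contDiff_pderiv (i := i) hψ.1).continuous) q
  have h2 := hasSum_coef_mul_coef (Function.update cosT i true) (toL2 _ hψ.1.continuous) g
  rw [inner_toL2] at h1 h2
  rw [mderiv_unitIdx, sum_unitIdx, pow_one, neg_one_mul]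
  refine h1.unique (h2.neg.congr_fun fun n => ?_)
  rw [(hψ.hasWDZeroTrace i).coef_eq rfl, h]
  ring

/-- The pairing of a gradient with a field, in coefficients. -/
lemma HasWD.hasSum_inner {i : Fin d} {q g : L2 d} (h : HasWD (unitIdx i) q g) (v : L2 d) :
    HasSum (fun n => -(coef cosT n q * (n i * Real.pi * coef (Function.update cosT i true) n v)))
      (inner ℝ g v) := by
  refine (hasSum_coef_mul_coef (Function.update cosT i true) g v).congr_fun fun n => ?_
  have e : Function.update (cosT (d := d)) i false = cosT := by
    funext j; rcases eq_or_ne j i with rfl | hj <;> simp [cosT, *]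
  rw [h.coef_unitIdx (by simp), Function.update_idem, e]
  ring

/-- Only the normal components need to vanish on the faces: then each `∂_i u_i` exists separately,
and cosines become admissible although they are not test functions. -/
lemma HasWeakDiv.coef_eq {u : Vec d} {g : L2 d} (h : HasWeakDiv u g)
    (hz : ∀ i, ∃ k, HasWDZeroTrace i (u i) k) (n : Fin d → ℕ) :
    coef cosT n g = ∑ i, n i * Real.pi * coef (Function.update cosT i true) n (u i) := by
  choose k hk using hz
  have hg : g = ∑ i, k i := by
    rw [← sub_eq_zero]
    refine eq_zero_of_integral_test fun ψ hψ => ?_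
    have hc := hψ.1.continuous
    have e : ∫ x in cube d, (∑ i, k i : L2 d) x * ψ x = ∑ i, ∫ x in cube d, k i x * ψ x := by
      simp only [← inner_toL2 hc, inner_sum]
    have h1 := h ψ hψ
    simp only [(hk _).integral_eq hψ.1, Finset.sum_neg_distrib] at h1
    rw [integral_sub_mul _ _ hc, e]
    linarith
  rw [hg, coef_sum]
  exact Finset.sum_congr rfl fun i _ => (hk i).coef_eq rfl n

/-! ### Symbols of the operators -/

/-- The square of a frequency. -/
noncomputable def freqSq (k : ℕ) : ℝ := (k * Real.pi) ^ 2

/-- The symbol of `-Δ`. -/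
noncomputable def lsym (n : Fin d → ℕ) : ℝ := ∑ j, freqSq (n j)

/-- The symbol of `A`. -/
noncomputable def asym (n : Fin d → ℕ) : ℝ := ∏ j, (1 + freqSq (n j))

/-- The symbol of `B`. -/
noncomputable def bsym : (d : ℕ) → ℝ → (Fin d → ℕ) → ℝ
  | 2, _, n => freqSq (n 0) * freqSq (n 1)
  -- The sixth-order derivative has a negative symbol, so the term `-τ/2 ∂_xxyyzz` contributes with
  -- a plus sign.
  | 3, τ, n => freqSq (n 0) * freqSq (n 1) + freqSq (n 1) * freqSq (n 2)
      + freqSq (n 0) * freqSq (n 2) + τ / 2 * (freqSq (n 0) * freqSq (n 1) * freqSq (n 2))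
  | _, _, _ => 0

/-- The symbol of `1 - τ/2 Δ + τ²/4 B`. -/
noncomputable def msym (τ : ℝ) (n : Fin d → ℕ) : ℝ := 1 + τ / 2 * lsym n + τ ^ 2 / 4 * bsym d τ n

lemma freqSq_nonneg (k : ℕ) : 0 ≤ freqSq k := sq_nonneg _

lemma one_le_freqSq {k : ℕ} (hk : k ≠ 0) : 1 ≤ freqSq k := by
  have h1 : (1 : ℝ) ≤ k := by exact_mod_cast Nat.one_le_iff_ne_zero.2 hk
  have h2 : (1 : ℝ) ≤ k * Real.pi := by nlinarith [Real.pi_gt_three]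
  unfold freqSq
  nlinarith

lemma lsym_nonneg (n : Fin d → ℕ) : 0 ≤ lsym n := Finset.sum_nonneg fun _ _ => freqSq_nonneg _

lemma freqSq_le_lsym (n : Fin d → ℕ) (j : Fin d) : freqSq (n j) ≤ lsym n :=
  Finset.single_le_sum (f := fun j => freqSq (n j)) (fun _ _ => freqSq_nonneg _) (Finset.mem_univ j)

lemma asym_eq_sum (n : Fin d → ℕ) : asym n = ∑ S : Finset (Fin d), ∏ j ∈ S, freqSq (n j) := by
  unfold asym
  rw [Finset.prod_one_add, Finset.powerset_univ]

lemma one_add_lsym_le_asym (n : Fin d → ℕ) : 1 + lsym n ≤ asym n := by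
  have key : ∀ s : Finset (Fin d), 1 + ∑ j ∈ s, freqSq (n j) ≤ ∏ j ∈ s, (1 + freqSq (n j)) := by
    intro s
    induction s using Finset.induction_on with
    | empty => simp
    | insert i s hi ih =>
      rw [Finset.sum_insert hi, Finset.prod_insert hi]
      have h1 := freqSq_nonneg (n i)
      have h2 : 0 ≤ ∑ j ∈ s, freqSq (n j) := Finset.sum_nonneg fun _ _ => freqSq_nonneg _
      nlinarith
  exact key Finset.univ

lemma one_le_asym (n : Fin d → ℕ) : 1 ≤ asym n := by
  have := one_add_lsym_le_asym n
  have := lsym_nonneg n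
  linarith

lemma bsym_nonneg (hd : d = 2 ∨ d = 3) {τ : ℝ} (hτ : 0 ≤ τ) (n : Fin d → ℕ) : 0 ≤ bsym d τ n := by
  have h := fun k => freqSq_nonneg k
  rcases hd with rfl | rfl
  · exact mul_nonneg (h _) (h _)
  · have h0 := h (n 0)
    have h1 := h (n 1)
    have h2 := h (n 2)
    simp only [bsym]
    positivity

/-- The symbol is affine in `τ` and hence determined by its values at `2` and `4`. This yields
bounds on `B u` uniform in `τ` from a regularity assumption that is made for each `τ` separately. -/
lemma bsym_eq (hd : d = 2 ∨ d = 3) (τ : ℝ) (n : Fin d → ℕ) :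
    bsym d τ n = 2 * bsym d 2 n - bsym d 4 n - τ / 2 * (bsym d 2 n - bsym d 4 n) := by
  rcases hd with rfl | rfl
  · simp only [bsym]; ring
  · simp only [bsym]; ring

lemma one_le_lsym (hd : d = 2 ∨ d = 3) {n : Fin d → ℕ} (hn : n ∈ Supp sinT) : 1 ≤ lsym n := by
  have : 0 < d := by omega
  exact (one_le_freqSq (hn ⟨0, this⟩ rfl)).trans (freqSq_le_lsym n _)

/-- On sines all squared frequencies are at least `π²`, and a sum of numbers that are at least `2`
is dominated by their pairwise products. -/
lemma lsym_le_bsym (hd : d = 2 ∨ d = 3) {τ : ℝ} (hτ : 0 ≤ τ) {n : Fin d → ℕ}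
    (hn : n ∈ Supp sinT) : lsym n ≤ bsym d τ n := by
  have h9 : ∀ j, 2 ≤ freqSq (n j) := by
    intro j
    have h1 : (1 : ℝ) ≤ n j := by exact_mod_cast Nat.one_le_iff_ne_zero.2 (hn j rfl)
    have h2 : (3 : ℝ) ≤ n j * Real.pi := by nlinarith [Real.pi_gt_three]
    unfold freqSq
    nlinarith
  rcases hd with rfl | rfl
  · simp only [bsym, lsym, Fin.sum_univ_two]
    nlinarith [h9 0, h9 1]
  · simp only [bsym, lsym, Fin.sum_univ_three]
    have h0 := h9 0
    have h1 := h9 1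
    have h2 := h9 2
    have : 0 ≤ τ / 2 * (freqSq (n 0) * freqSq (n 1) * freqSq (n 2)) := by positivity
    nlinarith

lemma one_le_msym (hd : d = 2 ∨ d = 3) {τ : ℝ} (hτ : 0 ≤ τ) (n : Fin d → ℕ) : 1 ≤ msym τ n := by
  have h1 := lsym_nonneg n
  have h2 := bsym_nonneg hd hτ n
  have : 0 ≤ τ / 2 * lsym n := by positivity
  have : 0 ≤ τ ^ 2 / 4 * bsym d τ n := by positivity
  unfold msym
  linarith

/-- All components of `u` vanish on the boundary in the sense of Green's formula. -/
def ZeroTrace (u : L2 d) : Prop := ∀ i, ∃ g, HasWDZeroTrace i u g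

lemma HasWD.coef_sin_two {u g : L2 d} {α : Fin d → ℕ} (h : HasWD α u g) (hu : ZeroTrace u)
    (hα : ∀ j, α j = 0 ∨ α j = 2) (n : Fin d → ℕ) :
    coef sinT n g = (∏ j, if α j = 2 then -freqSq (n j) else 1) * coef sinT n u := by
  have hadm : ∀ j, Adm u j (α j) (tr (sinT j) (n j)) := by
    intro j
    rcases hα j with h | h
    · rw [h]; exact Adm.zero
    · rw [h]; exact Adm.trace_two (hu j)
  rw [h.coef_eq sinT n hadm]
  have heven : Even (∑ j, α j) := Finset.even_sum _ fun j _ => by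
    rcases hα j with h | h <;> simp [h]
  have ht : (fun j => trType (sinT j) (α j)) = sinT := by
    funext j
    rcases hα j with h | h <;> simp [h, trType]
  rw [heven.neg_one_pow, one_mul, ht]
  congr 1
  refine Finset.prod_congr rfl fun j _ => ?_
  rcases hα j with h | h <;> simp [h, trFactor, freqSq]

/-- The derivative is expanded with cosines exactly in the differentiated directions, which the zero
trace of `u` permits. Squaring removes the signs. -/
lemma HasWD.coef_sq_of_zeroTrace {u g : L2 d} {α : Fin d → ℕ} (h : HasWD α u g)
    (hu : ZeroTrace u) (hα : ∀ j, α j ≤ 1) (n : Fin d → ℕ) :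
    coef (fun j => decide (α j = 0)) n g ^ 2 =
      (∏ j, if α j = 1 then freqSq (n j) else 1) * coef sinT n u ^ 2 := by
  have h01 : ∀ j, α j = 0 ∨ α j = 1 := fun j => by have := hα j; omega
  rw [h.coef_eq _ n fun j => ?_]
  · have ht : (fun j => trType (decide (α j = 0)) (α j)) = sinT := by
      funext j
      rcases h01 j with h | h <;> simp [h, trType, sinT]
    rw [ht, mul_pow, mul_pow, ← pow_mul, mul_comm _ 2, pow_mul, neg_one_sq, one_pow, one_mul,
      ← Finset.prod_pow]
    congr 1
    refine Finset.prod_congr rfl fun j _ => ?_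
    rcases h01 j with h | h <;> simp [h, trFactor, freqSq]
  · rcases h01 j with h | h
    · rw [h]; exact Adm.zero
    · rw [h]; exact Adm.trace_one (hu j)

lemma HasWD.coef_sq_cos {q g : L2 d} {α : Fin d → ℕ} (h : HasWD α q g) (hα : ∀ j, α j ≤ 1)
    (n : Fin d → ℕ) :
    coef (fun j => decide (α j = 1)) n g ^ 2 =
      (∏ j, if α j = 1 then freqSq (n j) else 1) * coef cosT n q ^ 2 := by
  have h01 : ∀ j, α j = 0 ∨ α j = 1 := fun j => by have := hα j; omega
  rw [h.coef_eq _ n fun j => ?_]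
  · have ht : (fun j => trType (decide (α j = 1)) (α j)) = cosT := by
      funext j
      rcases h01 j with h | h <;> simp [h, trType, cosT]
    rw [ht, mul_pow, mul_pow, ← pow_mul, mul_comm _ 2, pow_mul, neg_one_sq, one_pow, one_mul,
      ← Finset.prod_pow]
    congr 1
    refine Finset.prod_congr rfl fun j _ => ?_
    rcases h01 j with h | h <;> simp [h, trFactor, freqSq]
  · rcases h01 j with h | h
    · rw [h]; exact Adm.zero
    · rw [h]; simp only [decide_true]; exact Adm.sin_one

/-! ### The operators of the scheme in coefficients -/

lemma HasA.coef_eq {φ g : L2 d} (h : HasA d φ g) (n : Fin d → ℕ) :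
    coef cosT n g = asym n * coef cosT n φ := by
  unfold HasA at h
  split at h
  · obtain ⟨-, a, b, ha, hb, rfl⟩ := h
    have e1 := ha.coef_eq (σ := cosT) rfl n
    have e2 := hb.coef_eq (σ := cosT) rfl n
    simp only [coef_sub] at e2 ⊢
    rw [e2, e1]
    simp only [asym, Fin.prod_univ_two, freqSq]
    ring
  · obtain ⟨-, a, b, c, ha, hb, hc, rfl⟩ := h
    have e1 := ha.coef_eq (σ := cosT) rfl n
    have e2 := hb.coef_eq (σ := cosT) rfl n
    have e3 := hc.coef_eq (σ := cosT) rfl n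
    simp only [coef_sub] at e2 e3 ⊢
    rw [e3, e2, e1]
    simp only [asym, Fin.prod_univ_three, freqSq]
    ring
  · exact h.elim

lemma HasB.coef_eq {τ : ℝ} {v g : Vec d} (hd : d = 2 ∨ d = 3) (h : HasB τ v g)
    (hv : ∀ i, ZeroTrace (v i)) (i : Fin d) (n : Fin d → ℕ) :
    coef sinT n (g i) = bsym d τ n * coef sinT n (v i) := by
  have hadm : ∀ (j : Fin d) (a : ℕ), a = 0 ∨ a = 2 → Adm (v i) j a (tr (sinT j) (n j)) := by
    rintro j a (rfl | rfl)
    · exact Adm.zero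
    · exact Adm.trace_two (hv i j)
  rcases hd with rfl | rfl
  · have := coef_of_weak {()} (fun _ => 1) (fun _ => ![2, 2]) (v i) (g i) (fun ψ hψ => by
      rw [Finset.sum_singleton, one_mul, ← h i ψ hψ]; rfl) sinT n (fun _ _ j => hadm j _ (by
        fin_cases j <;> simp))
    rw [this]
    have ht : (fun j => trType (sinT j) (![2, 2] j)) = sinT := by
      funext j; fin_cases j <;> simp [trType, sinT]
    simp only [Finset.sum_singleton, one_mul, ht]
    simp [bsym, Fin.prod_univ_two, trFactor, freqSq]
  · let α : Fin 4 → Fin 3 → ℕ := ![![2, 2, 0], ![0, 2, 2], ![2, 0, 2], ![2, 2, 2]]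
    let c : Fin 4 → ℝ := ![1, 1, 1, -(τ / 2)]
    have hα : ∀ t j, α t j = 0 ∨ α t j = 2 := by
      intro t j; fin_cases t <;> fin_cases j <;> simp [α]
    have := coef_of_weak Finset.univ c α (v i) (g i) (fun ψ hψ => by
      have hi := fun β => integrable_mul_continuous (v i) (contDiff_mderiv hψ.1 β).continuous
      rw [← h i ψ hψ]
      simp_rw [← integral_const_mul]
      rw [← integral_finsetSum _ fun t _ => (hi (α t)).const_mul (c t)]
      refine integral_congr_ae (ae_of_all _ fun x => ?_)
      simp only [Fin.sum_univ_four]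
      simp only [opB, c, α, Matrix.cons_val]
      ring) sinT n (fun t _ j => hadm j _ (hα t j))
    rw [this]
    have ht : ∀ t, (fun j => trType (sinT j) (α t j)) = sinT := by
      intro t; funext j
      rcases hα t j with h | h <;> simp [h, trType, sinT]
    simp only [ht, Fin.sum_univ_four]
    simp [bsym, Fin.prod_univ_three, trFactor, freqSq, α, c]
    ring

/-- Each intermediate field is differentiated only in the direction in which it has boundary values,
so full sine products may be used as test functions and the fields can be eliminated frequency by
frequency. The products of one-dimensional symbols left over form the splitting term. -/
lemma VelocityStep.coef_eq (hd : d = 2 ∨ d = 3) {τ : ℝ} (hτ : 0 < τ) {G F u u' : Vec d} (h : VelocityStep d τ G F u u')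
    (hu : ∀ i, ZeroTrace (u i)) (i : Fin d) (n : Fin d → ℕ) :
    τ⁻¹ * (coef sinT n (u' i) - coef sinT n (u i))
      + 1 / 2 * lsym n * (coef sinT n (u' i) + coef sinT n (u i))
      + τ / 4 * bsym d τ n * (coef sinT n (u' i) - coef sinT n (u i))
      + coef sinT n (G i) = coef sinT n (F i) := by
  rcases hd with rfl | rfl
  · obtain ⟨uh, h⟩ := h
    obtain ⟨uhxx, uyy, uyy', h1, h2, h3, e1, e2⟩ := h i
    have c1 := h1.coef_eq (σ := sinT) rfl n
    have c2 := h2.coef_sin_two (hu i) (fun j => by fin_cases j <;> simp) n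
    have c3 := h3.coef_eq (σ := sinT) rfl n
    have f1 := congrArg (coef sinT n) e1
    have f2 := congrArg (coef sinT n) e2
    simp only [coef_add, coef_sub, coef_smul, c1, c2, c3] at f1 f2
    simp [Fin.prod_univ_two] at f1 f2
    simp only [lsym, bsym, Fin.sum_univ_two]
    unfold freqSq at *
    generalize coef sinT n (uh i) = y at *
    generalize coef sinT n (u' i) = z at *
    generalize coef sinT n (u i) = x at *
    generalize (n 0 * Real.pi) ^ 2 = a at *
    generalize (n 1 * Real.pi) ^ 2 = b at *
    generalize coef sinT n (G i) = g at *
    generalize coef sinT n (F i) = f at *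
    field_simp at f1 f2 ⊢
    -- The half-step value enters the two equations with the factors `1 + a τ / 2` and `-(1 - a τ /
    -- 2)`, up to scaling; these multipliers cancel it.
    linear_combination 4 * (1 - a * τ / 2) * f1 + 4 * (1 + a * τ / 2) * f2
  · obtain ⟨ξ, η, ζ, h⟩ := h
    obtain ⟨uxx, uyy, uzz, ηxx, ζyy, uzz', h1, h2, h3, h4, h5, h6, e1, e2, e3, e4⟩ := h i
    have c1 := h1.coef_sin_two (hu i) (fun j => by fin_cases j <;> simp) n
    have c2 := h2.coef_sin_two (hu i) (fun j => by fin_cases j <;> simp) n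
    have c3 := h3.coef_sin_two (hu i) (fun j => by fin_cases j <;> simp) n
    have c4 := h4.coef_eq (σ := sinT) rfl n
    have c5 := h5.coef_eq (σ := sinT) rfl n
    have c6 := h6.coef_eq (σ := sinT) rfl n
    have f1 := congrArg (coef sinT n) e1
    have f2 := congrArg (coef sinT n) e2
    have f3 := congrArg (coef sinT n) e3
    have f4 := congrArg (coef sinT n) e4
    simp only [coef_add, coef_sub, coef_smul, coef_zero, c1, c2, c3, c4, c5, c6] at f1 f2 f3 f4
    simp [Fin.prod_univ_three] at f1 f2 f3 f4
    simp only [lsym, bsym, Fin.sum_univ_three]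
    unfold freqSq at *
    generalize coef sinT n (ξ i) = y₁ at *
    generalize coef sinT n (η i) = y₂ at *
    generalize coef sinT n (ζ i) = y₃ at *
    generalize coef sinT n (u' i) = z at *
    generalize coef sinT n (u i) = x at *
    generalize (n 0 * Real.pi) ^ 2 = a at *
    generalize (n 1 * Real.pi) ^ 2 = b at *
    generalize (n 2 * Real.pi) ^ 2 = c at *
    generalize coef sinT n (G i) = g at *
    generalize coef sinT n (F i) = f at *
    have g2 : y₁ = y₂ - τ / 2 * (-(a * y₂) + a * x) := by
      field_simp at f2 ⊢; linarith
    have g3 : y₂ = y₃ - τ / 2 * (-(b * y₃) + b * x) := by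
      field_simp at f3 ⊢; linarith
    have g4 : y₃ = z - τ / 2 * (-(c * z) + c * x) := by
      field_simp at f4 ⊢; linarith
    subst g2 g3 g4
    field_simp at f1 ⊢
    linear_combination f1

/-! ### Norms of mixed derivatives as weighted sums of coefficients -/

lemma HasWD.hasSum_sin {u g : L2 d} {α : Fin d → ℕ} (h : HasWD α u g)
    (hu : ZeroTrace u) (hα : ∀ j, α j ≤ 1) :
    HasSum (fun n => (∏ j, if α j = 1 then freqSq (n j) else 1) * coef sinT n u ^ 2)
      (‖g‖ ^ 2) := by
  have := hasSum_coef_sq (fun j => decide (α j = 0)) g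
  simpa only [h.coef_sq_of_zeroTrace hu hα] using this

lemma HasWD.hasSum_cos {q g : L2 d} {α : Fin d → ℕ} (h : HasWD α q g) (hα : ∀ j, α j ≤ 1) :
    HasSum (fun n => (∏ j, if α j = 1 then freqSq (n j) else 1) * coef cosT n q ^ 2)
      (‖g‖ ^ 2) := by
  have := hasSum_coef_sq (fun j => decide (α j = 1)) g
  simpa only [h.coef_sq_cos hα] using this

lemma exists_coef_eq_sqrt {σ : Fin d → Bool} {w : (Fin d → ℕ) → ℝ} (hw : ∀ n, 0 ≤ w n) {u : L2 d}
    {s : ℝ} (h : HasSum (fun n => w n * coef σ n u ^ 2) s) :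
    ∃ z : L2 d, (∀ n, coef σ n z = √(w n) * coef σ n u) ∧ ‖z‖ ^ 2 = s := by
  have h' : HasSum (fun n => (√(w n) * coef σ n u) ^ 2) s := by
    simpa only [mul_pow, Real.sq_sqrt (hw _)] using h
  obtain ⟨z, hz⟩ := exists_coef_eq σ (fun n => √(w n) * coef σ n u) h'.summable
    (fun n hn => by rw [coef_eq_zero hn, mul_zero])
  refine ⟨z, hz, ?_⟩
  have := hasSum_coef_sq σ z
  simp only [hz] at this
  exact this.unique h'

/-- The norm of `Z` in coefficients. -/
lemma InZ.exists_coef_eq (hd : d = 2 ∨ d = 3) {τ : ℝ} (hτ : 0 ≤ τ) {v : Vec d} (hv : InZ v) :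
    ∃ z : Vec d, (∀ i n, coef sinT n (z i) = √(bsym d τ n) * coef sinT n (v i)) ∧
      ∑ i, ‖z i‖ ^ 2 = normBSq d τ v := by
  have hz : ∀ i, ZeroTrace (v i) := fun i => (hv i).1.exists_hasWDZeroTrace
  have key : ∀ (α : Fin d → ℕ), (∀ j, α j ≤ 1) → ∀ i,
      HasSum (fun n => (∏ j, if α j = 1 then freqSq (n j) else 1) * coef sinT n (v i) ^ 2)
        (‖wd α (v i)‖ ^ 2) := by
    intro α hα i
    obtain ⟨g, hg⟩ := (hv i).2 α hα
    rw [hg.wd_eq]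
    exact hg.hasSum_sin (hz i) hα
  have hb := fun n => bsym_nonneg hd hτ n
  rcases hd with rfl | rfl
  · have h := fun i => exists_coef_eq_sqrt (σ := sinT) hb (u := v i) (s := ‖wd ![1, 1] (v i)‖ ^ 2) (by
      simpa [bsym, Fin.prod_univ_two] using key ![1, 1] (fun j => by fin_cases j <;> simp) i)
    choose z h1 h2 using h
    exact ⟨z, h1, by simp only [h2, normBSq]⟩
  · have h := fun i => exists_coef_eq_sqrt (σ := sinT) hb (u := v i)
      (s := ‖wd ![1, 1, 0] (v i)‖ ^ 2 + ‖wd ![0, 1, 1] (v i)‖ ^ 2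
      + ‖wd ![1, 0, 1] (v i)‖ ^ 2 + τ / 2 * ‖wd ![1, 1, 1] (v i)‖ ^ 2) (by
      convert (((key ![1, 1, 0] (fun j => by fin_cases j <;> simp) i).add
        (key ![0, 1, 1] (fun j => by fin_cases j <;> simp) i)).add
        (key ![1, 0, 1] (fun j => by fin_cases j <;> simp) i)).add
        ((key ![1, 1, 1] (fun j => by fin_cases j <;> simp) i).mul_left (τ / 2)) using 2 with n
      simp [bsym, Fin.prod_univ_three]
      ring)
    choose z h1 h2 using h
    exact ⟨z, h1, by simp only [h2, normBSq]⟩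

/-- The multi-index of the derivative of order one in each of the directions in `S`. -/
def mixedIdx (S : Finset (Fin d)) : Fin d → ℕ := fun j => if j ∈ S then 1 else 0

lemma mixedIdx_le (S : Finset (Fin d)) (j : Fin d) : mixedIdx S j ≤ 1 := by
  unfold mixedIdx; split <;> simp

/-- Expanding the product `asym` gives one term for each set of directions, that is, one for each
mixed derivative in the definition of `Y`. Thus `Y`-regularity places a pressure in the form domain
of `A`. -/
lemma exists_coef_eq_sqrt_asym {q : L2 d} {W : Finset (Fin d) → L2 d}
    (hW : ∀ S, HasWD (mixedIdx S) q (W S)) :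
    ∃ y : L2 d, (∀ n, coef cosT n y = √(asym n) * coef cosT n q) ∧ ‖y‖ ≤ ∑ S, ‖W S‖ := by
  have hs : HasSum (fun n => asym n * coef cosT n q ^ 2) (∑ S, ‖W S‖ ^ 2) := by
    have := hasSum_sum (s := Finset.univ) fun S _ => (hW S).hasSum_cos (mixedIdx_le S)
    convert this using 2 with n
    rw [asym_eq_sum, Finset.sum_mul]
    refine Finset.sum_congr rfl fun S _ => ?_
    congr 1
    simp [mixedIdx, Finset.prod_ite_mem]
  obtain ⟨y, h1, h2⟩ := exists_coef_eq_sqrt (fun n => zero_le_one.trans (one_le_asym n)) hs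
  refine ⟨y, h1, ?_⟩
  have h0 : 0 ≤ ∑ S, ‖W S‖ := Finset.sum_nonneg fun _ _ => norm_nonneg _
  refine (abs_le_of_sq_le_sq' ?_ h0).2
  rw [h2]
  exact Finset.sum_sq_le_sq_sum_of_nonneg fun _ _ => norm_nonneg _

section Time

set_option linter.unusedSectionVars false

variable {E : Type*} [NormedAddCommGroup E] [NormedSpace ℝ E] [CompleteSpace E]

/-! ### Regularity in time -/

lemma ae_norm_le_of_memLp_top {T : ℝ} {g : ℝ → E} (hg : MemLp g ∞ (volume.restrict (Ioo 0 T))) :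
    ∃ K : ℝ, 0 ≤ K ∧ ∀ᵐ r, r ∈ Ioo 0 T → ‖g r‖ ≤ K := by
  refine ⟨(eLpNorm g ∞ (volume.restrict (Ioo 0 T))).toReal, ENNReal.toReal_nonneg, ?_⟩
  rw [← ae_restrict_iff' measurableSet_Ioo]
  filter_upwards [ae_le_eLpNormEssSup (f := g) (μ := volume.restrict (Ioo 0 T))] with r hr
  have h := ENNReal.toReal_mono hg.2.ne hr
  simpa using h

lemma intervalIntegrable_of_memLp_top {T s t : ℝ} {g : ℝ → E}
    (hg : MemLp g ∞ (volume.restrict (Ioo 0 T))) (hs : s ∈ Icc 0 T) (ht : t ∈ Icc 0 T) :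
    IntervalIntegrable g volume s t := by
  have h1 : IntegrableOn g (Ioo 0 T) := hg.integrable le_top
  rw [intervalIntegrable_iff]
  rw [← integrableOn_Ioc_iff_integrableOn_Ioo] at h1
  exact h1.mono_set (Ioc_subset_Ioc (le_min hs.1 ht.1) (max_le hs.2 ht.2))

lemma ae_uIoc_of_ae_Ioo {T s t : ℝ} {P : ℝ → Prop} (h : ∀ᵐ r, r ∈ Ioo 0 T → P r)
    (hs : s ∈ Icc 0 T) (ht : t ∈ Icc 0 T) : ∀ᵐ r, r ∈ uIoc s t → P r := by
  have hne : ∀ᵐ r : ℝ, r ≠ T := by simp [ae_iff]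
  filter_upwards [h, hne] with r hr hrT hmem
  refine hr ⟨(le_min hs.1 ht.1).trans_lt hmem.1, lt_of_le_of_ne (hmem.2.trans (max_le hs.2 ht.2)) hrT⟩

lemma sub_eq_integral {T s t : ℝ} {g g' : ℝ → E} (hg' : MemLp g' ∞ (volume.restrict (Ioo 0 T)))
    (h : ∀ t ∈ Icc 0 T, g t = g 0 + ∫ r in (0 : ℝ)..t, g' r) (hs : s ∈ Icc 0 T)
    (ht : t ∈ Icc 0 T) : g t - g s = ∫ r in s..t, g' r := by
  have h0 : (0 : ℝ) ∈ Icc 0 T := ⟨le_rfl, hs.1.trans hs.2⟩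
  rw [h t ht, h s hs, add_sub_add_left_eq_sub, intervalIntegral.integral_interval_sub_left
    (intervalIntegrable_of_memLp_top hg' h0 ht) (intervalIntegrable_of_memLp_top hg' h0 hs)]

lemma MemWInfty.exists_lipschitz {m : ℕ} {T : ℝ} {ψ : ℝ → E} (h : MemWInfty m T ψ) (hm : 1 ≤ m) :
    ∃ K : ℝ, 0 ≤ K ∧ ∀ s ∈ Icc 0 T, ∀ t ∈ Icc 0 T, ‖ψ t - ψ s‖ ≤ K * |t - s| := by
  obtain ⟨D, h0, h1, h2⟩ := h
  obtain ⟨K, hK, hb⟩ := ae_norm_le_of_memLp_top (h1 1 hm)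
  refine ⟨K, hK, fun s hs t ht => ?_⟩
  rw [← h0 s hs, ← h0 t ht, sub_eq_integral (h1 1 hm) (h2 0 hm) hs ht]
  exact intervalIntegral.norm_integral_le_of_norm_le_const_ae (ae_uIoc_of_ae_Ioo hb hs ht)

/-- One integration in time raises the order of a Taylor remainder by one; applied twice, this takes
the Lipschitz bound of the second derivative to a cubic remainder. -/
lemma norm_sub_sub_smul_le {T s t K : ℝ} {g g' : ℝ → E} {c : ℝ → E} {C : ℝ → E} {j : ℕ}
    (hK : 0 ≤ K) (hg' : MemLp g' ∞ (volume.restrict (Ioo 0 T)))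
    (h : ∀ t ∈ Icc 0 T, g t = g 0 + ∫ r in (0 : ℝ)..t, g' r)
    (hc : Continuous c) (hC : C t - C s = ∫ r in s..t, c r)
    (hb : ∀ r ∈ Icc 0 T, ‖g' r - c r‖ ≤ K * |r - s| ^ j) (hs : s ∈ Icc 0 T)
    (ht : t ∈ Icc 0 T) : ‖(g t - g s) - (C t - C s)‖ ≤ K * |t - s| ^ (j + 1) := by
  rw [sub_eq_integral hg' h hs ht, hC, ← intervalIntegral.integral_sub
    (intervalIntegrable_of_memLp_top hg' hs ht) (hc.intervalIntegrable _ _), pow_succ, ← mul_assoc]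
  refine intervalIntegral.norm_integral_le_of_norm_le_const fun r hr => ?_
  have hr' : r ∈ Icc 0 T :=
    ⟨(le_min hs.1 ht.1).trans hr.1.le, hr.2.trans (max_le hs.2 ht.2)⟩
  refine (hb r hr').trans ?_
  have : |r - s| ≤ |t - s| := abs_sub_left_of_mem_uIcc (uIoc_subset_uIcc hr)
  gcongr

/-- Taylor's formula for functions in `W^{3,∞}`. -/
lemma MemWInfty.exists_taylor {T : ℝ} {ψ : ℝ → E} (h : MemWInfty 3 T ψ) :
    ∃ (D₁ D₂ : ℝ → E) (K : ℝ), 0 ≤ K ∧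
      (∀ t ∈ Icc 0 T, HasDerivWithinAt ψ (D₁ t) (Icc 0 T) t) ∧ (∀ t ∈ Icc 0 T, ‖D₂ t‖ ≤ K) ∧
      ∀ s ∈ Icc 0 T, ∀ t ∈ Icc 0 T,
        ‖ψ t - (ψ s + (t - s) • D₁ s + ((t - s) ^ 2 / 2) • D₂ s)‖ ≤ K * |t - s| ^ 3 := by
  obtain ⟨D, h0, h1, h2⟩ := h
  obtain ⟨K₃, hK₃, hb₃⟩ := ae_norm_le_of_memLp_top (h1 3 le_rfl)
  have e2 : ∀ s ∈ Icc 0 T, ∀ t ∈ Icc 0 T, ‖D 2 t - D 2 s‖ ≤ K₃ * |t - s| ^ 1 := by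
    intro s hs t ht
    rw [sub_eq_integral (h1 3 le_rfl) (h2 2 (by norm_num)) hs ht, pow_one]
    exact intervalIntegral.norm_integral_le_of_norm_le_const_ae (ae_uIoc_of_ae_Ioo hb₃ hs ht)
  have e1 : ∀ s ∈ Icc 0 T, ∀ t ∈ Icc 0 T, ‖D 1 t - (D 1 s + (t - s) • D 2 s)‖ ≤ K₃ * |t - s| ^ 2 := by
    intro s hs t ht
    have := norm_sub_sub_smul_le (g := D 1) (g' := D 2) (c := fun _ => D 2 s)
      (C := fun t => (t - s) • D 2 s) (j := 1) hK₃ (h1 2 (by norm_num)) (h2 1 (by norm_num))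
      continuous_const (by simp) (fun r hr => e2 s hs r hr) hs ht
    simpa [sub_sub] using this
  have e0 : ∀ s ∈ Icc 0 T, ∀ t ∈ Icc 0 T,
      ‖D 0 t - (D 0 s + (t - s) • D 1 s + ((t - s) ^ 2 / 2) • D 2 s)‖ ≤ K₃ * |t - s| ^ 3 := by
    intro s hs t ht
    have := norm_sub_sub_smul_le (g := D 0) (g' := D 1) (c := fun r => D 1 s + (r - s) • D 2 s)
      (C := fun t => (t - s) • D 1 s + ((t - s) ^ 2 / 2) • D 2 s) (j := 2) hK₃ (h1 1 (by norm_num))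
      (h2 0 (by norm_num)) (by fun_prop) ?_ (fun r hr => e1 s hs r hr) hs ht
    · simpa [sub_sub, add_assoc] using this
    · rw [intervalIntegral.integral_add (by simp)
        ((Continuous.intervalIntegrable (by fun_prop) _ _)), intervalIntegral.integral_smul_const]
      have : ∫ r in s..t, (r - s) = (t - s) ^ 2 / 2 := by
        simp
        ring
      rw [this]
      simp
  have hT0 : ∀ t ∈ Icc 0 T, (0 : ℝ) ∈ Icc 0 T := fun t ht => ⟨le_rfl, ht.1.trans ht.2⟩
  have hD2 : ∀ t ∈ Icc 0 T, ‖D 2 t‖ ≤ ‖D 2 0‖ + K₃ * |T| := by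
    intro t ht
    have h := e2 0 (hT0 t ht) t ht
    have h' := norm_le_norm_add_norm_sub' (D 2 t) (D 2 0)
    have : |t - 0| ≤ |T| := by
      rw [sub_zero, abs_of_nonneg ht.1, abs_of_nonneg (ht.1.trans ht.2)]; exact ht.2
    have : K₃ * |t - 0| ^ 1 ≤ K₃ * |T| := by rw [pow_one]; gcongr
    linarith
  refine ⟨D 1, D 2, K₃ + (‖D 2 0‖ + K₃ * |T|), by positivity, fun s hs => ?_,
    fun t ht => (hD2 t ht).trans (le_add_of_nonneg_left hK₃), fun s hs t ht => ?_⟩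
  · rw [hasDerivWithinAt_iff_isLittleO]
    have hO : (fun t => ψ t - ψ s - (t - s) • D 1 s) =O[𝓝[Icc 0 T] s] fun t => (t - s) ^ 2 := by
      refine Asymptotics.IsBigO.of_bound (K₃ * |T| + ‖D 2 s‖ / 2) ?_
      filter_upwards [self_mem_nhdsWithin] with t ht
      have h := e0 s hs t ht
      rw [h0 s hs, h0 t ht] at h
      have hle : |t - s| ≤ |T| := by
        rw [abs_of_nonneg (ht.1.trans ht.2), abs_le]
        constructor <;> linarith [ht.1, ht.2, hs.1, hs.2]
      have h3 : K₃ * |t - s| ^ 3 ≤ K₃ * |T| * |t - s| ^ 2 := by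
        rw [pow_succ, mul_assoc, mul_comm |T|]; gcongr
      have : ψ t - ψ s - (t - s) • D 1 s =
          (ψ t - (ψ s + (t - s) • D 1 s + ((t - s) ^ 2 / 2) • D 2 s)) + ((t - s) ^ 2 / 2) • D 2 s := by
        abel
      rw [this]
      refine (norm_add_le _ _).trans ?_
      rw [norm_smul, Real.norm_of_nonneg (by positivity), Real.norm_of_nonneg (by positivity)]
      rw [sq_abs] at h3
      linarith
    refine hO.trans_isLittleO ?_
    have : (fun t : ℝ => (t - s) ^ 2) =o[𝓝 s] fun t => t - s := by
      have := (Asymptotics.isLittleO_pow_sub_sub s (m := 2) (by norm_num))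
      simpa using this
    exact this.mono nhdsWithin_le_nhds
  · rw [← h0 s hs, ← h0 t ht]
    refine (e0 s hs t ht).trans ?_
    have : 0 ≤ ‖D 2 0‖ + K₃ * |T| := by positivity
    gcongr
    linarith

/-! ### Grid values and consistency of the time discretization -/

/-- Values at the grid points `kτ`, `k < N`. The point `Nτ` may lie outside `[0,T]`, so the value
there is extrapolated by a quadratic polynomial. -/
noncomputable def gridVal (τ : ℝ) (N : ℕ) (ψ : ℝ → E) (k : ℕ) : E :=
  if k < N then ψ (k * τ)
  -- The weights are those of Lagrange extrapolation to `kτ` from the nodes at distances `0`, `τ/4`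
  -- and `τ/2` from `(k-1)τ`; at `k = N` all three nodes lie in `[0,T]`.
  else (3 : ℝ) • ψ ((k - 1) * τ) - (8 : ℝ) • ψ ((k - 1) * τ + τ / 4)
    + (6 : ℝ) • ψ ((k - 1) * τ + τ / 2)

lemma gridVal_of_lt {τ : ℝ} {N : ℕ} {ψ : ℝ → E} {k : ℕ} (h : k < N) :
    gridVal τ N ψ k = ψ (k * τ) := if_pos h

lemma mid_mem {τ T : ℝ} {N k : ℕ} (hτ : 0 < τ) (hN : ((N : ℝ) - 1 / 2) * τ ≤ T) (hk : k < N)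
    {θ : ℝ} (h0 : 0 ≤ θ) (h1 : θ ≤ 1 / 2) : k * τ + θ * τ ∈ Icc 0 T := by
  have hk' : (k : ℝ) + 1 ≤ N := by exact_mod_cast hk
  constructor
  · positivity
  · refine le_trans ?_ hN
    rw [← add_mul]
    gcongr
    linarith

lemma next_mem {τ T : ℝ} {N k : ℕ} (hτ : 0 < τ) (hN : ((N : ℝ) - 1 / 2) * τ ≤ T) (hk : k + 1 < N) :
    ((k + 1 : ℕ) : ℝ) * τ ∈ Icc 0 T := by
  simpa using mid_mem hτ hN hk le_rfl (by norm_num)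

/-- The constant comes from the extrapolated value: the weights `6` and `8` at distances `τ/2` and
`τ/4` add up to `5 τ`. -/
lemma norm_gridVal_succ_sub_le {τ T K : ℝ} {N k : ℕ} (hτ : 0 < τ) (hK : 0 ≤ K)
    (hN : ((N : ℝ) - 1 / 2) * τ ≤ T) (hk : k < N) {ψ : ℝ → E}
    (h : ∀ s ∈ Icc 0 T, ∀ t ∈ Icc 0 T, ‖ψ t - ψ s‖ ≤ K * |t - s|) :
    ‖gridVal τ N ψ (k + 1) - gridVal τ N ψ k‖ ≤ 5 * K * τ := by
  have m0 : (k : ℝ) * τ ∈ Icc 0 T := by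
    simpa using mid_mem hτ hN hk (θ := 0) le_rfl (by norm_num)
  rw [gridVal_of_lt hk]
  by_cases hk1 : k + 1 < N
  · rw [gridVal_of_lt hk1]
    refine (h _ m0 _ (next_mem hτ hN hk1)).trans ?_
    have : ((k + 1 : ℕ) : ℝ) * τ - k * τ = τ := by push_cast; ring
    rw [this, abs_of_pos hτ]
    nlinarith [mul_nonneg hK hτ.le]
  · rw [gridVal, if_neg hk1]
    have m1 := mid_mem hτ hN hk (θ := 1 / 4) (by norm_num) (by norm_num)
    have m2 := mid_mem hτ hN hk (θ := 1 / 2) (by norm_num) (by norm_num)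
    have e1 := h _ m0 _ m1
    have e2 := h _ m0 _ m2
    rw [add_sub_cancel_left, abs_of_pos (by positivity)] at e1 e2
    have : ((k + 1 : ℕ) : ℝ) - 1 = k := by push_cast; ring
    rw [this, show τ / 4 = 1 / 4 * τ by ring, show τ / 2 = 1 / 2 * τ by ring]
    generalize ψ (k * τ) = a at *
    generalize ψ (k * τ + 1 / 4 * τ) = b at *
    generalize ψ (k * τ + 1 / 2 * τ) = c at *
    have : (3 : ℝ) • a - (8 : ℝ) • b + (6 : ℝ) • c - a = (6 : ℝ) • (c - a) - (8 : ℝ) • (b - a) := by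
      module
    rw [this]
    refine (norm_sub_le _ _).trans ?_
    rw [norm_smul, norm_smul, Real.norm_of_nonneg (by norm_num), Real.norm_of_nonneg (by norm_num)]
    linarith

/-- Extrapolation reproduces quadratic polynomials, so only remainders survive at the last point:
`3/8 + 8/64` times `K τ³`. -/
lemma norm_gridVal_sub_taylor_le {τ T K : ℝ} {N k : ℕ} (hτ : 0 < τ) (hK : 0 ≤ K)
    (hN : ((N : ℝ) - 1 / 2) * τ ≤ T) (hk : k < N) {ψ D₁ D₂ : ℝ → E}
    (h : ∀ s ∈ Icc 0 T, ∀ t ∈ Icc 0 T,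
        ‖ψ t - (ψ s + (t - s) • D₁ s + ((t - s) ^ 2 / 2) • D₂ s)‖ ≤ K * |t - s| ^ 3) {m : ℝ}
    (hm : m = (k + 1 / 2 : ℝ) * τ) :
    ‖gridVal τ N ψ k - (ψ m - (τ / 2) • D₁ m + (τ ^ 2 / 8) • D₂ m)‖ ≤ K * τ ^ 3 ∧
    ‖gridVal τ N ψ (k + 1) - (ψ m + (τ / 2) • D₁ m + (τ ^ 2 / 8) • D₂ m)‖ ≤ K * τ ^ 3 := by
  have m0 : (k : ℝ) * τ ∈ Icc 0 T := by
    simpa using mid_mem hτ hN hk (θ := 0) le_rfl (by norm_num)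
  have m1 := mid_mem hτ hN hk (θ := 1 / 4) (by norm_num) (by norm_num)
  have m2 : m ∈ Icc 0 T := by
    have := mid_mem hτ hN hk (θ := 1 / 2) (by norm_num) (by norm_num)
    rwa [← add_mul, ← hm] at this
  have hKτ : 0 ≤ K * τ ^ 3 := by positivity
  have e0 := h m m2 _ m0
  have s0 : k * τ - m = -(τ / 2) := by rw [hm]; ring
  rw [s0, abs_neg, abs_of_pos (by positivity)] at e0
  have e0' : ‖ψ (k * τ) - (ψ m - (τ / 2) • D₁ m + (τ ^ 2 / 8) • D₂ m)‖ ≤ K * τ ^ 3 / 8 := by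
    convert e0 using 1
    · congr 1; module
    · ring
  rw [gridVal_of_lt hk]
  refine ⟨e0'.trans (by linarith), ?_⟩
  by_cases hk1 : k + 1 < N
  · rw [gridVal_of_lt hk1]
    have e1 := h m m2 _ (next_mem hτ hN hk1)
    have s1 : ((k + 1 : ℕ) : ℝ) * τ - m = τ / 2 := by rw [hm]; push_cast; ring
    rw [s1, abs_of_pos (by positivity)] at e1
    have : K * (τ / 2) ^ 3 ≤ K * τ ^ 3 := by nlinarith
    refine le_trans (le_of_eq ?_) (e1.trans this)
    congr 1
    module
  · rw [gridVal, if_neg hk1]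
    have e1 := h m m2 _ m1
    have s1 : k * τ + 1 / 4 * τ - m = -(τ / 4) := by rw [hm]; ring
    rw [s1, abs_neg, abs_of_pos (by positivity)] at e1
    have e1' : ‖ψ (k * τ + 1 / 4 * τ) - (ψ m - (τ / 4) • D₁ m + (τ ^ 2 / 32) • D₂ m)‖
        ≤ K * τ ^ 3 / 64 := by
      convert e1 using 1
      · congr 1; module
      · ring
    have : ((k + 1 : ℕ) : ℝ) - 1 = k := by push_cast; ring
    rw [this, show τ / 4 = 1 / 4 * τ by ring,
      show k * τ + τ / 2 = m by rw [hm]; ring]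
    generalize ψ (k * τ) = a at *
    generalize ψ (k * τ + 1 / 4 * τ) = b at *
    have : (3 : ℝ) • a - (8 : ℝ) • b + (6 : ℝ) • ψ m - (ψ m + (τ / 2) • D₁ m + (τ ^ 2 / 8) • D₂ m)
        = (3 : ℝ) • (a - (ψ m - (τ / 2) • D₁ m + (τ ^ 2 / 8) • D₂ m))
          - (8 : ℝ) • (b - (ψ m - (τ / 4) • D₁ m + (τ ^ 2 / 32) • D₂ m)) := by
      module
    rw [this]
    refine (norm_sub_le _ _).trans ?_
    rw [norm_smul, norm_smul, Real.norm_of_nonneg (by norm_num), Real.norm_of_nonneg (by norm_num)]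
    linarith

/-- Consistency of the Crank-Nicolson discretization. -/
lemma MemWInfty.exists_crankNicolson_bound {T : ℝ} (hT : 0 < T) {ψ : ℝ → E}
    (h : MemWInfty 3 T ψ) :
    ∃ K : ℝ, 0 ≤ K ∧ ∀ (τ : ℝ) (N k : ℕ), 0 < τ → ((N : ℝ) - 1 / 2) * τ ≤ T → k < N →
      (∀ D, HasDerivWithinAt ψ D (Icc 0 T) ((k + 1 / 2 : ℝ) * τ) →
        ‖τ⁻¹ • (gridVal τ N ψ (k + 1) - gridVal τ N ψ k) - D‖ ≤ K * τ ^ 2) ∧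
      ‖(1 / 2 : ℝ) • (gridVal τ N ψ (k + 1) + gridVal τ N ψ k) - ψ ((k + 1 / 2 : ℝ) * τ)‖
        ≤ K * τ ^ 2 := by
  obtain ⟨D₁, D₂, K, hK, hd, h2, ht⟩ := h.exists_taylor
  refine ⟨2 * K + 2 * T * K, by positivity, fun τ N k hτ hN hk => ?_⟩
  obtain ⟨a0, a1⟩ := norm_gridVal_sub_taylor_le hτ hK hN hk ht rfl
  have m2 : (k + 1 / 2 : ℝ) * τ ∈ Icc 0 T := by
    have := mid_mem hτ hN hk (θ := 1 / 2) (by norm_num) (by norm_num)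
    rwa [← add_mul] at this
  have hτT : τ ≤ 2 * T := by
    have : (0 : ℝ) ≤ k := Nat.cast_nonneg k
    nlinarith [m2.2]
  set m := (k + 1 / 2 : ℝ) * τ
  set x := gridVal τ N ψ (k + 1)
  set y := gridVal τ N ψ k
  constructor
  · intro D hD
    have hDD : D = D₁ m := (uniqueDiffOn_Icc hT m m2).eq_deriv _ hD (hd m m2)
    subst hDD
    have : τ⁻¹ • (x - y) - D₁ m = τ⁻¹ • ((x - (ψ m + (τ / 2) • D₁ m + (τ ^ 2 / 8) • D₂ m))
        - (y - (ψ m - (τ / 2) • D₁ m + (τ ^ 2 / 8) • D₂ m))) := by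
      have e : (τ⁻¹ * τ) • D₁ m = D₁ m := by rw [inv_mul_cancel₀ hτ.ne', one_smul]
      nth_rewrite 1 [← e]
      module
    rw [this, norm_smul, Real.norm_of_nonneg (by positivity)]
    have h3 := norm_sub_le (x - (ψ m + (τ / 2) • D₁ m + (τ ^ 2 / 8) • D₂ m))
      (y - (ψ m - (τ / 2) • D₁ m + (τ ^ 2 / 8) • D₂ m))
    calc _ ≤ τ⁻¹ * (2 * K * τ ^ 3) := by gcongr; linarith
      _ = 2 * K * τ ^ 2 := by field_simp
      _ ≤ _ := by gcongr; linarith [mul_nonneg hT.le hK]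
  · have : (1 / 2 : ℝ) • (x + y) - ψ m = (1 / 2 : ℝ) •
        ((x - (ψ m + (τ / 2) • D₁ m + (τ ^ 2 / 8) • D₂ m))
        + (y - (ψ m - (τ / 2) • D₁ m + (τ ^ 2 / 8) • D₂ m))) + (τ ^ 2 / 8) • D₂ m := by
      module
    rw [this]
    refine (norm_add_le _ _).trans ?_
    rw [norm_smul, norm_smul, Real.norm_of_nonneg (by positivity),
      Real.norm_of_nonneg (by positivity)]
    have h3 := norm_add_le (x - (ψ m + (τ / 2) • D₁ m + (τ ^ 2 / 8) • D₂ m))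
      (y - (ψ m - (τ / 2) • D₁ m + (τ ^ 2 / 8) • D₂ m))
    have h4 : τ ^ 2 / 8 * ‖D₂ m‖ ≤ τ ^ 2 / 8 * K := by gcongr; exact h2 m m2
    have h5 : K * τ ^ 3 ≤ K * (2 * T) * τ ^ 2 := by
      rw [pow_succ', ← mul_assoc]; gcongr
    nlinarith [mul_nonneg hK (sq_nonneg τ)]

lemma MemWInfty.exists_second_difference_bound {T : ℝ} {ψ : ℝ → E} (h : MemWInfty 3 T ψ) :
    ∃ K : ℝ, 0 ≤ K ∧ ∀ τ t, 0 < τ → t - τ ∈ Icc 0 T → t + τ ∈ Icc 0 T →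
      ‖ψ (t + τ) - ψ t - (ψ t - ψ (t - τ))‖ ≤ K * τ ^ 2 := by
  obtain ⟨D₁, D₂, K, hK, hd, h2, ht⟩ := h.exists_taylor
  refine ⟨K + 2 * K * |T|, by positivity, fun τ t hτ h0 h1 => ?_⟩
  have hmem : t ∈ Icc 0 T := ⟨by linarith [h0.1], by linarith [h1.2]⟩
  have hτT : τ ≤ |T| := by
    rw [abs_of_nonneg (hmem.1.trans hmem.2)]; linarith [h1.2, h0.1]
  have e0 := ht t hmem _ h0
  have e1 := ht t hmem _ h1
  rw [show t - τ - t = -τ by ring, abs_neg, abs_of_pos hτ] at e0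
  rw [add_sub_cancel_left, abs_of_pos hτ] at e1
  have : ψ (t + τ) - ψ t - (ψ t - ψ (t - τ)) =
      (ψ (t + τ) - (ψ t + τ • D₁ t + (τ ^ 2 / 2) • D₂ t))
      + (ψ (t - τ) - (ψ t + (-τ) • D₁ t + ((-τ) ^ 2 / 2) • D₂ t)) + τ ^ 2 • D₂ t := by
    module
  rw [this]
  refine (norm_add_le _ _).trans ?_
  have h3 := norm_add_le (ψ (t + τ) - (ψ t + τ • D₁ t + (τ ^ 2 / 2) • D₂ t))
      (ψ (t - τ) - (ψ t + (-τ) • D₁ t + ((-τ) ^ 2 / 2) • D₂ t))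
  rw [norm_smul, Real.norm_of_nonneg (by positivity)]
  have h4 : τ ^ 2 * ‖D₂ t‖ ≤ τ ^ 2 * K := by gcongr; exact h2 t hmem
  have h5 : K * τ ^ 3 ≤ K * |T| * τ ^ 2 := by
    rw [pow_succ', ← mul_assoc]; gcongr
  linarith

end Time

/-! ### The spectral realization of the abstract scheme -/

/-- Square integrable vector fields with their Hilbert norm. -/
noncomputable abbrev Vel (d : ℕ) : Type := PiLp 2 fun _ : Fin d => L2 d

/-- The operators of the abstract scheme as multipliers. A velocity is represented by its image under
the square root of `1 - τ/2 Δ + τ²/4 B`, a pressure by its image under the square root of `A`. -/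
structure IsSpectral (τ : ℝ) (J G Z : Vel d →L[ℝ] Vel d) (D : Vel d →L[ℝ] L2 d) : Prop where
  emb : ∀ x i n, coef sinT n (x i) = √(msym τ n) * coef sinT n (J x i)
  grad : ∀ x i n, coef sinT n (G x i) = √(lsym n) * coef sinT n (J x i)
  split : ∀ x i n, coef sinT n (Z x i) = √(bsym d τ n) * coef sinT n (J x i)
  div : ∀ x n, coef cosT n (D x) =
    ∑ i, n i * Real.pi / √(asym n) * coef (Function.update cosT i true) n (J x i)

/-- The componentwise action of an operator. -/
noncomputable def componentwise (A : L2 d →L[ℝ] L2 d) : Vel d →L[ℝ] Vel d :=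
  ((PiLp.continuousLinearEquiv 2 ℝ fun _ : Fin d => L2 d).symm :
    (Fin d → L2 d) →L[ℝ] Vel d) ∘L
    ContinuousLinearMap.pi fun i => A ∘L (PiLp.proj 2 (fun _ : Fin d => L2 d) i)

lemma componentwise_apply (A : L2 d →L[ℝ] L2 d) (x : Vel d) (i : Fin d) :
    componentwise A x i = A (x i) := rfl

lemma div_sqrt_asym_le (n : Fin d → ℕ) (i : Fin d) : |n i * Real.pi / √(asym n)| ≤ 1 := by
  have h1 : 0 < asym n := zero_lt_one.trans_le (one_le_asym n)
  have h2 : freqSq (n i) ≤ asym n := by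
    have := freqSq_le_lsym n i
    have := one_add_lsym_le_asym n
    linarith
  rw [abs_of_nonneg (div_nonneg (mul_nonneg (Nat.cast_nonneg _) Real.pi_pos.le) (Real.sqrt_nonneg _)),
    div_le_one (Real.sqrt_pos.2 h1)]
  exact Real.le_sqrt_of_sq_le h2

lemma msym_pos (hd : d = 2 ∨ d = 3) {τ : ℝ} (hτ : 0 ≤ τ) (n : Fin d → ℕ) : 0 < msym τ n :=
  zero_lt_one.trans_le (one_le_msym hd hτ n)

lemma exists_isSpectral (hd : d = 2 ∨ d = 3) {τ : ℝ} (hτ : 0 < τ) :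
    ∃ (J G Z : Vel d →L[ℝ] Vel d) (D : Vel d →L[ℝ] L2 d), IsSpectral τ J G Z D := by
  have hM := fun n : Fin d → ℕ => msym_pos hd hτ.le n
  have hM1 := fun n : Fin d → ℕ => one_le_msym hd hτ.le n
  have hl := fun n : Fin d → ℕ => lsym_nonneg n
  have hb := fun n : Fin d → ℕ => bsym_nonneg hd hτ.le n
  have hsM := fun n : Fin d → ℕ => Real.sqrt_pos.2 (hM n)
  obtain ⟨A, hA⟩ := exists_multiplier (d := d) sinT sinT (fun n => (√(msym τ n))⁻¹) 1 (fun n _ => by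
    rw [abs_of_nonneg (inv_nonneg.2 (Real.sqrt_nonneg _))]
    exact inv_le_one_of_one_le₀ (Real.one_le_sqrt.2 (hM1 n))) subset_rfl
  obtain ⟨B, hB⟩ := exists_multiplier (d := d) sinT sinT (fun n => √(lsym n) / √(msym τ n))
    √(2 / τ) (fun n _ => by
      rw [← Real.sqrt_div (hl n), abs_of_nonneg (Real.sqrt_nonneg _)]
      apply Real.sqrt_le_sqrt
      rw [div_le_div_iff₀ (hM n) hτ]
      have : 0 ≤ τ ^ 2 / 4 * bsym d τ n := mul_nonneg (by positivity) (hb n)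
      unfold msym
      linarith) subset_rfl
  obtain ⟨C, hC⟩ := exists_multiplier (d := d) sinT sinT (fun n => √(bsym d τ n) / √(msym τ n))
    √(4 / τ ^ 2) (fun n _ => by
      rw [← Real.sqrt_div (hb n), abs_of_nonneg (Real.sqrt_nonneg _)]
      apply Real.sqrt_le_sqrt
      rw [div_le_div_iff₀ (hM n) (by positivity)]
      have : 0 ≤ τ / 2 * lsym n := mul_nonneg (by positivity) (hl n)
      unfold msym
      linarith) subset_rfl
  have hDi := fun i => exists_multiplier (d := d) (Function.update cosT i true) cosT
    (fun n => n i * Real.pi / √(asym n)) 1 (fun n _ => div_sqrt_asym_le n i)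
    (fun n _ j hj => by simp [cosT] at hj)
  choose Di hDi using hDi
  refine ⟨componentwise A, componentwise B, componentwise C,
    ∑ i, Di i ∘L PiLp.proj 2 (fun _ : Fin d => L2 d) i ∘L componentwise A,
    fun x i n => ?_, fun x i n => ?_, fun x i n => ?_, fun x n => ?_⟩
  · rw [componentwise_apply, hA, mul_inv_cancel_left₀ (hsM n).ne']
  · rw [componentwise_apply, componentwise_apply, hA, hB]; ring
  · rw [componentwise_apply, componentwise_apply, hA, hC]; ring
  · simp only [sum_apply, coef_sum, ContinuousLinearMap.comp_apply, hDi]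
    rfl

lemma hasSum_vel_inner (x y : Vel d) :
    HasSum (fun n => ∑ i, coef sinT n (x i) * coef sinT n (y i)) (inner ℝ x y) := by
  rw [PiLp.inner_apply]
  exact hasSum_sum fun i _ => hasSum_coef_mul_coef sinT (x i) (y i)

lemma hasSum_vel_norm (x : Vel d) : HasSum (fun n => ∑ i, coef sinT n (x i) ^ 2) (‖x‖ ^ 2) := by
  have := hasSum_vel_inner x x
  rw [real_inner_self_eq_norm_sq] at this
  simpa only [sq] using this

lemma vel_norm_le {x y : Vel d} (h : ∀ n ∈ Supp (sinT (d := d)), ∀ i,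
    coef sinT n (x i) ^ 2 ≤ coef sinT n (y i) ^ 2) : ‖x‖ ≤ ‖y‖ := by
  refine (abs_le_of_sq_le_sq' ?_ (norm_nonneg _)).2
  refine hasSum_le (fun n => Finset.sum_le_sum fun i _ => ?_) (hasSum_vel_norm x) (hasSum_vel_norm y)
  by_cases hn : n ∈ Supp sinT
  · exact h n hn i
  · simp [coef_eq_zero hn]

variable {τ : ℝ} {J G Z : Vel d →L[ℝ] Vel d} {D : Vel d →L[ℝ] L2 d}

lemma IsSpectral.hasSum_inner_grad (h : IsSpectral τ J G Z D) (x y : Vel d) :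
    HasSum (fun n => ∑ i, lsym n * (coef sinT n (J x i) * coef sinT n (J y i)))
      (inner ℝ (G x) (G y)) := by
  refine (hasSum_vel_inner (G x) (G y)).congr_fun fun n => Finset.sum_congr rfl fun i _ => ?_
  rw [h.grad, h.grad]
  linear_combination (-(coef sinT n (J x i) * coef sinT n (J y i))) * Real.mul_self_sqrt (lsym_nonneg n)

lemma IsSpectral.hasSum_inner_split (hd : d = 2 ∨ d = 3) (hτ : 0 < τ) (h : IsSpectral τ J G Z D)
    (x y : Vel d) :
    HasSum (fun n => ∑ i, bsym d τ n * (coef sinT n (J x i) * coef sinT n (J y i)))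
      (inner ℝ (Z x) (Z y)) := by
  refine (hasSum_vel_inner (Z x) (Z y)).congr_fun fun n => Finset.sum_congr rfl fun i _ => ?_
  rw [h.split, h.split]
  linear_combination (-(coef sinT n (J x i) * coef sinT n (J y i)))
    * Real.mul_self_sqrt (bsym_nonneg hd hτ.le n)

lemma IsSpectral.isSplitting (hd : d = 2 ∨ d = 3) (hτ : 0 < τ) (h : IsSpectral τ J G Z D) :
    IsSplitting τ J G Z D where
  inner_eq x y := by
    refine (hasSum_vel_inner x y).unique ?_
    convert ((hasSum_vel_inner (J x) (J y)).add ((h.hasSum_inner_grad x y).mul_left (τ / 2))).add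
      ((h.hasSum_inner_split hd hτ x y).mul_left (τ ^ 2 / 4)) using 2 with n
    simp only [Finset.mul_sum, ← Finset.sum_add_distrib]
    refine Finset.sum_congr rfl fun i _ => ?_
    rw [h.emb x, h.emb y]
    have := Real.mul_self_sqrt (msym_pos hd hτ.le n).le
    rw [mul_mul_mul_comm, this]
    unfold msym
    ring
  -- Cauchy-Schwarz in the sum over the components. The squared multipliers add up to `lsym n / asym
  -- n ≤ 1`.
  div_le x := by
    refine (abs_le_of_sq_le_sq' ?_ (norm_nonneg _)).2
    rw [PiLp.norm_sq_eq_of_L2]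
    refine hasSum_le (fun n => ?_) (hasSum_coef_sq cosT (D x))
      (hasSum_sum fun i _ => hasSum_coef_sq (Function.update cosT i true) (J x i))
    rw [h.div]
    refine (Finset.sum_mul_sq_le_sq_mul_sq _ _ _).trans ?_
    have ha : 0 < asym n := zero_lt_one.trans_le (one_le_asym n)
    have : ∑ i, (n i * Real.pi / √(asym n)) ^ 2 ≤ 1 := by
      simp only [div_pow, Real.sq_sqrt ha.le, ← Finset.sum_div]
      rw [div_le_one ha]
      have := one_add_lsym_le_asym n
      unfold lsym freqSq at this
      linarith
    exact mul_le_of_le_one_left (Finset.sum_nonneg fun _ _ => sq_nonneg _) this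
  emb_le x := vel_norm_le fun n hn i => by
    rw [h.grad, mul_pow, Real.sq_sqrt (lsym_nonneg n)]
    exact le_mul_of_one_le_left (sq_nonneg _) (one_le_lsym hd hn)
  grad_le x := vel_norm_le fun n hn i => by
    rw [h.grad, h.split, mul_pow, mul_pow, Real.sq_sqrt (lsym_nonneg n),
      Real.sq_sqrt (bsym_nonneg hd hτ.le n)]
    exact mul_le_mul_of_nonneg_right (lsym_le_bsym hd hτ.le hn) (sq_nonneg _)

/-- `J` divides by the square root of `msym`, so a field lies in its range as soon as multiplication
by this root leaves it in `L²`. -/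
lemma IsSpectral.exists_emb_eq (hd : d = 2 ∨ d = 3) (hτ : 0 < τ) (h : IsSpectral τ J G Z D)
    {e : Vec d} (he : ∀ i, ∃ y, ∀ n, coef sinT n y = √(msym τ n) * coef sinT n (e i)) :
    ∃ x, ∀ i, J x i = e i := by
  choose y hy using he
  refine ⟨WithLp.toLp 2 y, fun i => ext_coef sinT fun n => ?_⟩
  have h1 := h.emb (WithLp.toLp 2 y) i n
  have h2 : coef sinT n (y i) = √(msym τ n) * coef sinT n (J (WithLp.toLp 2 y) i) := h1
  rw [hy] at h2
  exact (mul_left_cancel₀ (Real.sqrt_pos.2 (msym_pos hd hτ.le n)).ne' h2).symm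

lemma IsSpectral.eq_zero (h : IsSpectral τ J G Z D) {x : Vel d} (hx : ∀ i, J x i = 0) : x = 0 := by
  ext1 i
  refine ext_coef sinT fun n => ?_
  rw [h.emb, hx]
  simp

/-- The pairing of a velocity with a pressure gradient. -/
lemma IsSpectral.sum_inner_grad (h : IsSpectral τ J G Z D) {q y : L2 d} {Γ : Vec d}
    (hy : ∀ n, coef cosT n y = √(asym n) * coef cosT n q) (hΓ : ∀ i, HasWD (unitIdx i) q (Γ i))
    (x : Vel d) : ∑ i, inner ℝ (Γ i) (J x i) = -inner ℝ y (D x) := by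
  have h1 := hasSum_sum (s := Finset.univ) fun i _ => (hΓ i).hasSum_inner (v := J x i)
  have h2 := (hasSum_coef_mul_coef cosT y (D x)).neg
  refine h1.unique (h2.congr_fun fun n => ?_)
  have ha : √(asym n) ≠ 0 := (Real.sqrt_pos.2 (zero_lt_one.trans_le (one_le_asym n))).ne'
  rw [hy, h.div, Finset.mul_sum, ← Finset.sum_neg_distrib]
  refine Finset.sum_congr rfl fun i _ => ?_
  field_simp

lemma IsSpectral.hasWDZeroTrace (h : IsSpectral τ J G Z D) (x : Vel d) (i j : Fin d) :
    ∃ g, HasWDZeroTrace j (J x i) g ∧ ‖g‖ ≤ ‖G x‖ := by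
  have hle : ∀ n, (n j * Real.pi * coef sinT n (J x i)) ^ 2 ≤ coef sinT n (G x i) ^ 2 := by
    intro n
    rw [h.grad, mul_pow, mul_pow (√(lsym n)), Real.sq_sqrt (lsym_nonneg n)]
    exact mul_le_mul_of_nonneg_right (freqSq_le_lsym n j) (sq_nonneg _)
  obtain ⟨g, hg⟩ := exists_coef_eq (Function.update sinT j false)
    (fun n => n j * Real.pi * coef sinT n (J x i))
    (Summable.of_nonneg_of_le (fun _ => sq_nonneg _) hle (hasSum_coef_sq sinT (G x i)).summable)
    (fun n hn => by
      rw [coef_eq_zero, mul_zero]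
      exact fun h' => hn fun k _ => h' k rfl)
  refine ⟨g, hasWDZeroTrace_of_coef hg, le_trans ?_ (PiLp.norm_apply_le (G x) i)⟩
  refine (abs_le_of_sq_le_sq' (hasSum_le (fun n => ?_) (hasSum_coef_sq (Function.update sinT j false) g)
    (hasSum_coef_sq sinT (G x i))) (norm_nonneg _)).2
  rw [hg]
  exact hle n

/-- By Green's formula the gradient moves onto the velocity, so only the `L²` norm of `q` enters.
This is the sole estimate available for the initial predictor, since `φ^{-1/2}` need not lie in the
form domain of `A`. -/
lemma IsSpectral.abs_sum_inner_grad_le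
    (h : IsSpectral τ J G Z D) {q : L2 d} {Γ : Vec d} (hΓ : ∀ i, HasWD (unitIdx i) q (Γ i))
    (x : Vel d) : |∑ i, inner ℝ (Γ i) (J x i)| ≤ d * ‖q‖ * ‖G x‖ := by
  have key : ∀ i, |inner ℝ (Γ i) (J x i)| ≤ ‖q‖ * ‖G x‖ := by
    intro i
    obtain ⟨g, hg, hn⟩ := h.hasWDZeroTrace x i i
    have : inner ℝ (Γ i) (J x i) = -inner ℝ q g := by
      refine ((hΓ i).hasSum_inner (v := J x i)).unique
        ((hasSum_coef_mul_coef cosT q g).neg.congr_fun fun n => ?_)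
      rw [hg.coef_eq (σ := cosT) rfl]
    rw [this, abs_neg]
    exact (abs_real_inner_le_norm _ _).trans (by gcongr)
  refine (Finset.abs_sum_le_sum_abs _ _).trans ((Finset.sum_le_sum fun i _ => key i).trans ?_)
  simp [mul_assoc]

/-- A pressure in the form domain of `A` has a gradient. -/
lemma inH1_of_coef_eq_sqrt_asym {q y : L2 d}
    (hy : ∀ n, coef cosT n y = √(asym n) * coef cosT n q) : InH1 q := by
  intro i
  have hs : Summable fun n => (-(n i * Real.pi) * coef cosT n q) ^ 2 := by
    refine Summable.of_nonneg_of_le (fun _ => sq_nonneg _) (fun n => ?_)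
      (hasSum_coef_sq cosT y).summable
    rw [hy, mul_pow, mul_pow (√(asym n)), Real.sq_sqrt (zero_le_one.trans (one_le_asym n)), neg_sq]
    refine mul_le_mul_of_nonneg_right ?_ (sq_nonneg _)
    have := freqSq_le_lsym n i
    have := one_add_lsym_le_asym n
    unfold freqSq at *
    linarith
  obtain ⟨g, hg⟩ := exists_coef_eq (Function.update cosT i true) _ hs fun n hn => by
    have : n i = 0 := by
      by_contra h0
      refine hn fun j hj => ?_
      rcases eq_or_ne j i with rfl | hji
      · exact h0
      · simp [hji, cosT] at hj
    simp [this]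
  exact ⟨g, hasWD_of_coef hg⟩

/-- A bound of the pairing with velocities bounds the norm `‖·‖_△`. -/
lemma IsSpectral.triNorm_le (hd : d = 2 ∨ d = 3) (hτ : 0 < τ) (h : IsSpectral τ J G Z D) {q y : L2 d}
    (hy : ∀ n, coef cosT n y = √(asym n) * coef cosT n q) {κ : ℝ} (hκ : 0 ≤ κ)
    (hb : ∀ x, |inner ℝ y (D x)| ≤ κ * ‖Z x‖) : triNorm τ q ≤ ENNReal.ofReal κ := by
  refine iSup_le fun ⟨v, hv, _⟩ => ENNReal.ofReal_le_ofReal ?_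
  obtain ⟨z, hz, hzn⟩ := hv.exists_coef_eq hd hτ.le
  have hbp : ∀ n ∈ Supp (sinT (d := d)), 1 ≤ bsym d τ n := fun n hn =>
    (one_le_lsym hd hn).trans (lsym_le_bsym hd hτ.le hn)
  -- Every `v` in `Z` must be realized as `J x`. On the sine frequencies `1 ≤ lsym ≤ bsym`, so `msym
  -- / bsym` is bounded for fixed `τ`; the bound does not enter the estimate.
  obtain ⟨A, hA⟩ := exists_multiplier (d := d) sinT sinT (fun n => √(msym τ n) / √(bsym d τ n))
    √(1 + τ / 2 + τ ^ 2 / 4) (fun n hn => by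
      have h0 := hbp n hn
      have h1 : 0 < bsym d τ n := by linarith
      have h2 := lsym_le_bsym hd hτ.le hn
      rw [← Real.sqrt_div (msym_pos hd hτ.le n).le, abs_of_nonneg (Real.sqrt_nonneg _)]
      apply Real.sqrt_le_sqrt
      rw [div_le_iff₀ h1]
      have : τ / 2 * lsym n ≤ τ / 2 * bsym d τ n := by gcongr
      unfold msym
      linarith) subset_rfl
  obtain ⟨x, hx⟩ := h.exists_emb_eq hd hτ (e := v) fun i => ⟨A (z i), fun n => by
    rw [hA, hz]
    by_cases hn : n ∈ Supp sinT
    · have : √(bsym d τ n) ≠ 0 := (Real.sqrt_pos.2 (by linarith [hbp n hn])).ne'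
      field_simp
    · simp [coef_eq_zero hn]⟩
  have hH1 := inH1_of_coef_eq_sqrt_asym hy
  have hpair := h.sum_inner_grad hy (Γ := fun i => wd (unitIdx i) q)
    (fun i => by
      obtain ⟨g, hg⟩ := hH1 i
      rw [hg.wd_eq]; exact hg) x
  have hZ : ‖Z x‖ = √(normBSq d τ v) := by
    rw [← hzn, eq_comm, Real.sqrt_eq_iff_mul_self_eq (by positivity) (by positivity), ← sq,
      PiLp.norm_sq_eq_of_L2]
    refine Finset.sum_congr rfl fun i _ => ?_
    have : Z x i = z i := ext_coef sinT fun n => by rw [h.split, hx, hz]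
    rw [this]
  simp only [hx] at hpair
  rw [hpair]
  refine div_le_of_le_mul₀ (Real.sqrt_nonneg _) hκ ?_
  rw [← hZ]
  exact (neg_le_abs _).trans (hb x)

lemma ellTwoTri_le {N : ℕ} {q : ℕ → L2 d} {κ : ℕ → ℝ} {C : ℝ} (hτ : 0 ≤ τ) (hC : 0 ≤ C)
    (hκ : ∀ k < N, 0 ≤ κ k ∧ triNorm τ (q k) ≤ ENNReal.ofReal (κ k))
    (h : τ * ∑ k ∈ Finset.range N, κ k ^ 2 ≤ C ^ 2) : ellTwoTri τ N q ≤ ENNReal.ofReal C := by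
  have h1 : ∑ k ∈ Finset.range N, triNorm τ (q k) ^ 2 ≤
      ENNReal.ofReal (∑ k ∈ Finset.range N, κ k ^ 2) := by
    rw [ENNReal.ofReal_sum_of_nonneg fun _ _ => sq_nonneg _]
    refine Finset.sum_le_sum fun k hk => ?_
    obtain ⟨h0, h1⟩ := hκ k (Finset.mem_range.1 hk)
    rw [ENNReal.ofReal_pow h0]
    gcongr
  unfold ellTwoTri
  calc _ ≤ (ENNReal.ofReal (C ^ 2)) ^ (1 / 2 : ℝ) := by
        gcongr
        refine (mul_le_mul_right h1 _).trans ?_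
        rw [← ENNReal.ofReal_mul hτ]
        exact ENNReal.ofReal_le_ofReal h
    _ = ENNReal.ofReal C := by
        rw [ENNReal.ofReal_rpow_of_nonneg (sq_nonneg _) (by norm_num), ← Real.sqrt_eq_rpow,
          Real.sqrt_sq hC]

/-! ### Consistency of the scheme -/

lemma mderiv_single_two (i : Fin d) (ψ : (Fin d → ℝ) → ℝ) :
    mderiv (Pi.single i 2) ψ = pderiv i (pderiv i ψ) := by
  have key : ∀ l : List (Fin d), l.Nodup →
      l.foldr (fun j χ => (pderiv j)^[(Pi.single i 2 : Fin d → ℕ) j] χ) ψ =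
        if i ∈ l then pderiv i (pderiv i ψ) else ψ := by
    intro l
    induction l with
    | nil => simp
    | cons j l ih =>
      intro hl
      rw [List.nodup_cons] at hl
      rw [List.foldr_cons, ih hl.2]
      rcases eq_or_ne j i with rfl | hj
      · simp [hl.1]
      · simp [hj, hj.symm]
  rw [mderiv, key _ (List.nodup_finRange d)]
  simp

lemma prod_single_two (n : Fin d → ℕ) (j : Fin d) :
    (∏ k, if (Pi.single j 2 : Fin d → ℕ) k = 2 then -freqSq (n k) else 1) = -freqSq (n j) := by
  rw [Finset.prod_eq_single j]
  · simp
  · intro k _ hk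
    simp [hk]
  · simp

lemma HasWD.coef_single_two {u g : L2 d} {j : Fin d} (h : HasWD (Pi.single j 2) u g)
    (hu : ZeroTrace u) (n : Fin d → ℕ) : coef sinT n g = -freqSq (n j) * coef sinT n u := by
  rw [h.coef_sin_two hu (fun k => ?_), prod_single_two]
  rcases eq_or_ne k j with rfl | hk
  · simp
  · simp [hk]

lemma HasWeakLaplacian.eq_sum {u g : L2 d} (h : HasWeakLaplacian u g) {W : Fin d → L2 d}
    (hW : ∀ j, HasWD (Pi.single j 2) u (W j)) : g = ∑ j, W j := by
  rw [← sub_eq_zero]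
  refine eq_zero_of_integral_test fun ψ hψ => ?_
  have hc := hψ.1.continuous
  have e : ∫ x in cube d, (∑ j, W j : L2 d) x * ψ x = ∑ j, ∫ x in cube d, W j x * ψ x := by
    simp only [← inner_toL2 hc, inner_sum]
  have h1 : ∀ j, ∫ x in cube d, u x * pderiv j (pderiv j ψ) x = ∫ x in cube d, W j x * ψ x := by
    intro j
    rw [← mderiv_single_two, hW j ψ hψ]
    simp
  rw [integral_sub_mul _ _ hc, e, ← h ψ hψ, sub_eq_zero]
  simp_rw [Finset.mul_sum]
  rw [integral_finsetSum _ fun j _ =>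
    integrable_mul_continuous u (contDiff_pderiv (contDiff_pderiv hψ.1)).continuous]
  exact Finset.sum_congr rfl fun j _ => h1 j

lemma HasWD.eq_of_zero {u g : L2 d} (h : HasWD 0 u g) : g = u := by
  rw [← sub_eq_zero]
  refine eq_zero_of_integral_test fun ψ hψ => ?_
  have h1 := h ψ hψ
  have h2 : mderiv (0 : Fin d → ℕ) ψ = ψ := by
    unfold mderiv
    induction List.finRange d with
    | nil => rfl
    | cons i l ih => simp only [List.foldr_cons, ih]; rfl
  rw [h2] at h1
  simp at h1
  rw [integral_sub_mul _ _ hψ.1.continuous, h1, sub_self]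

lemma MemWInfty.congr {E : Type*} [NormedAddCommGroup E] [NormedSpace ℝ E] [CompleteSpace E]
    {m : ℕ} {T : ℝ} {ψ χ : ℝ → E} (h : MemWInfty m T ψ) (he : ∀ t ∈ Icc 0 T, ψ t = χ t) :
    MemWInfty m T χ := by
  obtain ⟨D, h0, h1, h2⟩ := h
  exact ⟨D, fun t ht => (h0 t ht).trans (he t ht), h1, h2⟩

/-- A grid value is a fixed linear combination of values in `[0,T]`. Linear relations between
coefficients, such as incompressibility, therefore persist even at the extrapolated point. -/
lemma sum_coef_gridVal_eq_zero {ι : Type*} (s : Finset ι) {T τ : ℝ} {N k : ℕ} (hτ : 0 < τ)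
    (hN : ((N : ℝ) - 1 / 2) * τ ≤ T) (hN0 : 0 < N) (hk : k ≤ N) {a : ι → ℝ → L2 d}
    {σ : ι → Fin d → Bool} {n : Fin d → ℕ} {w : ι → ℝ}
    (h : ∀ t ∈ Icc 0 T, ∑ i ∈ s, w i * coef (σ i) n (a i t) = 0) :
    ∑ i ∈ s, w i * coef (σ i) n (gridVal τ N (a i) k) = 0 := by
  rcases hk.lt_or_eq with hlt | rfl
  · simp only [gridVal_of_lt hlt]
    exact h _ (by simpa using mid_mem hτ hN hlt (θ := 0) le_rfl (by norm_num))
  · obtain ⟨k, rfl⟩ : ∃ m, k = m + 1 := ⟨k - 1, by omega⟩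
    have hk' : k < k + 1 := Nat.lt_succ_self k
    have e0 := h _ (mid_mem hτ hN hk' (θ := 0) le_rfl (by norm_num))
    have e1 := h _ (mid_mem hτ hN hk' (θ := 1 / 4) (by norm_num) (by norm_num))
    have e2 := h _ (mid_mem hτ hN hk' (θ := 1 / 2) (by norm_num) (by norm_num))
    rw [zero_mul, add_zero] at e0
    rw [one_div, inv_mul_eq_div] at e1 e2
    have hc : ((k + 1 : ℕ) : ℝ) - 1 = k := by push_cast; ring
    simp only [gridVal, lt_irrefl, if_false, hc, coef_add, coef_sub, coef_smul]
    calc _ = 3 * (∑ i ∈ s, w i * coef (σ i) n (a i (k * τ)))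
          - 8 * (∑ i ∈ s, w i * coef (σ i) n (a i (k * τ + τ / 4)))
          + 6 * (∑ i ∈ s, w i * coef (σ i) n (a i (k * τ + τ / 2))) := by
          simp only [Finset.mul_sum, ← Finset.sum_add_distrib, ← Finset.sum_sub_distrib]
          exact Finset.sum_congr rfl fun i _ => by ring
      _ = 0 := by rw [e0, e1, e2]; ring

lemma coef_gridVal_eq {T τ : ℝ} {N k : ℕ} (hτ : 0 < τ)
    (hN : ((N : ℝ) - 1 / 2) * τ ≤ T) (hN0 : 0 < N) (hk : k ≤ N) {a b : ℝ → L2 d}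
    {σ : Fin d → Bool} {n : Fin d → ℕ} {w : ℝ}
    (h : ∀ t ∈ Icc 0 T, coef σ n (a t) = w * coef σ n (b t)) :
    coef σ n (gridVal τ N a k) = w * coef σ n (gridVal τ N b k) := by
  have := sum_coef_gridVal_eq_zero Finset.univ hτ hN hN0 hk (a := ![a, b]) (σ := fun _ => σ) (n := n)
    (w := ![1, -w]) (fun t ht => by simp [h t ht])
  simp at this
  linarith

/-- The truncation error in one component. -/
lemma exists_consistency_component (hd : d = 2 ∨ d = 3) {T : ℝ} (hT : 0 < T) {f ue : ℝ → Vec d}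
    {pe : ℝ → L2 d} (hsol : IsStokesSolution T f ue pe) (hueH2 : MemWInftyH2 3 T ue)
    (hueB : ∀ τ : ℝ, 0 < τ → MemWInftyDB τ 2 T ue) (i : Fin d) :
    ∃ K : ℝ, 0 ≤ K ∧ ∀ (τ : ℝ) (N : ℕ), 0 < τ → ((N : ℝ) - 1 / 2) * τ ≤ T → 0 < N →
      (∀ k ≤ N, ∃ w, ∀ n, coef sinT n w =
        msym τ n * coef sinT n (gridVal τ N (fun t => ue t i) k)) ∧
      ∀ k < N, ∃ r : L2 d, ‖r‖ ≤ K * τ ^ 2 ∧ ∃ grad,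
        HasWD (unitIdx i) (pe ((k + 1 / 2 : ℝ) * τ)) grad ∧ ∀ n,
        τ⁻¹ * (coef sinT n (gridVal τ N (fun t => ue t i) (k + 1))
            - coef sinT n (gridVal τ N (fun t => ue t i) k))
          + 1 / 2 * lsym n * (coef sinT n (gridVal τ N (fun t => ue t i) (k + 1))
            + coef sinT n (gridVal τ N (fun t => ue t i) k))
          + τ / 4 * bsym d τ n * (coef sinT n (gridVal τ N (fun t => ue t i) (k + 1))
            - coef sinT n (gridVal τ N (fun t => ue t i) k))
          + coef sinT n grad = coef sinT n (f ((k + 1 / 2 : ℝ) * τ) i) + coef sinT n r := by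
  have hU : MemWInfty 3 T fun t => ue t i := by
    obtain ⟨W, h1, h2⟩ := hueH2 i 0 (by simp)
    exact h2.congr fun t ht => (h1 t ht).eq_of_zero
  choose W hW hWm using fun j => hueH2 i (Pi.single j 2) (by simp)
  -- The two parameters `2` and `4` suffice for all `τ`, by `bsym_eq`.
  obtain ⟨hz2, -, B₂, hB₂, hB₂m⟩ := hueB 2 (by norm_num)
  obtain ⟨-, -, B₄, hB₄, hB₄m⟩ := hueB 4 (by norm_num)
  have hz : ∀ t ∈ Icc 0 T, ∀ i, ZeroTrace (ue t i) := fun t ht i => (hz2 t ht i).exists_hasWDZeroTrace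
  obtain ⟨K₁, hK₁, h1⟩ := hU.exists_crankNicolson_bound hT
  choose K₂ hK₂ h2 using fun j => (hWm j).exists_crankNicolson_bound hT
  obtain ⟨K₃, hK₃, h3⟩ := (hB₂m i).exists_lipschitz (by norm_num)
  obtain ⟨K₄, hK₄, h4⟩ := (hB₄m i).exists_lipschitz (by norm_num)
  have hK₂s : 0 ≤ ∑ j, K₂ j := Finset.sum_nonneg fun j _ => hK₂ j
  refine ⟨K₁ + ∑ j, K₂ j + (5 / 2 + 2 * T) * (K₃ + K₄), by positivity, fun τ N hτ hN hN0 => ?_⟩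
  have cW : ∀ k ≤ N, ∀ n j, coef sinT n (gridVal τ N (W j) k) =
      -freqSq (n j) * coef sinT n (gridVal τ N (fun t => ue t i) k) := fun k hk n j =>
    coef_gridVal_eq hτ hN hN0 hk fun t ht => (hW j t ht).coef_single_two (hz t ht i) n
  have c2 : ∀ k ≤ N, ∀ n, coef sinT n (gridVal τ N (fun t => B₂ t i) k) =
      bsym d 2 n * coef sinT n (gridVal τ N (fun t => ue t i) k) := fun k hk n =>
    coef_gridVal_eq hτ hN hN0 hk fun t ht => (hB₂ t ht).coef_eq hd (hz t ht) i n
  have c4 : ∀ k ≤ N, ∀ n, coef sinT n (gridVal τ N (fun t => B₄ t i) k) =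
      bsym d 4 n * coef sinT n (gridVal τ N (fun t => ue t i) k) := fun k hk n =>
    coef_gridVal_eq hτ hN hN0 hk fun t ht => (hB₄ t ht).coef_eq hd (hz t ht) i n
  constructor
  · intro k hk
    refine ⟨gridVal τ N (fun t => ue t i) k - (τ / 2) • ∑ j, gridVal τ N (W j) k
      + (τ ^ 2 / 4) • ((2 : ℝ) • gridVal τ N (fun t => B₂ t i) k - gridVal τ N (fun t => B₄ t i) k
        - (τ / 2) • (gridVal τ N (fun t => B₂ t i) k - gridVal τ N (fun t => B₄ t i) k)), fun n => ?_⟩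
    simp only [coef_add, coef_sub, coef_smul, coef_sum, cW k hk, c2 k hk, c4 k hk, ← Finset.sum_mul,
      Finset.sum_neg_distrib]
    rw [msym, bsym_eq hd τ n, lsym]
    ring
  · intro k hk
    have hmem : (k + 1 / 2 : ℝ) * τ ∈ Icc 0 T := by
      have := mid_mem hτ hN hk (θ := 1 / 2) (by norm_num) (by norm_num)
      rwa [← add_mul] at this
    have hτT : τ ≤ 2 * T := by
      have : (0 : ℝ) ≤ k := Nat.cast_nonneg k
      nlinarith [hmem.2]
    obtain ⟨lap, grad, hlap, hgrad, hder⟩ := hsol.momentum _ ⟨by positivity, hmem.2⟩ i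
    have hlap' := hlap.eq_sum fun j => hW j _ hmem
    obtain ⟨e1, -⟩ := h1 τ N k hτ hN hk
    have e1 := e1 _ hder
    have e2 := fun j => (h2 j τ N k hτ hN hk).2
    have e3 := norm_gridVal_succ_sub_le hτ hK₃ hN hk h3
    have e4 := norm_gridVal_succ_sub_le hτ hK₄ hN hk h4
    set m := (k + 1 / 2 : ℝ) * τ with hm
    set r₁ := τ⁻¹ • (gridVal τ N (fun t => ue t i) (k + 1) - gridVal τ N (fun t => ue t i) k)
      - (f m i + lap - grad) with hr₁
    set r₂ := fun j => (1 / 2 : ℝ) • (gridVal τ N (W j) (k + 1) + gridVal τ N (W j) k) - W j m with hr₂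
    set r₃ := gridVal τ N (fun t => B₂ t i) (k + 1) - gridVal τ N (fun t => B₂ t i) k with hr₃
    set r₄ := gridVal τ N (fun t => B₄ t i) (k + 1) - gridVal τ N (fun t => B₄ t i) k with hr₄
    -- The residual collects the Crank-Nicolson errors of the time derivative and of the Laplacian,
    -- and the splitting term. The latter is `τ/4` times an increment of `B u`, hence of order `τ²`
    -- by Lipschitz continuity in time.
    refine ⟨r₁ - ∑ j, r₂ j + (τ / 4) • ((2 : ℝ) • r₃ - r₄ - (τ / 2) • (r₃ - r₄)), ?_, grad, hgrad,
      fun n => ?_⟩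
    · have n2 : ‖∑ j, r₂ j‖ ≤ (∑ j, K₂ j) * τ ^ 2 := by
        rw [Finset.sum_mul]
        exact norm_sum_le_of_le _ fun j _ => e2 j
      have n3 : ‖(2 : ℝ) • r₃ - r₄ - (τ / 2) • (r₃ - r₄)‖ ≤
          2 * ‖r₃‖ + ‖r₄‖ + T * (‖r₃‖ + ‖r₄‖) := by
        refine (norm_sub_le _ _).trans (add_le_add ((norm_sub_le _ _).trans ?_) ?_)
        · rw [norm_smul, Real.norm_of_nonneg (by norm_num)]
        · rw [norm_smul, Real.norm_of_nonneg (by positivity)]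
          gcongr
          · linarith
          · exact norm_sub_le _ _
      have n4 : ‖(τ / 4) • ((2 : ℝ) • r₃ - r₄ - (τ / 2) • (r₃ - r₄))‖ ≤
          (5 / 2 + 2 * T) * (K₃ + K₄) * τ ^ 2 := by
        rw [norm_smul, Real.norm_of_nonneg (by positivity)]
        calc _ ≤ τ / 4 * (2 * (5 * K₃ * τ) + 5 * K₄ * τ + T * (5 * K₃ * τ + 5 * K₄ * τ)) := by
              gcongr
              refine n3.trans ?_
              gcongr
          _ = (5 / 2 * K₃ + 5 / 4 * K₄ + 5 / 4 * T * (K₃ + K₄)) * τ ^ 2 := by ring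
          _ ≤ _ := by
            gcongr
            nlinarith [mul_nonneg hT.le hK₃, mul_nonneg hT.le hK₄]
      calc _ ≤ ‖r₁‖ + ‖∑ j, r₂ j‖ + ‖(τ / 4) • ((2 : ℝ) • r₃ - r₄ - (τ / 2) • (r₃ - r₄))‖ :=
            (norm_add_le _ _).trans (add_le_add_left (norm_sub_le _ _) _)
        _ ≤ _ := by linarith
    · have cm : ∀ j, coef sinT n (W j m) = -freqSq (n j) * coef sinT n (ue m i) := fun j =>
        (hW j m hmem).coef_single_two (hz m hmem i) n
      simp only [hr₁, hr₂, hr₃, hr₄, hlap', coef_add, coef_sub, coef_smul, coef_sum, cW k hk.le,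
        cW (k + 1) hk, c2 k hk.le, c2 (k + 1) hk, c4 k hk.le, c4 (k + 1) hk, cm,
        Finset.sum_sub_distrib, ← Finset.mul_sum, Finset.sum_add_distrib, ← Finset.sum_mul,
        Finset.sum_neg_distrib]
      rw [bsym_eq hd τ n, lsym]
      ring

/-- The truncation error. -/
lemma exists_consistency (hd : d = 2 ∨ d = 3) {T : ℝ} (hT : 0 < T) {f ue : ℝ → Vec d}
    {pe : ℝ → L2 d} (hsol : IsStokesSolution T f ue pe) (hueH2 : MemWInftyH2 3 T ue)
    (hueB : ∀ τ : ℝ, 0 < τ → MemWInftyDB τ 2 T ue) :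
    ∃ K : ℝ, 0 ≤ K ∧ ∀ (τ : ℝ) (N : ℕ), 0 < τ → ((N : ℝ) - 1 / 2) * τ ≤ T → 0 < N →
      ∃ (U : ℕ → Vec d) (R : ℕ → Vel d), U 0 = ue 0 ∧
      (∀ k ≤ N, ∀ i, ∃ w, ∀ n, coef sinT n w = msym τ n * coef sinT n (U k i)) ∧
      (∀ k ≤ N, ∀ n : Fin d → ℕ,
        ∑ i, n i * Real.pi * coef (Function.update cosT i true) n (U k i) = 0) ∧
      (∀ k < N, ‖R k‖ ≤ K * τ ^ 2) ∧
      ∀ k < N, ∃ grad : Vec d, (∀ i, HasWD (unitIdx i) (pe ((k + 1 / 2 : ℝ) * τ)) (grad i)) ∧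
        ∀ i n, τ⁻¹ * (coef sinT n (U (k + 1) i) - coef sinT n (U k i))
          + 1 / 2 * lsym n * (coef sinT n (U (k + 1) i) + coef sinT n (U k i))
          + τ / 4 * bsym d τ n * (coef sinT n (U (k + 1) i) - coef sinT n (U k i))
          + coef sinT n (grad i) = coef sinT n (f ((k + 1 / 2 : ℝ) * τ) i) + coef sinT n (R k i) := by
  choose K hK h using fun i => exists_consistency_component hd hT hsol hueH2 hueB i
  refine ⟨∑ i, K i, Finset.sum_nonneg fun i _ => hK i, fun τ N hτ hN hN0 => ?_⟩
  have h' := fun i => h i τ N hτ hN hN0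
  have hr : ∀ k, ∃ r : Vel d, k < N → ∀ i, ‖r i‖ ≤ K i * τ ^ 2 ∧ ∃ grad,
        HasWD (unitIdx i) (pe ((k + 1 / 2 : ℝ) * τ)) grad ∧ ∀ n,
        τ⁻¹ * (coef sinT n (gridVal τ N (fun t => ue t i) (k + 1))
            - coef sinT n (gridVal τ N (fun t => ue t i) k))
          + 1 / 2 * lsym n * (coef sinT n (gridVal τ N (fun t => ue t i) (k + 1))
            + coef sinT n (gridVal τ N (fun t => ue t i) k))
          + τ / 4 * bsym d τ n * (coef sinT n (gridVal τ N (fun t => ue t i) (k + 1))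
            - coef sinT n (gridVal τ N (fun t => ue t i) k))
          + coef sinT n grad = coef sinT n (f ((k + 1 / 2 : ℝ) * τ) i) + coef sinT n (r i) := by
    intro k
    by_cases hk : k < N
    · choose r hr using fun i => (h' i).2 k hk
      exact ⟨WithLp.toLp 2 r, fun _ i => hr i⟩
    · exact ⟨0, fun hk' => absurd hk' hk⟩
  choose R hR using hr
  refine ⟨fun k i => gridVal τ N (fun t => ue t i) k, R, ?_, fun k hk i => (h' i).1 k hk,
    fun k hk n => ?_, fun k hk => ?_, fun k hk => ?_⟩
  · funext i
    simp [gridVal_of_lt hN0]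
  · refine sum_coef_gridVal_eq_zero Finset.univ hτ hN hN0 hk
      (σ := fun i => Function.update cosT i true) fun t ht => ?_
    rw [← (hsol.incompressible t ht).coef_eq
      fun i => ((hueB 2 (by norm_num)).1 t ht i).exists_hasWDZeroTrace i, coef_zero]
  · rw [Finset.sum_mul]
    have h1 : ‖R k‖ ≤ ∑ i, ‖R k i‖ := by
      refine (abs_le_of_sq_le_sq' ?_ (Finset.sum_nonneg fun _ _ => norm_nonneg _)).2
      rw [PiLp.norm_sq_eq_of_L2]
      exact Finset.sum_sq_le_sq_sum_of_nonneg fun _ _ => norm_nonneg _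
    exact h1.trans (Finset.sum_le_sum fun i _ => (hR k hk i).1)
  · choose grad hg using fun i => (hR k hk i).2
    exact ⟨grad, fun i => (hg i).1, fun i => (hg i).2⟩

/-- The pressure in the form domain of `A`. -/
lemma exists_pressure_coordinates {T : ℝ} {pe : ℝ → L2 d} (hpe : MemWInftyY 3 T pe) :
    ∃ (Y : ℝ → L2 d) (K : ℝ), 0 ≤ K ∧
      (∀ t ∈ Icc 0 T, ∀ n, coef cosT n (Y t) = √(asym n) * coef cosT n (pe t)) ∧
      (∀ s ∈ Icc 0 T, ∀ t ∈ Icc 0 T, ‖Y t - Y s‖ ≤ K * |t - s|) ∧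
      ∀ τ t, 0 < τ → t - τ ∈ Icc 0 T → t + τ ∈ Icc 0 T →
        ‖Y (t + τ) - Y t - (Y t - Y (t - τ))‖ ≤ K * τ ^ 2 := by
  choose W hW hWm using fun S : Finset (Fin d) => hpe.2 (mixedIdx S) (mixedIdx_le S)
  choose K₁ hK₁ h1 using fun S => (hWm S).exists_lipschitz (by norm_num)
  choose K₂ hK₂ h2 using fun S => (hWm S).exists_second_difference_bound
  have hY : ∀ t, ∃ y : L2 d, t ∈ Icc 0 T → ∀ n, coef cosT n y = √(asym n) * coef cosT n (pe t) := by
    intro t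
    by_cases ht : t ∈ Icc 0 T
    · obtain ⟨y, hy, -⟩ := exists_coef_eq_sqrt_asym fun S => hW S t ht
      exact ⟨y, fun _ => hy⟩
    · exact ⟨0, fun h => absurd h ht⟩
  choose Y hY using hY
  have hs1 : 0 ≤ ∑ S, K₁ S := Finset.sum_nonneg fun S _ => hK₁ S
  have hs2 : 0 ≤ ∑ S, K₂ S := Finset.sum_nonneg fun S _ => hK₂ S
  refine ⟨Y, ∑ S, K₁ S + ∑ S, K₂ S, by positivity, hY, fun s hs t ht => ?_,
    fun τ t hτ h0 h3 => ?_⟩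
  · obtain ⟨y, hy, hn⟩ := exists_coef_eq_sqrt_asym fun S => (hW S t ht).sub (hW S s hs)
    have : Y t - Y s = y := ext_coef cosT fun n => by
      rw [coef_sub, hY t ht, hY s hs, hy, coef_sub]; ring
    rw [this, add_mul, Finset.sum_mul]
    refine hn.trans ((Finset.sum_le_sum fun S _ => h1 S s hs t ht).trans ?_)
    exact le_add_of_nonneg_right (mul_nonneg hs2 (abs_nonneg _))
  · have ht : t ∈ Icc 0 T := ⟨by linarith [h0.1], by linarith [h3.2]⟩
    obtain ⟨y, hy, hn⟩ := exists_coef_eq_sqrt_asym fun S =>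
      ((hW S _ h3).sub (hW S t ht)).sub ((hW S t ht).sub (hW S _ h0))
    have : Y (t + τ) - Y t - (Y t - Y (t - τ)) = y := ext_coef cosT fun n => by
      simp only [coef_sub, hY t ht, hY _ h0, hY _ h3, hy]; ring
    rw [this, add_mul, Finset.sum_mul _ _ (τ ^ 2)]
    refine hn.trans ((Finset.sum_le_sum fun S _ => h2 S τ t hτ h0 h3).trans ?_)
    rw [← Finset.sum_mul, ← Finset.sum_mul]
    exact le_add_of_nonneg_left (mul_nonneg hs1 (sq_nonneg _))

/-! ### The error equations -/

lemma IsSpectral.momentum_eq (hd : d = 2 ∨ d = 3) (hτ : 0 < τ) (h : IsSpectral τ J G Z D)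
    {e e' : Vel d} {r : Vec d}
    (hr : ∀ i n, τ⁻¹ * (coef sinT n (J e' i) - coef sinT n (J e i))
      + 1 / 2 * lsym n * (coef sinT n (J e' i) + coef sinT n (J e i))
      + τ / 4 * bsym d τ n * (coef sinT n (J e' i) - coef sinT n (J e i)) = coef sinT n (r i))
    (v : Vel d) : momentum τ J G Z e e' v = ∑ i, inner ℝ (r i) (J v i) := by
  have h1 := (hasSum_vel_inner (J (e' - e)) (J v)).mul_left τ⁻¹
  have h2 := (h.hasSum_inner_grad (e' + e) v).mul_left (1 / 2)
  have h3 := (h.hasSum_inner_split hd hτ (e' - e) v).mul_left (τ / 4)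
  refine ((h1.add h2).add h3).unique
    ((hasSum_sum fun i _ => hasSum_coef_mul_coef sinT (r i) (J v i)).congr_fun fun n => ?_)
  simp only [Finset.mul_sum, ← Finset.sum_add_distrib]
  refine Finset.sum_congr rfl fun i _ => ?_
  rw [← hr i n, map_sub, map_add, PiLp.sub_apply, PiLp.add_apply, coef_sub, coef_add]
  ring

lemma IsSpectral.exists_emb_eq_of_msym (hd : d = 2 ∨ d = 3) (hτ : 0 < τ) (h : IsSpectral τ J G Z D)
    {e : Vec d} (he : ∀ i, ∃ w, ∀ n, coef sinT n w = msym τ n * coef sinT n (e i)) :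
    ∃ x, ∀ i, J x i = e i := by
  choose w hw using he
  refine h.exists_emb_eq hd hτ fun i => ⟨J (WithLp.toLp 2 w) i, fun n => ?_⟩
  have h1 : coef sinT n (w i) = √(msym τ n) * coef sinT n (J (WithLp.toLp 2 w) i) :=
    h.emb (WithLp.toLp 2 w) i n
  have hM := msym_pos hd hτ.le n
  refine mul_left_cancel₀ (Real.sqrt_pos.2 hM).ne' ?_
  rw [← h1, hw, ← mul_assoc, Real.mul_self_sqrt hM.le]

/-- The velocity step preserves the regularity of the velocity. -/
lemma IsSpectral.exists_emb_eq_of_step (hd : d = 2 ∨ d = 3) (hτ : 0 < τ)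
    (h : IsSpectral τ J G Z D) {Γ F u u' : Vec d} (hs : VelocityStep d τ Γ F u u')
    (hu : ∃ x, ∀ i, J x i = u i) : ∃ x, ∀ i, J x i = u' i := by
  obtain ⟨x, hx⟩ := hu
  have hM := fun n : Fin d → ℕ => msym_pos hd hτ.le n
  have hz : ∀ i, ZeroTrace (u i) := fun i j => by
    obtain ⟨g, hg, -⟩ := h.hasWDZeroTrace x i j
    exact ⟨g, hx i ▸ hg⟩
  obtain ⟨A, hA⟩ := exists_multiplier (d := d) sinT sinT (fun n => lsym n / msym τ n) (2 / τ)
    (fun n _ => by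
      rw [abs_of_nonneg (div_nonneg (lsym_nonneg n) (hM n).le), div_le_div_iff₀ (hM n) hτ]
      have : 0 ≤ τ ^ 2 / 4 * bsym d τ n := mul_nonneg (by positivity) (bsym_nonneg hd hτ.le n)
      unfold msym
      linarith) subset_rfl
  set y : Vel d := J (WithLp.toLp 2 fun i => F i - Γ i) with hy
  -- The step reads `msym u' = msym u - τ lsym u + τ (F - Γ)`. Dividing by the root of `msym` gives
  -- this witness, since `lsym / msym` is bounded by `2 / τ`.
  refine h.exists_emb_eq hd hτ fun i => ⟨x i - τ • A (x i) + τ • y i, fun n => ?_⟩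
  have e1 := hs.coef_eq hd hτ hz i n
  have e2 : coef sinT n (F i - Γ i) = √(msym τ n) * coef sinT n (y i) :=
    h.emb (WithLp.toLp 2 fun i => F i - Γ i) i n
  have e3 := h.emb x i n
  have hss := Real.mul_self_sqrt (hM n).le
  have hs0 := (Real.sqrt_pos.2 (hM n)).ne'
  rw [coef_sub] at e2
  simp only [coef_add, coef_sub, coef_smul, hA, e3, hx]
  refine mul_left_cancel₀ hs0 ?_
  rw [← mul_assoc (√_) (√_), hss]
  have e4 : √(msym τ n) * (√(msym τ n) * coef sinT n (u i)
      - τ * (lsym n / msym τ n * (√(msym τ n) * coef sinT n (u i))) + τ * coef sinT n (y i)) =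
      msym τ n * coef sinT n (u i) - τ * lsym n * coef sinT n (u i)
        + τ * (coef sinT n (F i) - coef sinT n (Γ i)) := by
    rw [e2]
    have hm0 := (hM n).ne'
    calc _ = (√(msym τ n) * √(msym τ n)) * coef sinT n (u i)
        - τ * (lsym n * ((√(msym τ n) * √(msym τ n)) / msym τ n) * coef sinT n (u i))
        + τ * (√(msym τ n) * coef sinT n (y i)) := by ring
      _ = _ := by rw [hss, div_self hm0]; ring
  rw [e4, ← e1, msym]
  field_simp
  ring

/-- The times of the pressures: the initial pressure, then the midpoints. -/
noncomputable def pressureTime (τ : ℝ) : ℕ → ℝ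
  | 0 => 0
  | k + 1 => (k + 1 / 2 : ℝ) * τ

lemma pressureTime_mem {T : ℝ} {N k : ℕ} (hT : 0 ≤ T) (hτ : 0 < τ)
    (hN : ((N : ℝ) - 1 / 2) * τ ≤ T) (hk : k ≤ N) : pressureTime τ k ∈ Icc 0 T := by
  cases k with
  | zero => exact ⟨le_rfl, hT⟩
  | succ k =>
    have := mid_mem hτ hN hk (θ := 1 / 2) (by norm_num) (by norm_num)
    rwa [← add_mul] at this

lemma abs_pressureTime_sub_le (hτ : 0 < τ) (k : ℕ) :
    |pressureTime τ (k + 1) - pressureTime τ k| ≤ τ := by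
  cases k with
  | zero =>
    simp only [pressureTime]
    rw [abs_of_nonneg (by simp; positivity)]
    simp
    linarith
  | succ k =>
    simp only [pressureTime]
    have : ((k + 1 : ℕ) + 1 / 2 : ℝ) * τ - (k + 1 / 2 : ℝ) * τ = τ := by push_cast; ring
    rw [this, abs_of_pos hτ]

/-- The penalty step in the coordinates of the abstract scheme. -/
lemma IsSpectral.coef_div_of_penalty (hτ : 0 < τ) (h : IsSpectral τ J G Z D)
    {u U : Vec d} {φ g : L2 d} {x : Vel d} (hx : ∀ i, J x i = U i - u i)
    (hu : ∀ i, ∃ k, HasWDZeroTrace i (u i) k)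
    (hU : ∀ n : Fin d → ℕ, ∑ i, n i * Real.pi * coef (Function.update cosT i true) n (U i) = 0)
    (hg : HasWeakDiv u g) (hA : HasA d φ (-(τ⁻¹ • g))) (n : Fin d → ℕ) :
    coef cosT n (τ⁻¹ • D x) = √(asym n) * coef cosT n φ := by
  have ha : 0 < asym n := zero_lt_one.trans_le (one_le_asym n)
  have hs := Real.mul_self_sqrt ha.le
  have hs0 := (Real.sqrt_pos.2 ha).ne'
  have e1 := hA.coef_eq n
  have e2 := hg.coef_eq hu n
  have e3 : coef cosT n (D x) = -(coef cosT n g) / √(asym n) := by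
    have e : -(coef cosT n g) = (∑ i, n i * Real.pi * coef (Function.update cosT i true) n (U i))
        - coef cosT n g := by rw [hU n, zero_sub]
    rw [h.div, e, e2, ← Finset.sum_sub_distrib, Finset.sum_div]
    refine Finset.sum_congr rfl fun i _ => ?_
    rw [hx, coef_sub]
    ring
  rw [coef_neg, coef_smul] at e1
  rw [coef_smul, e3]
  refine mul_left_cancel₀ hs0 ?_
  rw [← mul_assoc (√_) (√_), hs, ← e1]
  field_simp

end DirSplit

/-- First-order convergence of the pressure of the standard direction splitting scheme in the
norm `ℓ²(△)`. The sum runs over the pressure errors `ε^{k+1/2} = p(t_{k+1/2}) - p^{k+1/2}`,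
`k < N`, for any number `N` of steps with all the times `t_{k+1/2} = (k+1/2)τ` in `[0,T]`. -/
theorem mainTheorem3 (d : ℕ) (hd : d = 2 ∨ d = 3) (T : ℝ) (hT : 0 < T)
    (f ue : ℝ → Vec d) (pe : ℝ → L2 d)
    (hf : ∀ i, MemWInfty 3 T fun t => f t i)
    (hsol : IsStokesSolution T f ue pe)
    (hueH2 : MemWInftyH2 3 T ue)
    (hueB : ∀ τ : ℝ, 0 < τ → MemWInftyDB τ 2 T ue)
    (hpe : MemWInftyY 3 T pe)
    (c₀ : ℝ) :
    ∃ c : ℝ, ∀ (τ : ℝ) (N : ℕ), 0 < τ → ((N : ℝ) - 1 / 2) * τ ≤ T →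
      ∀ (u : ℕ → Vec d) (p φ : ℕ → L2 d),
        IsStandardScheme τ N f (ue 0) (pe 0) u p φ →
        ‖pe (τ / 2) - (p 0 + φ 0)‖ ≤ c₀ * τ →
        (∀ k < N, InH1 (pe ((k + 1 / 2 : ℝ) * τ) - p (k + 1))) ∧
        ellTwoTri τ N (fun k => pe ((k + 1 / 2 : ℝ) * τ) - p (k + 1)) ≤
          ENNReal.ofReal (c * τ) := by
  obtain ⟨K, hK, hcons⟩ := exists_consistency hd hT hsol hueH2 hueB
  obtain ⟨Y, K', hK', hY, hY1, hY2⟩ := exists_pressure_coordinates hpe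
  have hC : 0 ≤ K + K' + d * |c₀| := by positivity
  obtain ⟨c, hc, hbound⟩ := exists_pressure_bound (V := Vel d) (H := Vel d) (P := L2 d) T
    -- One constant bounds the residual, the pressure increments and the initial predictor error;
    -- the factor `d` comes from `IsSpectral.abs_sum_inner_grad_le`.
    (K + K' + d * |c₀|) hT hC
  refine ⟨c, fun τ N hτ hN u p φ hsch hinit => ?_⟩
  rcases Nat.eq_zero_or_pos N with rfl | hN0
  · exact ⟨fun k hk => absurd hk (Nat.not_lt_zero k), ellTwoTri_le (κ := 0) hτ.le (by positivity)
      (fun k hk => absurd hk (Nat.not_lt_zero k)) (by simp; positivity)⟩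
  obtain ⟨J, G, Z, D, h⟩ := exists_isSpectral hd hτ
  obtain ⟨U, R, hU0, hUreg, hUdiv, hR, hmom⟩ := hcons τ N hτ hN hN0
  choose Γ hΓ hstep using hsch.velocity
  have hu : ∀ k ≤ N, ∃ x, ∀ i, J x i = u k i := by
    intro k
    induction k with
    | zero =>
      intro _
      rw [hsch.initial_velocity, ← hU0]
      exact h.exists_emb_eq_of_msym hd hτ (hUreg 0 hN0.le)
    | succ k ih =>
      intro hk
      exact h.exists_emb_eq_of_step hd hτ (hstep k hk) (ih (Nat.le_of_succ_le hk))
  have huz : ∀ k ≤ N, ∀ i, ZeroTrace (u k i) := fun k hk i j => by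
    obtain ⟨x, hx⟩ := hu k hk
    obtain ⟨g, hg, -⟩ := h.hasWDZeroTrace x i j
    exact ⟨g, hx i ▸ hg⟩
  have hE : ∀ k, ∃ x, k ≤ N → ∀ i, J x i = U k i - u k i := by
    intro k
    by_cases hk : k ≤ N
    · obtain ⟨x, hx⟩ := hu k hk
      obtain ⟨y, hy⟩ := h.exists_emb_eq_of_msym hd hτ (hUreg k hk)
      exact ⟨y - x, fun _ i => by rw [map_sub, PiLp.sub_apply, hx, hy]⟩
    · exact ⟨0, fun hk' => absurd hk' hk⟩
  choose E hE using hE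
  have hE0 : E 0 = 0 := h.eq_zero fun i => by
    rw [hE 0 hN0.le, hU0, hsch.initial_velocity, sub_self]
  -- The first increment covers only the time `τ/2`, all others `τ`; second differences are
  -- therefore of order `τ²` only from `k = 1` on.
  set δ : ℕ → L2 d := fun k => Y (pressureTime τ (k + 1)) - Y (pressureTime τ k) with hδ
  set α : ℕ → L2 d := fun k => Nat.rec 0 (fun k a => a + δ k - τ⁻¹ • D (E (k + 1))) k with hα
  have hα0 : α 0 = 0 := rfl
  have hαs : ∀ k, α (k + 1) = α k + δ k - τ⁻¹ • D (E (k + 1)) := fun k => rfl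
  have hmem := fun k (hk : k ≤ N) => pressureTime_mem hT.le hτ hN hk
  have hδc : ∀ k < N, ∀ n, coef cosT n (δ k) = √(asym n) *
      (coef cosT n (pe (pressureTime τ (k + 1))) - coef cosT n (pe (pressureTime τ k))) := by
    intro k hk n
    simp only [hδ]
    rw [coef_sub, hY _ (hmem _ hk), hY _ (hmem _ hk.le), mul_sub]
  have hφ : ∀ k < N, ∀ n, coef cosT n (τ⁻¹ • D (E (k + 1))) = √(asym n) * coef cosT n (φ (k + 1)) := by
    intro k hk n
    obtain ⟨g, hg, hA⟩ := hsch.penalty k hk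
    exact h.coef_div_of_penalty hτ (hE (k + 1) hk) (fun i => huz (k + 1) hk i i)
      (hUdiv (k + 1) hk) hg hA n
  -- The recursively defined `α` is identified with the pressure error. In particular the latter
  -- lies in the form domain of `A`, which is not assumed of the discrete pressures.
  have hαc : ∀ k ≤ N, ∀ n, coef cosT n (α k) =
      √(asym n) * coef cosT n (pe (pressureTime τ k) - p k) := by
    intro k
    induction k with
    | zero =>
      intro _ n
      rw [hα0, hsch.initial_pressure]
      simp [pressureTime]
    | succ k ih =>
      intro hk n
      rw [hαs, coef_sub, coef_add, ih (Nat.le_of_succ_le hk), hφ k hk,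
        hδc k hk, hsch.pressure k hk]
      simp only [coef_sub, coef_add]
      ring
  have hmom' : ∀ (k : ℕ) (hk : k < N), ∃ Γ' : Vec d,
      (∀ i, HasWD (unitIdx i) (pe (pressureTime τ (k + 1)) - (p k + φ k)) (Γ' i)) ∧
      ∀ v, momentum τ J G Z (E k) (E (k + 1)) v =
        inner ℝ (R k) (J v) - ∑ i, inner ℝ (Γ' i) (J v i) := by
    intro k hk
    obtain ⟨grad, hgrad, heq⟩ := hmom k hk
    refine ⟨fun i => grad i - Γ k hk i, fun i => (hgrad i).sub (hΓ k hk i), fun v => ?_⟩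
    rw [h.momentum_eq hd hτ (r := fun i => R k i - (grad i - Γ k hk i)) (fun i n => ?_)]
    · simp only [inner_sub_left, Finset.sum_sub_distrib, PiLp.inner_apply]
    · have e1 := heq i n
      have e2 := (hstep k hk).coef_eq hd hτ (huz k hk.le) i n
      rw [hE k hk.le, hE (k + 1) hk]
      simp only [coef_sub]
      linear_combination e1 - e2
  choose Γ' hΓ' hmom' using hmom'
  have hδ1 : ∀ k < N, ‖δ k‖ ≤ K' * τ := fun k hk =>
    (hY1 _ (hmem k hk.le) _ (hmem (k + 1) hk)).trans
      (mul_le_mul_of_nonneg_left (abs_pressureTime_sub_le hτ k) hK')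
  obtain ⟨κ, hκ, hsum⟩ : ∃ κ : ℕ → ℝ,
      (∀ k < N, 0 ≤ κ k ∧ ∀ v, |inner ℝ (α (k + 1)) (D v)| ≤ κ k * ‖Z v‖) ∧
        τ * ∑ k ∈ Finset.range N, κ k ^ 2 ≤ (c * τ) ^ 2 := by
    refine hbound τ N hτ hN J G Z D (h.isSplitting hd hτ) E α δ R
      -- In the first step the gradient of the predictor error stays a mere functional, because `φ
      -- 0` is not produced by a penalty step.
      (fun v => -∑ i, inner ℝ (Γ' 0 hN0 i) (J v i)) hE0 hα0 (fun k _ => hαs k) (fun v => ?_)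
      (fun _ v => by rw [hmom' 0 hN0, sub_eq_add_neg]) (fun k hk1 hk v => ?_) (fun k hk => ?_)
      (fun k hk => ?_) (fun k hk1 hk => ?_)
    · rw [abs_neg]
      refine (h.abs_sum_inner_grad_le (hΓ' 0 hN0) v).trans ?_
      have e : pressureTime τ (0 + 1) = τ / 2 := by simp [pressureTime]; ring
      rw [e]
      refine mul_le_mul_of_nonneg_right ?_ (norm_nonneg _)
      have : c₀ * τ ≤ |c₀| * τ := mul_le_mul_of_nonneg_right (le_abs_self _) hτ.le
      calc _ ≤ (d : ℝ) * (|c₀| * τ) := by gcongr; exact hinit.trans this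
        _ ≤ _ := by
          have := mul_nonneg (add_nonneg hK hK') hτ.le
          linarith
    · rw [hmom' k hk, sub_eq_add_neg, h.sum_inner_grad (y := α k + δ k - τ⁻¹ • D (E k)) (fun n => ?_)
        (hΓ' k hk), neg_neg]
      -- For `k ≥ 1` the increment `φ k` in the predictor comes from the preceding penalty step, so
      -- it equals `τ⁻¹ D (E k)` in the coordinates of `A`.
      obtain ⟨j, rfl⟩ : ∃ j, k = j + 1 := ⟨k - 1, by omega⟩
      rw [coef_sub, coef_add, hαc _ hk.le, hφ j (Nat.lt_of_succ_lt hk), hδc _ hk]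
      simp only [coef_sub, coef_add]
      ring
    · refine (hR k hk).trans (mul_le_mul_of_nonneg_right ?_ (sq_nonneg _))
      linarith [mul_nonneg (Nat.cast_nonneg (α := ℝ) d) (abs_nonneg c₀)]
    · refine (hδ1 k hk).trans (mul_le_mul_of_nonneg_right ?_ hτ.le)
      linarith [mul_nonneg (Nat.cast_nonneg (α := ℝ) d) (abs_nonneg c₀)]
    · obtain ⟨j, rfl⟩ : ∃ j, k = j + 1 := ⟨k - 1, by omega⟩
      have h0 := hmem (j + 1) (by omega)
      have h2 := hmem (j + 1 + 1 + 1) hk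
      have e0 : pressureTime τ (j + 1) = pressureTime τ (j + 1 + 1) - τ := by
        simp only [pressureTime]; push_cast; ring
      have e2 : pressureTime τ (j + 1 + 1 + 1) = pressureTime τ (j + 1 + 1) + τ := by
        simp only [pressureTime]; push_cast; ring
      rw [e0] at h0
      rw [e2] at h2
      simp only [hδ]
      rw [e2, e0]
      refine (hY2 τ _ hτ h0 h2).trans (mul_le_mul_of_nonneg_right ?_ (sq_nonneg _))
      linarith [mul_nonneg (Nat.cast_nonneg (α := ℝ) d) (abs_nonneg c₀)]
  have hc : ∀ k < N, ∀ n, coef cosT n (α (k + 1)) =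
      √(asym n) * coef cosT n (pe ((k + 1 / 2 : ℝ) * τ) - p (k + 1)) := fun k hk => hαc (k + 1) hk
  exact ⟨fun k hk => inH1_of_coef_eq_sqrt_asym (hc k hk),
    ellTwoTri_le hτ.le (by positivity)
      (fun k hk => ⟨(hκ k hk).1, h.triNorm_le hd hτ (hc k hk) (hκ k hk).1 (hκ k hk).2⟩) hsum⟩
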